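/- Let $H$ be a fixed finite connected undirected graph, possibly with loops, in which every vertex has at most two neighbours, where a vertex with a loop counts as a neighbour of itself. An instance of List $H$-Coloring is a pair $(G,L)$, where $G$ is a finite simple graph and $L$ assigns to every vertex $v$ of $G$ a set $L(v)\subseteq V(H)$; the question is whether there is a map $\varphi:V(G)\to V(H)$ such that $\varphi(u)\varphi(v)\in E(H)$ for every edge $uv$ of $G$ and $\varphi(v)\in L(v)$ for every vertex $v$ of $G$. Let $C_k$ denote the (loopless) cycle on $k$ vertices, and let $P^*_k$ denote the graph obtained from a path on $k$ vertices by adding a loop at each of its two endvertices. Then, for instances $(G,L)$ in which $G$ has $n$ vertices and diameter exactly $3$ (in particular, $G$ is connected), List $H$-Coloring can be solved by a deterministic algorithm 1. in time polynomial in $n$, if $H$ is not isomorphic to any of $C_3, C_5, C_6, C_7, P^*_3, P^*_4$; 2. in time $2^{\mathcal{O}(n^{2/3}\log^{2/3} n)}$, if $H$ is isomorphic to one of $C_3, C_5, C_6, C_7, P^*_3, P^*_4$. The algorithm and the constants in the time bounds may depend on $H$. Running time is measured on a random access machine with unit-cost addition, truncated subtraction, comparison and indirect addressing; the input consists of $n$,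 the adjacency matrix of $G$ and the incidence matrix of $L$. -/

import Mathlib

/-! ### Graphs with possible loops -/

/-- An undirected graph in which loops are allowed (and multiple edges are not). -/
structure LoopGraph (V : Type*) where
  Adj : V → V → Prop
  symm : ∀ ⦃x y : V⦄, Adj x y → Adj y x

namespace LoopGraph

/-- The neighbours of `x`; a vertex with a loop is a neighbour of itself. -/
def neighborSet {V : Type*} (H : LoopGraph V) (x : V) : Set V := {y | H.Adj x y}

/-- The number of neighbours of `x`, where a loop at `x` contributes one. -/
noncomputable def degree {V : Type*} (H : LoopGraph V) (x : V) : ℕ := (H.neighborSet x).ncard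

/-- Connectedness (the graph has at least one vertex; loops play no role). -/
def Connected {V : Type*} (H : LoopGraph V) : Prop := (SimpleGraph.fromRel H.Adj).Connected

/-- Isomorphism of graphs with possible loops. -/
def Isomorphic {V W : Type*} (H : LoopGraph V) (K : LoopGraph W) : Prop :=
  Nonempty (H.Adj ≃r K.Adj)

/-- The loopless cycle on `k` vertices, for `3 ≤ k`. -/
def cycle (k : ℕ) : LoopGraph (Fin k) where
  Adj := (SimpleGraph.cycleGraph k).Adj
  symm := fun _ _ h => h.symm

/-- The path on `k` vertices with a loop added on each of its two endvertices. -/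
def loopedPath (k : ℕ) : LoopGraph (Fin k) where
  Adj i j := (SimpleGraph.pathGraph k).Adj i j ∨ (i = j ∧ (i.val = 0 ∨ i.val + 1 = k))
  symm := by
    rintro i j (h | ⟨rfl, h⟩)
    · exact Or.inl h.symm
    · exact Or.inr ⟨rfl, h⟩

/-- `H` is one of `C₃, C₅, C₆, C₇, P*₃, P*₄`, up to isomorphism. -/
def IsExceptional {V : Type*} (H : LoopGraph V) : Prop :=
  H.Isomorphic (cycle 3) ∨ H.Isomorphic (cycle 5) ∨ H.Isomorphic (cycle 6) ∨
    H.Isomorphic (cycle 7) ∨ H.Isomorphic (loopedPath 3) ∨ H.Isomorphic (loopedPath 4)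

/-- There is a list homomorphism from `(G, L)` to `H`. -/
def HasListHom {V W : Type*} (H : LoopGraph W) (G : SimpleGraph V) (L : V → Finset W) : Prop :=
  ∃ φ : V → W, (∀ u v, G.Adj u v → H.Adj (φ u) (φ v)) ∧ ∀ v, φ v ∈ L v

end LoopGraph

/-! ### Random access machines

A structured program works on variables and (two-dimensional, initially blank) arrays of natural
numbers. Indirect addressing is allowed, but the arithmetic is restricted to addition, truncated
subtraction and comparison. Every node of an evaluated expression and every executed command costs
one time unit, so each stored number gains at most one bit per time unit, and `T` time units are
simulated by a Turing machine in time polynomial in `T` and the input length (and conversely). -/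

namespace RAM

structure Store where
  /-- contents of the variables -/
  var : ℕ → ℕ
  /-- contents of the arrays: `arr a i j` is entry `(i, j)` of array number `a` -/
  arr : ℕ → ℕ → ℕ → ℕ

inductive Expr where
  | const (m : ℕ)
  | var (x : ℕ)
  | get (a : ℕ) (i j : Expr)
  | add (e f : Expr)
  | sub (e f : Expr)
  | eq (e f : Expr)
  | lt (e f : Expr)

namespace Expr

/-- The value of an expression; comparisons return `1` for true and `0` for false. -/
def val (s : Store) : Expr → ℕ
  | const m => m
  | var x => s.var x
  | get a i j => s.arr a (val s i) (val s j)
  | add e f => val s e + val s f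
  | sub e f => val s e - val s f
  | eq e f => if val s e = val s f then 1 else 0
  | lt e f => if val s e < val s f then 1 else 0

/-- The time to evaluate an expression: its number of nodes. -/
def cost : Expr → ℕ
  | const _ => 1
  | var _ => 1
  | get _ i j => cost i + cost j + 1
  | add e f => cost e + cost f + 1
  | sub e f => cost e + cost f + 1
  | eq e f => cost e + cost f + 1
  | lt e f => cost e + cost f + 1

end Expr

inductive Program where
  | skip
  | assign (x : ℕ) (e : Expr)
  | put (a : ℕ) (i j e : Expr)
  | seq (p q : Program)
  | cond (e : Expr) (p q : Program)
  | loop (e : Expr) (p : Program)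

/-- Write the value `m` to the variable `x`. -/
def Store.setVar (s : Store) (x m : ℕ) : Store :=
  { s with var := fun y => if y = x then m else s.var y }

/-- Write the value `m` to entry `(i, j)` of array number `a`. -/
def Store.setArr (s : Store) (a i j m : ℕ) : Store :=
  { s with arr := fun b i' j' => if b = a ∧ i' = i ∧ j' = j then m else s.arr b i' j' }

/-- `Exec p s t s'`: started in `s`, the program `p` halts after exactly `t` time units, in `s'`.
`cond e p q` runs `p` if the value of `e` is not `0` and `q` otherwise; `loop e p` runs `p` as long
as the value of `e` is not `0`. -/
inductive Exec : Program → Store → ℕ → Store → Prop where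
  | skip (s : Store) : Exec .skip s 1 s
  | assign (x : ℕ) (e : Expr) (s : Store) :
      Exec (.assign x e) s (e.cost + 1) (s.setVar x (e.val s))
  | put (a : ℕ) (i j e : Expr) (s : Store) :
      Exec (.put a i j e) s (i.cost + j.cost + e.cost + 1)
        (s.setArr a (i.val s) (j.val s) (e.val s))
  | seq {p q : Program} {s s' s'' : Store} {t t' : ℕ} :
      Exec p s t s' → Exec q s' t' s'' → Exec (.seq p q) s (t + t') s''
  | condTrue {e : Expr} {p q : Program} {s s' : Store} {t : ℕ} :
      e.val s ≠ 0 → Exec p s t s' → Exec (.cond e p q) s (e.cost + 1 + t) s'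
  | condFalse {e : Expr} {p q : Program} {s s' : Store} {t : ℕ} :
      e.val s = 0 → Exec q s t s' → Exec (.cond e p q) s (e.cost + 1 + t) s'
  | loopTrue {e : Expr} {p : Program} {s s' s'' : Store} {t t' : ℕ} :
      e.val s ≠ 0 → Exec p s t s' → Exec (.loop e p) s' t' s'' →
        Exec (.loop e p) s (e.cost + 1 + t + t') s''
  | loopFalse {e : Expr} {p : Program} {s : Store} :
      e.val s = 0 → Exec (.loop e p) s (e.cost + 1) s

/-- Programs are deterministic: the running time and the final store are determined. -/
theorem Exec.deterministic {p : Program} {s s₁ s₂ : Store} {t₁ t₂ : ℕ}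
    (h₁ : Exec p s t₁ s₁) (h₂ : Exec p s t₂ s₂) : t₁ = t₂ ∧ s₁ = s₂ := by
  induction h₁ generalizing t₂ s₂ with
  | skip s => cases h₂; exact ⟨rfl, rfl⟩
  | assign x e s => cases h₂; exact ⟨rfl, rfl⟩
  | put a i j e s => cases h₂; exact ⟨rfl, rfl⟩
  | seq _ _ ih ih' =>
    cases h₂ with
    | seq h h' =>
      obtain ⟨rfl, rfl⟩ := ih h
      obtain ⟨rfl, rfl⟩ := ih' h'
      exact ⟨rfl, rfl⟩
  | condTrue he _ ih =>
    cases h₂ with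
    | condTrue _ h => obtain ⟨rfl, rfl⟩ := ih h; exact ⟨rfl, rfl⟩
    | condFalse he' _ => exact absurd he' he
  | condFalse he _ ih =>
    cases h₂ with
    | condTrue he' _ => exact absurd he he'
    | condFalse _ h => obtain ⟨rfl, rfl⟩ := ih h; exact ⟨rfl, rfl⟩
  | loopTrue he _ _ ih ih' =>
    cases h₂ with
    | loopTrue _ h h' =>
      obtain ⟨rfl, rfl⟩ := ih h
      obtain ⟨rfl, rfl⟩ := ih' h'
      exact ⟨rfl, rfl⟩
    | loopFalse he' => exact absurd he' he
  | loopFalse he =>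
    cases h₂ with
    | loopTrue he' _ _ => exact absurd he he'
    | loopFalse _ => exact ⟨rfl, rfl⟩

end RAM

/-! ### The computational problem -/

namespace ListColoring

open Classical in
/-- The initial store for the instance `(G, L)`: variable `0` holds the number `n` of vertices,
array `0` the adjacency matrix of `G`, array `1` the incidence matrix of the lists, and everything
else is `0`. -/
noncomputable def input {k n : ℕ} (G : SimpleGraph (Fin n)) (L : Fin n → Finset (Fin k)) :
    RAM.Store where
  var x := if x = 0 then n else 0
  arr a i j :=
    if a = 0 ∧ ∃ (hi : i < n) (hj : j < n), G.Adj ⟨i, hi⟩ ⟨j, hj⟩ then 1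
    else if a = 1 ∧ ∃ (hi : i < n) (hj : j < k), (⟨j, hj⟩ : Fin k) ∈ L ⟨i, hi⟩ then 1
    else 0

open Classical in
/-- The program `p` decides, for every instance `(G, L)` of List `H`-Coloring where `G` is an
`n`-vertex graph of diameter `d`, whether there is a list homomorphism from `(G, L)` to `H`, and it
halts within `T n` time units. The answer (`1` for yes, `0` for no) is left in variable `0`. -/
def SolvesInTime {k : ℕ} (H : LoopGraph (Fin k)) (d : ℕ) (p : RAM.Program) (T : ℕ → ℝ) : Prop :=
  ∀ (n : ℕ) (G : SimpleGraph (Fin n)) (L : Fin n → Finset (Fin k)), G.ediam = d →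
    ∃ (t : ℕ) (s : RAM.Store), RAM.Exec p (input G L) t s ∧ (t : ℝ) ≤ T n ∧
      s.var 0 = if H.HasListHom G L then 1 else 0

end ListColoring

/-!
# List `H`-colouring on graphs of diameter three, for `H` of maximum degree two

A connected graph `H` of maximum degree two is a cycle, or a path with or without loops at its
ends (`LoopGraph.exists_numbering`, by means of a longest path). Both algorithms rest on path
consistency: pairs of assignments "the vertex `u` gets the colour `a`" are deleted as long as some
pair does not extend to some third vertex. If the remaining pairs are preserved by a majority
operation and every vertex keeps a colour, then there is a solution
(`ListColoring.exists_isSolution`). This is used for two majority operations.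

* *Labellings.* If the colours in the lists can be labelled with integers such that `a` and `b`
  are adjacent if and only if `0 ≤ ω a + ω b ≤ 1`, then the median with respect to `ω` is
  preserved. There is such a labelling for a path with at most one loop, for a path of at most two
  vertices with loops at both ends, and for the cycle of length four. In the other cases that are
  not exceptional there are two vertices of `H` at distance at least four (in a cycle of length at
  least eight, or at the ends of a path with at least five vertices). As the diameter of `G` is
  three, a solution avoids one of them, and without it `H` becomes a path with at most one loop.
  So two runs of path consistency suffice (`ListColoring.exists_labellings`,
  `ListColoring.exists_polynomial_program`).

* *Two colours per vertex.* If path consistency leaves at most two colours for each vertex, then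
  the operation "the second argument if it equals the third, else the first" is preserved. The
  exceptional graphs `H` contain no two vertices with two common neighbours. For them the
  algorithm searches for a certificate that reduces the instance to this case
  (`ListColoring.exists_certificate`). For a threshold `δ` it first guesses about `n k / δ`
  assignments. As long as some assignment of a solution makes at least `δ` lists smaller, it can
  be chosen, so that in the end every assignment of the solution affects fewer than `δ` lists, and
  the colours without this property can be deleted. Then a vertex with at least two colours
  `a ≠ a'` has at most `2 δ` neighbours with at least two colours, since any such neighbour is
  affected by `a` or by `a'`. A vertex with a neighbour of fixed colour keeps at most two colours.
  Let `v₀` be a vertex with three colours all of whose neighbours have at least two. Guess the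
  colours of the at most `1 + 2 δ + 4 δ²` vertices with at least two colours within two steps from
  `v₀`. Any other vertex of the same kind as `v₀` lies within distance three from `v₀`, so it now
  has a neighbour of fixed colour, or a fixed colour itself.

There are `(n k) ^ O(n / δ) * k ^ O(δ²) * n` certificates to try. With `δ³ ≈ n log n` the
logarithm of this number is `O((n log n) ^ (2 / 3))`.

The programs are written in a small language of loops and bounded sums, whose semantics is a
function on stores. It is compiled to the machine with a running time that is polynomial in a
bound for the variables that control loops and sums (`RAM.Cmd.exec_compile`).
-/

/-! ### A language of bounded sums, and its compilation -/

namespace RAM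

@[simp] theorem Store.setVar_var (s : Store) (x m y : ℕ) :
    (s.setVar x m).var y = if y = x then m else s.var y := rfl

@[simp] theorem Store.setVar_arr (s : Store) (x m : ℕ) : (s.setVar x m).arr = s.arr := rfl

@[simp] theorem Store.setArr_var (s : Store) (a i j m : ℕ) : (s.setArr a i j m).var = s.var := rfl

theorem Store.setArr_arr (s : Store) (a i j m b i' j' : ℕ) :
    (s.setArr a i j m).arr b i' j' = if b = a ∧ i' = i ∧ j' = j then m else s.arr b i' j' := rfl

/-- The binary operations of the machine. -/
inductive BinOp where
  | add | sub | eq | lt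

/-- The function computed by a binary operation. -/
def BinOp.app : BinOp → ℕ → ℕ → ℕ
  | add, a, b => a + b
  | sub, a, b => a - b
  | eq, a, b => if a = b then 1 else 0
  | lt, a, b => if a < b then 1 else 0

/-- The machine expression for a binary operation. -/
def BinOp.expr : BinOp → Expr → Expr → Expr
  | add => Expr.add
  | sub => Expr.sub
  | eq => Expr.eq
  | lt => Expr.lt

theorem BinOp.val_expr (o : BinOp) (s : Store) (e f : Expr) :
    (o.expr e f).val s = o.app (e.val s) (f.val s) := by
  cases o <;> rfl

theorem BinOp.cost_expr (o : BinOp) (e f : Expr) : (o.expr e f).cost = e.cost + f.cost + 1 := by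
  cases o <;> rfl

/-- Machine expressions extended by bounded sums: `sum x r e` is the sum of `e` over the values
`0, 1, …` of the variable `x` below the value of the variable `r`.

The variables below `8` are reserved for sizes: only they may bound sums and loops, and no sum or
loop may run over them. The variables from `100` on are reserved for intermediate results. -/
inductive SumExpr where
  | const (m : ℕ)
  | var (x : ℕ)
  | get (a : ℕ) (i j : SumExpr)
  | bin (o : BinOp) (e f : SumExpr)
  | sum (x r : ℕ) (e : SumExpr)

namespace SumExpr

/-- The value of an expression with bounded sums. -/
def val : SumExpr → Store → ℕ
  | const m, _ => m
  | var x, s => s.var x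
  | get a i j, s => s.arr a (i.val s) (j.val s)
  | bin o e f, s => o.app (e.val s) (f.val s)
  | sum x r e, s => ∑ i ∈ Finset.range (s.var r), e.val (s.setVar x i)

/-- The conventions on reserved variables are respected. -/
def Ok : SumExpr → Prop
  | const _ => True
  | var x => x < 100
  | get _ i j => i.Ok ∧ j.Ok
  | bin _ e f => e.Ok ∧ f.Ok
  | sum x r e => (8 ≤ x ∧ x < 100) ∧ r < 8 ∧ e.Ok

/-- The array `b` occurs in the expression. -/
def Reads (b : ℕ) : SumExpr → Prop
  | const _ => False
  | var _ => False
  | get a i j => b = a ∨ i.Reads b ∨ j.Reads b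
  | bin _ e f => e.Reads b ∨ f.Reads b
  | sum _ _ e => e.Reads b

theorem val_congr {e : SumExpr} (he : e.Ok) {s s' : Store}
    (hv : ∀ x < 100, s.var x = s'.var x) (ha : ∀ b, e.Reads b → s.arr b = s'.arr b) :
    e.val s = e.val s' := by
  induction e generalizing s s' with
  | const m => rfl
  | var x => exact hv x he
  | get a i j hi hj =>
    simp only [val]
    rw [ha a (Or.inl rfl), hi he.1 hv fun b hb => ha b (Or.inr (Or.inl hb)),
      hj he.2 hv fun b hb => ha b (Or.inr (Or.inr hb))]
  | bin o e f ihe ihf =>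
    simp only [val]
    rw [ihe he.1 hv fun b hb => ha b (Or.inl hb), ihf he.2 hv fun b hb => ha b (Or.inr hb)]
  | sum x r e ih =>
    simp only [val]
    rw [hv r (by have := he.2.1; omega)]
    refine Finset.sum_congr rfl fun i _ => ih he.2.2 ?_ ha
    intro y hy
    simp [hv y hy]

/-- A program that stores the value of the expression in the variable `d`, and changes no other
variables than those from `d` on. -/
def compile : SumExpr → ℕ → Program
  | const m, d => .assign d (.const m)
  | var x, d => .assign d (.var x)
  | get a i j, d =>
    .seq (i.compile d) (.seq (j.compile (d + 1)) (.assign d (.get a (.var d) (.var (d + 1)))))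
  | bin o e f, d =>
    .seq (e.compile d) (.seq (f.compile (d + 1)) (.assign d (o.expr (.var d) (.var (d + 1)))))
  | sum x r e, d =>
    .seq (.assign d (.var r)) <| .seq (.assign (d + 1) (.const 0)) <|
    .seq (.assign (d + 2) (.var x)) <| .seq (.assign x (.const 0)) <|
    .seq (.loop (.lt (.var x) (.var d)) <|
      .seq (e.compile (d + 3)) <|
      .seq (.assign (d + 1) (.add (.var (d + 1)) (.var (d + 3))))
        (.assign x (.add (.var x) (.const 1)))) <|
    .seq (.assign x (.var (d + 2))) (.assign d (.var (d + 1)))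

/-- A bound for the time to evaluate an expression, as a polynomial in a bound for the sizes. -/
noncomputable def time : SumExpr → Polynomial ℕ
  | const _ => 2
  | var _ => 2
  | get _ i j => i.time + j.time + 4
  | bin _ e f => e.time + f.time + 4
  | sum _ _ e => Polynomial.X * (e.time + 12) + 16

end SumExpr

/-- All size variables are bounded by `M`. -/
def Store.SizeLE (s : Store) (M : ℕ) : Prop := ∀ r < 8, s.var r ≤ M

theorem Store.SizeLE.setVar {s : Store} {M : ℕ} (h : s.SizeLE M) {x : ℕ} (hx : 8 ≤ x) (m : ℕ) :
    (s.setVar x m).SizeLE M := by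
  intro r hr
  simpa [show r ≠ x by omega] using h r hr

/-- A loop whose body is executed `m` times, in at most `T` time units each. -/
theorem Exec.loop_of_invariant {e : Expr} {p : Program} (m T : ℕ) (I : ℕ → Store → Prop)
    (hstep : ∀ i < m, ∀ s, I i s →
      e.val s ≠ 0 ∧ ∃ t s', Exec p s t s' ∧ t ≤ T ∧ I (i + 1) s')
    (hend : ∀ s, I m s → e.val s = 0) (s : Store) (hs : I 0 s) :
    ∃ t s', Exec (.loop e p) s t s' ∧ t ≤ m * (e.cost + 1 + T) + (e.cost + 1) ∧ I m s' := by
  suffices H : ∀ r i, i + r = m → ∀ s, I i s →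
      ∃ t s', Exec (.loop e p) s t s' ∧ t ≤ r * (e.cost + 1 + T) + (e.cost + 1) ∧ I m s' from
    H m 0 (by omega) s hs
  intro r
  induction r with
  | zero =>
    intro i hi s hs
    obtain rfl : i = m := by omega
    exact ⟨_, s, .loopFalse (hend s hs), by omega, hs⟩
  | succ r ih =>
    intro i hi s hs
    obtain ⟨he, t, s', hex, ht, hs'⟩ := hstep i (by omega) s hs
    obtain ⟨t', s'', hex', ht', hs''⟩ := ih (i + 1) (by omega) s' hs'
    refine ⟨_, s'', .loopTrue he hex hex', ?_, hs''⟩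
    rw [Nat.add_mul]
    omega

theorem SumExpr.exec_compile {e : SumExpr} (he : e.Ok) {d : ℕ} (hd : 100 ≤ d) {M : ℕ} {s : Store}
    (hM : s.SizeLE M) :
    ∃ t s', Exec (e.compile d) s t s' ∧ s'.var d = e.val s ∧ (∀ y < d, s'.var y = s.var y) ∧
      s'.arr = s.arr ∧ t ≤ e.time.eval M := by
  induction e generalizing d s with
  | const m =>
    refine ⟨_, _, .assign _ _ _, by simp [val, Expr.val], fun y hy => ?_, rfl, ?_⟩
    · simp [hy.ne]
    · simp [Expr.cost, time]
  | var x =>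
    refine ⟨_, _, .assign _ _ _, by simp [val, Expr.val], fun y hy => ?_, rfl, ?_⟩
    · simp [hy.ne]
    · simp [Expr.cost, time]
  | get a i j hi hj =>
    obtain ⟨t₁, s₁, h₁, hd₁, hv₁, ha₁, ht₁⟩ := hi he.1 hd hM
    have hM₁ : s₁.SizeLE M := fun r hr => by rw [hv₁ r (by omega)]; exact hM r hr
    obtain ⟨t₂, s₂, h₂, hd₂, hv₂, ha₂, ht₂⟩ := hj he.2 (show 100 ≤ d + 1 by omega) hM₁
    refine ⟨_, _, .seq h₁ (.seq h₂ (.assign _ _ _)), ?_, fun y hy => ?_, by simp [ha₁, ha₂], ?_⟩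
    · simp only [Store.setVar_var, if_true, Expr.val, val]
      rw [hd₂, hv₂ d (by omega), hd₁, ha₂, ha₁,
        val_congr he.2 (fun x hx => hv₁ x (by omega)) (fun b _ => by rw [ha₁])]
    · simp [hy.ne, hv₂ y (by omega), hv₁ y hy]
    · simp [Expr.cost, time]
      omega
  | bin o e f ihe ihf =>
    obtain ⟨t₁, s₁, h₁, hd₁, hv₁, ha₁, ht₁⟩ := ihe he.1 hd hM
    have hM₁ : s₁.SizeLE M := fun r hr => by rw [hv₁ r (by omega)]; exact hM r hr
    obtain ⟨t₂, s₂, h₂, hd₂, hv₂, ha₂, ht₂⟩ := ihf he.2 (show 100 ≤ d + 1 by omega) hM₁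
    refine ⟨_, _, .seq h₁ (.seq h₂ (.assign _ _ _)), ?_, fun y hy => ?_, by simp [ha₁, ha₂], ?_⟩
    · simp only [Store.setVar_var, if_true, Expr.val, BinOp.val_expr, val]
      rw [hd₂, hv₂ d (by omega), hd₁,
        val_congr he.2 (fun x hx => hv₁ x (by omega)) (fun b _ => by rw [ha₁])]
    · simp [hy.ne, hv₂ y (by omega), hv₁ y hy]
    · simp [Expr.cost, BinOp.cost_expr, time]
      omega
  | sum x r e ih =>
    obtain ⟨⟨hx8, hx⟩, hr, he⟩ := he
    have hloop := Exec.loop_of_invariant (e := .lt (.var x) (.var d))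
      (p := .seq (e.compile (d + 3)) <|
        .seq (.assign (d + 1) (.add (.var (d + 1)) (.var (d + 3))))
          (.assign x (.add (.var x) (.const 1)))) (s.var r) (e.time.eval M + 8)
      (fun i s' => s'.var x = i ∧ s'.var d = s.var r ∧ s'.var (d + 2) = s.var x ∧
        s'.var (d + 1) = ∑ j ∈ Finset.range i, e.val (s.setVar x j) ∧
        (∀ y < d, y ≠ x → s'.var y = s.var y) ∧ s'.arr = s.arr) ?_ ?_
      ((((s.setVar d (s.var r)).setVar (d + 1) 0).setVar (d + 2) (s.var x)).setVar x 0) ?_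
    · obtain ⟨t, s', hex, ht, hx', hd', hd2, hd1, hv, ha⟩ := hloop
      refine ⟨_, _, .seq (.assign _ _ _) (.seq (.assign _ _ _) (.seq (.assign _ _ _)
        (.seq (.assign _ _ _) (.seq (t := t) (s' := s') ?_
          (.seq (.assign _ _ _) (.assign _ _ _)))))), ?_, fun y hy => ?_, ?_, ?_⟩
      · convert hex using 1
        simp [Expr.val, show x ≠ d by omega, show x ≠ d + 1 by omega]
      · simp [Expr.val, show d + 1 ≠ x by omega, hd1, val]
      · by_cases hyx : y = x
        · subst hyx
          simp [Expr.val, hd2, hy.ne]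
        · simp [hyx, hy.ne, hv y hy hyx]
      · simp [ha]
      · have h1 : s.var r ≤ M := hM r hr
        have h2 : s.var r * (e.time.eval M + 12) ≤ M * (e.time.eval M + 12) :=
          Nat.mul_le_mul_right _ h1
        simp only [Expr.cost] at ht ⊢
        have h3 : ((SumExpr.sum x r e).time).eval M = M * (e.time.eval M + 12) + 16 := by
          simp [time]
        rw [h3]
        have h4 : (1 + 1 + 1 + 1 + (e.time.eval M + 8)) = e.time.eval M + 12 := by ring
        rw [h4] at ht
        omega
    · rintro i hi s' ⟨hx', hd', hd2, hd1, hv, ha⟩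
      refine ⟨by simp [Expr.val, hx', hd', hi], ?_⟩
      have hM' : s'.SizeLE M := fun q hq => by
        rw [hv q (by omega) (by omega)]; exact hM q hq
      obtain ⟨t₁, s₁, h₁, hd₁, hv₁, ha₁, ht₁⟩ := ih he (show 100 ≤ d + 3 by omega) hM'
      refine ⟨_, _, .seq h₁ (.seq (.assign _ _ _) (.assign _ _ _)), ?_, ?_, ?_, ?_, ?_, ?_, ?_⟩
      · simp only [Expr.cost]
        omega
      · simp [Expr.val, show x ≠ d + 1 by omega, hv₁ x (by omega), hx']
      · simp [show d ≠ x by omega, hv₁ d (by omega), hd']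
      · simp [show d + 2 ≠ x by omega, hv₁ (d + 2) (by omega), hd2]
      · have : e.val s' = e.val (s.setVar x i) := by
          refine val_congr he (fun y hy => ?_) (fun b _ => by simp [ha])
          by_cases hyx : y = x
          · subst hyx; simp [hx']
          · simp [hyx, hv y (by omega) hyx]
        simp [Expr.val, show d + 1 ≠ x by omega, hv₁ (d + 1) (by omega), hd1, hd₁,
          Finset.sum_range_succ, this]
      · intro y hy hyx
        simp [hyx, show y ≠ d + 1 by omega, hv₁ y (by omega), hv y hy hyx]
      · simp [ha₁, ha]
    · rintro s' ⟨hx', hd', -⟩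
      simp [Expr.val, hx', hd']
    · refine ⟨by simp, ?_, ?_, ?_, ?_, ?_⟩
      · simp [show d ≠ x by omega]
      · simp [show d + 2 ≠ x by omega]
      · simp [show d + 1 ≠ x by omega]
      · intro y hy hyx
        simp [hyx, hy.ne, show y ≠ d + 1 by omega, show y ≠ d + 2 by omega]
      · simp

/-- Commands over expressions with bounded sums; `iter x r c` executes `c` for the values
`0, 1, …` of the variable `x` below the value that the variable `r` has at the beginning. -/
inductive Cmd where
  | set (x : ℕ) (e : SumExpr)
  | put (a : ℕ) (i j e : SumExpr)
  | seq (c c' : Cmd)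
  | iter (x r : ℕ) (c : Cmd)

/-- The state of a counting loop over `x` with body `f` after `i` rounds. -/
def loopState (f : Store → Store) (x : ℕ) (s : Store) : ℕ → Store
  | 0 => s
  | i + 1 => f ((loopState f x s i).setVar x i)

namespace Cmd

/-- The effect of a command on the store. -/
def run : Cmd → Store → Store
  | set x e, s => s.setVar x (e.val s)
  | put a i j e, s => s.setArr a (i.val s) (j.val s) (e.val s)
  | seq c c', s => c'.run (c.run s)
  | iter x r c, s => loopState c.run x s (s.var r)

/-- The conventions on reserved variables are respected. -/
def Ok : Cmd → Prop
  | set x e => x < 100 ∧ e.Ok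
  | put _ i j e => i.Ok ∧ j.Ok ∧ e.Ok
  | seq c c' => c.Ok ∧ c'.Ok
  | iter x r c => x < 100 ∧ r < 8 ∧ c.Ok

/-- No size variable is changed. -/
def KeepsSizes : Cmd → Prop
  | set x _ => 8 ≤ x
  | put _ _ _ _ => True
  | seq c c' => c.KeepsSizes ∧ c'.KeepsSizes
  | iter x _ c => 8 ≤ x ∧ c.KeepsSizes

/-- Throughout the execution from `s`, the size variables are bounded by `M`. -/
def SizeLE (M : ℕ) : Cmd → Store → Prop
  | set _ _, s => s.SizeLE M
  | put _ _ _ _, s => s.SizeLE M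
  | seq c c', s => c.SizeLE M s ∧ c'.SizeLE M (c.run s)
  | iter x r c, s => s.SizeLE M ∧
      ∀ i < s.var r, c.SizeLE M ((loopState c.run x s i).setVar x i)

/-- The program for a command; it uses the variables from `d` on for intermediate results. -/
def compile : Cmd → ℕ → Program
  | set x e, d => .seq (e.compile d) (.assign x (.var d))
  | put a i j e, d =>
    .seq (i.compile d) <| .seq (j.compile (d + 1)) <| .seq (e.compile (d + 2)) <|
      .put a (.var d) (.var (d + 1)) (.var (d + 2))
  | seq c c', d => .seq (c.compile d) (c'.compile d)
  | iter x r c, d =>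
    .seq (.assign d (.var r)) <| .seq (.assign (d + 1) (.const 0)) <|
    .loop (.lt (.var (d + 1)) (.var d)) <|
      .seq (.assign x (.var (d + 1))) <| .seq (c.compile (d + 2))
        (.assign (d + 1) (.add (.var (d + 1)) (.const 1)))

/-- A bound for the running time, as a polynomial in a bound for the sizes. -/
noncomputable def time : Cmd → Polynomial ℕ
  | set _ e => e.time + 2
  | put _ i j e => i.time + j.time + e.time + 4
  | seq c c' => c.time + c'.time
  | iter _ _ c => Polynomial.X * (c.time + 10) + 8

theorem keepsSizes_run {c : Cmd} (hc : c.KeepsSizes) (s : Store) {r : ℕ} (hr : r < 8) :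
    (c.run s).var r = s.var r := by
  induction c generalizing s with
  | set x e => simp [run, show r ≠ x by have : 8 ≤ x := hc; omega]
  | put a i j e => simp [run]
  | seq c c' ih ih' => simp only [run]; rw [ih' hc.2, ih hc.1]
  | iter x q c ih =>
    simp only [run]
    generalize s.var q = m
    have hx : r ≠ x := by have : 8 ≤ x := hc.1; omega
    induction m with
    | zero => rfl
    | succ m ihm => simp only [loopState]; rw [ih hc.2]; simp [hx, ihm]

theorem sizeLE_of_keepsSizes {c : Cmd} (hc : c.KeepsSizes) {M : ℕ} {s : Store}
    (hs : s.SizeLE M) : c.SizeLE M s := by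
  induction c generalizing s with
  | set x e => exact hs
  | put a i j e => exact hs
  | seq c c' ih ih' =>
    exact ⟨ih hc.1 hs, ih' hc.2 fun r hr => by rw [keepsSizes_run hc.1 s hr]; exact hs r hr⟩
  | iter x q c ih =>
    refine ⟨hs, fun i _ => ih hc.2 (Store.SizeLE.setVar (fun r hr => ?_) hc.1 i)⟩
    have hx : r ≠ x := by have : 8 ≤ x := hc.1; omega
    induction i with
    | zero => exact hs r hr
    | succ i ihi =>
      simp only [loopState]
      rw [keepsSizes_run hc.2 _ hr]
      simpa [hx] using ihi (by omega)

/-- The compiled program has the effect of the command, up to intermediate results, and it respects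
the time bound. -/
theorem exec_compile {c : Cmd} (hc : c.Ok) {d : ℕ} (hd : 100 ≤ d) {M : ℕ} {s s₀ : Store}
    (hv : ∀ y < 100, s.var y = s₀.var y) (ha : s.arr = s₀.arr) (hM : c.SizeLE M s₀) :
    ∃ t s', Exec (c.compile d) s t s' ∧ (∀ y < 100, s'.var y = (c.run s₀).var y) ∧
      (∀ y < d, 100 ≤ y → s'.var y = s.var y) ∧ s'.arr = (c.run s₀).arr ∧
      t ≤ c.time.eval M := by
  have key : ∀ {u u₀ : Store}, (∀ y < 100, u.var y = u₀.var y) → u₀.SizeLE M → u.SizeLE M :=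
    fun h h' r hr => by rw [h r (by omega)]; exact h' r hr
  induction c generalizing d s s₀ with
  | set x e =>
    obtain ⟨t₁, s₁, h₁, hd₁, hv₁, ha₁, ht₁⟩ := e.exec_compile hc.2 hd (key hv hM)
    have he : e.val s = e.val s₀ := SumExpr.val_congr hc.2 hv fun b _ => by rw [ha]
    refine ⟨_, _, .seq h₁ (.assign _ _ _), fun y hy => ?_, fun y hy hy' => ?_, ?_, ?_⟩
    · simp [run, Expr.val, hd₁, he, hv₁ y (by omega), hv y hy]
    · simp [show y ≠ x by have := hc.1; omega, hv₁ y hy]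
    · simp [run, ha₁, ha]
    · simp [Expr.cost, time]
      omega
  | put a i j e =>
    obtain ⟨t₁, s₁, h₁, hd₁, hv₁, ha₁, ht₁⟩ := i.exec_compile hc.1 hd (key hv hM)
    have e₁ : ∀ y < 100, s₁.var y = s₀.var y := fun y hy => by rw [hv₁ y (by omega), hv y hy]
    obtain ⟨t₂, s₂, h₂, hd₂, hv₂, ha₂, ht₂⟩ := j.exec_compile hc.2.1 (show 100 ≤ d + 1 by omega)
      (key e₁ hM)
    have e₂ : ∀ y < 100, s₂.var y = s₀.var y := fun y hy => by rw [hv₂ y (by omega), e₁ y hy]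
    obtain ⟨t₃, s₃, h₃, hd₃, hv₃, ha₃, ht₃⟩ := e.exec_compile hc.2.2 (show 100 ≤ d + 2 by omega)
      (key e₂ hM)
    have hi : i.val s = i.val s₀ := SumExpr.val_congr hc.1 hv fun b _ => by rw [ha]
    have hj : j.val s₁ = j.val s₀ := SumExpr.val_congr hc.2.1 e₁ fun b _ => by rw [ha₁, ha]
    have he : e.val s₂ = e.val s₀ := SumExpr.val_congr hc.2.2 e₂ fun b _ => by rw [ha₂, ha₁, ha]
    refine ⟨_, _, .seq h₁ (.seq h₂ (.seq h₃ (.put _ _ _ _ _))), fun y hy => ?_,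
      fun y hy hy' => ?_, ?_, ?_⟩
    · simp [run, hv₃ y (by omega), e₂ y hy]
    · simp [hv₃ y (by omega), hv₂ y (by omega), hv₁ y (by omega)]
    · funext b i' j'
      simp only [run, Expr.val, Store.setArr_arr, hd₃, he, hv₃ (d + 1) (by omega), hd₂, hj,
        hv₃ d (by omega), hv₂ d (by omega), hd₁, hi, ha₃, ha₂, ha₁, ha]
    · simp [Expr.cost, time]
      omega
  | seq c c' ih ih' =>
    obtain ⟨t₁, s₁, h₁, hv₁, hh₁, ha₁, ht₁⟩ := ih hc.1 hd hv ha hM.1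
    obtain ⟨t₂, s₂, h₂, hv₂, hh₂, ha₂, ht₂⟩ := ih' hc.2 hd hv₁ ha₁ hM.2
    refine ⟨_, _, .seq h₁ h₂, hv₂, fun y hy hy' => ?_, ha₂, ?_⟩
    · rw [hh₂ y hy hy', hh₁ y hy hy']
    · simp [time]
      omega
  | iter x r c ih =>
    obtain ⟨hx, hr, hc⟩ := hc
    obtain ⟨hM0, hM⟩ := hM
    have hloop := Exec.loop_of_invariant (e := .lt (.var (d + 1)) (.var d))
      (p := .seq (.assign x (.var (d + 1))) <| .seq (c.compile (d + 2))
        (.assign (d + 1) (.add (.var (d + 1)) (.const 1)))) (s₀.var r) (c.time.eval M + 6)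
      (fun i s' => s'.var (d + 1) = i ∧ s'.var d = s₀.var r ∧
        (∀ y < 100, s'.var y = (loopState c.run x s₀ i).var y) ∧
        (∀ y < d, 100 ≤ y → s'.var y = s.var y) ∧
        s'.arr = (loopState c.run x s₀ i).arr) ?_ ?_
      ((s.setVar d (s.var r)).setVar (d + 1) 0) ?_
    · obtain ⟨t, s', hex, ht, -, -, hv', hh, ha'⟩ := hloop
      refine ⟨_, _, .seq (.assign _ _ _) (.seq (.assign _ _ _) hex), hv', hh, ha', ?_⟩
      have h2 : s₀.var r * (c.time.eval M + 10) ≤ M * (c.time.eval M + 10) :=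
        Nat.mul_le_mul_right _ (hM0 r hr)
      simp only [Expr.cost] at ht ⊢
      have h3 : (iter x r c).time.eval M = M * (c.time.eval M + 10) + 8 := by simp [time]
      have h4 : (1 + 1 + 1 + 1 + (c.time.eval M + 6)) = c.time.eval M + 10 := by ring
      rw [h4] at ht
      rw [h3]
      omega
    · rintro i hi s' ⟨hi', hd', hv', hh, ha'⟩
      refine ⟨by simp [Expr.val, hi', hd', hi], ?_⟩
      obtain ⟨t₁, s₁, h₁, hv₁, hh₁, ha₁, ht₁⟩ := ih hc (show 100 ≤ d + 2 by omega)
        (s := s'.setVar x i) (s₀ := (loopState c.run x s₀ i).setVar x i)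
        (fun y hy => by simp [hv' y hy]) (by simp [ha']) (hM i hi)
      refine ⟨_, _, .seq (.assign _ _ _) (.seq (t := t₁) (s' := s₁) ?_ (.assign _ _ _)),
        ?_, ?_, ?_, fun y hy => ?_, fun y hy hy' => ?_, ?_⟩
      · simpa [Expr.val, hi'] using h₁
      · simp only [Expr.cost]
        omega
      · simp [Expr.val, hh₁ (d + 1) (by omega) (by omega), show d + 1 ≠ x by omega, hi']
      · simp [hh₁ d (by omega) (by omega), show d ≠ x by omega, hd']
      · simp [show y ≠ d + 1 by omega, hv₁ y hy, loopState]
      · simp [show y ≠ d + 1 by omega, hh₁ y (by omega) hy', show y ≠ x by omega, hh y hy hy']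
      · simp [ha₁, loopState]
    · rintro s' ⟨hi', hd', -⟩
      simp [Expr.val, hi', hd']
    · refine ⟨by simp, by simp [hv r (by omega)], fun y hy => ?_, fun y hy hy' => ?_, ?_⟩
      · simp [show y ≠ d by omega, show y ≠ d + 1 by omega, hv y hy, loopState]
      · simp [show y ≠ d by omega, show y ≠ d + 1 by omega]
      · simp [loopState, ha]

theorem loopState_induction (f : Store → Store) (x : ℕ) (s : Store) (m : ℕ)
    (I : ℕ → Store → Prop) (h0 : I 0 s)
    (hstep : ∀ i < m, ∀ s', I i s' → I (i + 1) (f (s'.setVar x i))) :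
    I m (loopState f x s m) := by
  induction m with
  | zero => exact h0
  | succ m ih => exact hstep m (by omega) _ (ih fun i hi => hstep i (by omega))

/-- Fill the first entries `(i, 0)` of the array `a` with the values of `e`, where `i` is the
variable `8`. -/
def fill₁ (a r : ℕ) (e : SumExpr) : Cmd := .iter 8 r (.put a (.var 8) (.const 0) e)

/-- Fill the first entries `(i, j)` of the array `a` with the values of `e`, where `i` and `j` are
the variables `8` and `9`. -/
def fill₂ (a r q : ℕ) (e : SumExpr) : Cmd := .iter 8 r (.iter 9 q (.put a (.var 8) (.var 9) e))

theorem run_fill₁ {a r : ℕ} {e : SumExpr} (he : e.Ok) (ha : ¬ e.Reads a) (s : Store) :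
    (∀ x, x ≠ 8 → ((fill₁ a r e).run s).var x = s.var x) ∧
    (∀ b, b ≠ a → ((fill₁ a r e).run s).arr b = s.arr b) ∧
    ∀ i < s.var r, ((fill₁ a r e).run s).arr a i 0 = e.val (s.setVar 8 i) := by
  refine loopState_induction _ 8 s (s.var r) (fun m s' => (∀ x, x ≠ 8 → s'.var x = s.var x) ∧
    (∀ b, b ≠ a → s'.arr b = s.arr b) ∧ ∀ i < m, s'.arr a i 0 = e.val (s.setVar 8 i))
    ⟨fun _ _ => rfl, fun _ _ => rfl, by simp⟩ ?_
  rintro m hm s' ⟨hv, hb, hval⟩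
  refine ⟨fun x hx => ?_, fun b hba => ?_, fun i hi => ?_⟩
  · simp [run, hx, hv x hx]
  · funext i j
    simp [run, Store.setArr_arr, hba, hb b hba]
  · have : e.val (s'.setVar 8 m) = e.val (s.setVar 8 m) := by
      refine SumExpr.val_congr he (fun x _ => ?_) fun b hb' => hb b fun h => ha (h ▸ hb')
      by_cases hx : x = 8
      · simp [hx]
      · simp [hx, hv x hx]
    simp only [run, SumExpr.val, Store.setArr_arr, Store.setVar_var, if_true, Store.setVar_arr,
      this, true_and]
    split_ifs with h
    · rw [h.1]
    · exact hval i (by simp at h; omega)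

theorem run_fill₂ {a r q : ℕ} (hq : q < 8) {e : SumExpr} (he : e.Ok) (ha : ¬ e.Reads a)
    (s : Store) :
    (∀ x, x ≠ 8 → x ≠ 9 → ((fill₂ a r q e).run s).var x = s.var x) ∧
    (∀ b, b ≠ a → ((fill₂ a r q e).run s).arr b = s.arr b) ∧
    ∀ i < s.var r, ∀ j < s.var q, ((fill₂ a r q e).run s).arr a i j =
      e.val ((s.setVar 8 i).setVar 9 j) := by
  refine loopState_induction _ 8 s (s.var r)
    (fun m s' => (∀ x, x ≠ 8 → x ≠ 9 → s'.var x = s.var x) ∧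
    (∀ b, b ≠ a → s'.arr b = s.arr b) ∧
    ∀ i < m, ∀ j < s.var q, s'.arr a i j = e.val ((s.setVar 8 i).setVar 9 j))
    ⟨fun _ _ _ => rfl, fun _ _ => rfl, by simp⟩ ?_
  rintro m hm s' ⟨hv, hb, hval⟩
  have hq' : (s'.setVar 8 m).var q = s.var q := by
    simp [show q ≠ 8 by omega, hv q (by omega) (by omega)]
  have := loopState_induction (put a (.var 8) (.var 9) e).run 9 (s'.setVar 8 m)
    ((s'.setVar 8 m).var q)
    (fun l s'' => (∀ x, x ≠ 8 → x ≠ 9 → s''.var x = s.var x) ∧ s''.var 8 = m ∧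
      (∀ b, b ≠ a → s''.arr b = s.arr b) ∧
      (∀ i < m, ∀ j < s.var q, s''.arr a i j = e.val ((s.setVar 8 i).setVar 9 j)) ∧
      ∀ j < l, s''.arr a m j = e.val ((s.setVar 8 m).setVar 9 j))
    ⟨fun x hx hx' => by simp [hx, hv x hx hx'], by simp, fun b hba => hb b hba, hval, by simp⟩ ?_
  · obtain ⟨h1, -, h2, h3, h4⟩ := this
    refine ⟨h1, h2, fun i hi j hj => ?_⟩
    by_cases him : i = m
    · subst him
      exact h4 j (by rw [hq']; exact hj)
    · exact h3 i (by omega) j hj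
  · rintro l hl s'' ⟨h1, h1', h2, h3, h4⟩
    have hval' : e.val (s''.setVar 9 l) = e.val ((s.setVar 8 m).setVar 9 l) := by
      refine SumExpr.val_congr he (fun x _ => ?_) fun b hb' => h2 b fun h => ha (h ▸ hb')
      by_cases hx : x = 9
      · simp [hx]
      · by_cases hx' : x = 8
        · simp [hx', h1']
        · simp [hx, hx', h1 x hx' hx]
    refine ⟨fun x hx hx' => ?_, ?_, fun b hba => ?_, fun i hi j hj => ?_, fun j hj => ?_⟩
    · simp [run, hx', h1 x hx hx']
    · simp [run, h1']
    · funext i j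
      simp [run, Store.setArr_arr, hba, h2 b hba]
    · simp [run, Store.setArr_arr, SumExpr.val, h1', hi.ne, h3 i hi j hj]
    · by_cases hjl : j = l
      · subst hjl
        simp [run, Store.setArr_arr, SumExpr.val, h1', hval']
      · simp [run, Store.setArr_arr, SumExpr.val, hjl, h4 j (by omega)]

end Cmd

end RAM

/-! ### Path consistency and majority operations -/

namespace ListColoring

variable {V W : Type*}

/-- Assigning the colour `x.2` to the vertex `x.1` and the colour `y.2` to the vertex `y.1` is not
contradictory in itself. -/
def Compat (H : LoopGraph W) (G : SimpleGraph V) (x y : V × W) : Prop :=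
  (x.1 = y.1 → x.2 = y.2) ∧ (G.Adj x.1 y.1 → H.Adj x.2 y.2)

theorem Compat.symm {H : LoopGraph W} {G : SimpleGraph V} {x y : V × W} (h : Compat H G x y) :
    Compat H G y x :=
  ⟨fun e => (h.1 e.symm).symm, fun e => H.symm (h.2 e.symm)⟩

/-- A colouring that respects the lists `Λ`. -/
def IsSolution (H : LoopGraph W) (G : SimpleGraph V) (Λ : V → W → Prop) (φ : V → W) : Prop :=
  (∀ v, Λ v (φ v)) ∧ ∀ u v, G.Adj u v → H.Adj (φ u) (φ v)

theorem IsSolution.compat {H : LoopGraph W} {G : SimpleGraph V} {Λ : V → W → Prop} {φ : V → W}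
    (h : IsSolution H G Λ φ) (u v : V) : Compat H G (u, φ u) (v, φ v) :=
  ⟨fun e => congrArg φ e, h.2 u v⟩

/-- The pairs of assignments that are admitted by the lists and not contradictory. -/
def initialPairs (H : LoopGraph W) (G : SimpleGraph V) (Λ : V → W → Prop) (x y : V × W) : Prop :=
  Λ x.1 x.2 ∧ Λ y.1 y.2 ∧ Compat H G x y

/-- One round of path consistency: keep the pairs that extend to every third vertex. -/
def refinePairs (P : V × W → V × W → Prop) (x y : V × W) : Prop :=
  P x y ∧ ∀ w, ∃ c, P x (w, c) ∧ P (w, c) y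

/-- The pairs that survive sufficiently many rounds of path consistency. -/
def consistentPairs [Fintype V] [Fintype W] (H : LoopGraph W) (G : SimpleGraph V)
    (Λ : V → W → Prop) : V × W → V × W → Prop :=
  refinePairs^[(Fintype.card V * Fintype.card W) * (Fintype.card V * Fintype.card W)]
    (initialPairs H G Λ)

/-- Since every round that changes something deletes a pair, the pairs become stable. -/
theorem refinePairs_iterate_stable [Fintype V] [Fintype W] (P : V × W → V × W → Prop) :
    refinePairs (refinePairs^[(Fintype.card V * Fintype.card W) *
      (Fintype.card V * Fintype.card W)] P) =
    refinePairs^[(Fintype.card V * Fintype.card W) * (Fintype.card V * Fintype.card W)] P := by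
  have le : ∀ Q : V × W → V × W → Prop, ∀ x y, refinePairs Q x y → Q x y := fun _ _ _ h => h.1
  have key : ∀ m, refinePairs (refinePairs^[m] P) = refinePairs^[m] P ∨
      {z : (V × W) × (V × W) | refinePairs^[m] P z.1 z.2}.ncard + m ≤
        (Fintype.card V * Fintype.card W) * (Fintype.card V * Fintype.card W) := by
    intro m
    induction m with
    | zero =>
      right
      refine (Set.ncard_le_card _).trans ?_
      simp [Fintype.card_prod]
    | succ m ih =>
      rw [Function.iterate_succ_apply']
      by_cases h : refinePairs (refinePairs^[m] P) = refinePairs^[m] P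
      · left
        rw [h, h]
      · right
        have hlt : {z : (V × W) × (V × W) | refinePairs (refinePairs^[m] P) z.1 z.2}.ncard <
            {z : (V × W) × (V × W) | refinePairs^[m] P z.1 z.2}.ncard := by
          refine Set.ncard_lt_ncard ⟨fun z hz => le _ _ _ hz, fun hsub => h ?_⟩ (Set.toFinite _)
          funext x y
          exact propext ⟨fun hz => le _ _ _ hz, fun hz => hsub (a := (x, y)) hz⟩
        rcases ih with ih | ih
        · exact absurd ih h
        · omega
  rcases key ((Fintype.card V * Fintype.card W) * (Fintype.card V * Fintype.card W)) with h | h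
  · exact h
  · have h0 := (Set.ncard_eq_zero (Set.toFinite _)).1 (Nat.le_zero.1
      (Nat.le_of_add_le_add_right (h.trans_eq (Nat.zero_add _).symm)))
    funext x y
    refine propext ⟨fun hz => le _ _ _ hz, fun hz => ?_⟩
    exact ((Set.ext_iff.1 h0 (x, y)).1 hz).elim

section consistentPairs

variable [Fintype V] [Fintype W] {H : LoopGraph W} {G : SimpleGraph V} {Λ : V → W → Prop}

theorem consistentPairs_extend {x y : V × W} (h : consistentPairs H G Λ x y) (w : V) :
    ∃ c, consistentPairs H G Λ x (w, c) ∧ consistentPairs H G Λ (w, c) y := by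
  have := refinePairs_iterate_stable (initialPairs H G Λ)
  have h' : refinePairs (consistentPairs H G Λ) x y := by
    unfold consistentPairs
    rw [this]
    exact h
  exact h'.2 w

/-- A property of families of pairs that holds initially and is preserved by every round. -/
theorem consistentPairs_induction {p : (V × W → V × W → Prop) → Prop}
    (h0 : p (initialPairs H G Λ)) (hstep : ∀ P, p P → p (refinePairs P)) :
    p (consistentPairs H G Λ) := by
  unfold consistentPairs
  generalize (Fintype.card V * Fintype.card W) * (Fintype.card V * Fintype.card W) = m
  induction m with
  | zero => exact h0
  | succ m ih => rw [Function.iterate_succ_apply']; exact hstep _ ih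

theorem consistentPairs_symm {x y : V × W} (h : consistentPairs H G Λ x y) :
    consistentPairs H G Λ y x := by
  refine consistentPairs_induction (p := fun P => ∀ x y, P x y → P y x) ?_ ?_ x y h
  · exact fun x y h => ⟨h.2.1, h.1, h.2.2.symm⟩
  · refine fun P hP x y h => ⟨hP _ _ h.1, fun w => ?_⟩
    obtain ⟨c, h1, h2⟩ := h.2 w
    exact ⟨c, hP _ _ h2, hP _ _ h1⟩

theorem initialPairs_of_consistentPairs {x y : V × W} (h : consistentPairs H G Λ x y) :
    initialPairs H G Λ x y :=
  consistentPairs_induction (p := fun P => ∀ x y, P x y → initialPairs H G Λ x y)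
    (fun _ _ h => h) (fun _ hP x y h => hP x y h.1) x y h

theorem IsSolution.consistentPairs {φ : V → W} (h : IsSolution H G Λ φ) (u v : V) :
    consistentPairs H G Λ (u, φ u) (v, φ v) :=
  consistentPairs_induction (p := fun P => ∀ u v, P (u, φ u) (v, φ v))
    (fun u v => ⟨h.1 u, h.1 v, h.compat u v⟩)
    (fun _ hP u v => ⟨hP u v, fun w => ⟨φ w, hP u w, hP w v⟩⟩) u v

end consistentPairs

/-- A ternary operation that returns any value which occurs at least twice among its arguments. -/
def IsMajority (m : W → W → W → W) : Prop := ∀ a b, m a a b = a ∧ m a b a = a ∧ m b a a = a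

/-- The pairs of assignments in `P` are preserved by the operation `m`. -/
def ClosedUnder (m : W → W → W → W) (P : V × W → V × W → Prop) : Prop :=
  ∀ u v a₁ a₂ a₃ b₁ b₂ b₃, P (u, a₁) (v, b₁) → P (u, a₂) (v, b₂) → P (u, a₃) (v, b₃) →
    P (u, m a₁ a₂ a₃) (v, m b₁ b₂ b₃)

/-- If the consistent pairs are preserved by a majority operation, then every consistent partial
colouring extends to one more vertex. -/
theorem exists_extension [Fintype V] [Fintype W] {H : LoopGraph W} {G : SimpleGraph V}
    {Λ : V → W → Prop} {m : W → W → W → W} (hm : IsMajority m)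
    (hc : ClosedUnder m (consistentPairs H G Λ))
    (hdom : ∀ u, ∃ a, consistentPairs H G Λ (u, a) (u, a))
    (φ : V → W) (z : V) (T : Finset V)
    (hT : ∀ u ∈ T, ∀ v ∈ T, consistentPairs H G Λ (u, φ u) (v, φ v)) :
    ∃ c, ∀ v ∈ T, consistentPairs H G Λ (v, φ v) (z, c) := by
  classical
  induction T using Finset.strongInduction with
  | H T ih =>
    by_cases h3 : 2 < T.card
    · obtain ⟨v₁, h₁, v₂, h₂, v₃, h₃, h12, h13, h23⟩ := Finset.two_lt_card.1 h3
      -- solve the problem with one of the three vertices left out, and take the majority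
      have aux : ∀ v ∈ T, ∃ c a, consistentPairs H G Λ (v, a) (z, c) ∧
          ∀ u ∈ T, u ≠ v → consistentPairs H G Λ (u, φ u) (z, c) := by
        intro v hv
        obtain ⟨c, hc'⟩ := ih (T.erase v) (Finset.erase_ssubset hv)
          fun u hu w hw => hT u (Finset.mem_of_mem_erase hu) w (Finset.mem_of_mem_erase hw)
        obtain ⟨w, hw, hwv⟩ := Finset.exists_mem_ne (by omega : 1 < T.card) v
        obtain ⟨a, -, ha⟩ := consistentPairs_extend (hc' w (Finset.mem_erase.2 ⟨hwv, hw⟩)) v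
        exact ⟨c, a, ha, fun u hu huv => hc' u (Finset.mem_erase.2 ⟨huv, hu⟩)⟩
      obtain ⟨c₁, a₁, e₁, f₁⟩ := aux v₁ h₁
      obtain ⟨c₂, a₂, e₂, f₂⟩ := aux v₂ h₂
      obtain ⟨c₃, a₃, e₃, f₃⟩ := aux v₃ h₃
      refine ⟨m c₁ c₂ c₃, fun v hv => ?_⟩
      by_cases hv₁ : v = v₁
      · subst hv₁
        have := hc _ _ _ _ _ _ _ _ e₁ (f₂ v hv h12) (f₃ v hv h13)
        rwa [(hm (φ v) a₁).2.2] at this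
      by_cases hv₂ : v = v₂
      · subst hv₂
        have := hc _ _ _ _ _ _ _ _ (f₁ v hv h12.symm) e₂ (f₃ v hv h23)
        rwa [(hm (φ v) a₂).2.1] at this
      by_cases hv₃ : v = v₃
      · subst hv₃
        have := hc _ _ _ _ _ _ _ _ (f₁ v hv h13.symm) (f₂ v hv h23.symm) e₃
        rwa [(hm (φ v) a₃).1] at this
      have := hc _ _ _ _ _ _ _ _ (f₁ v hv hv₁) (f₂ v hv hv₂) (f₃ v hv hv₃)
      rwa [(hm (φ v) (φ v)).1] at this
    · have : T.card = 0 ∨ T.card = 1 ∨ T.card = 2 := by omega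
      rcases this with h | h | h
      · obtain rfl := Finset.card_eq_zero.1 h
        exact ⟨(hdom z).choose, by simp⟩
      · obtain ⟨v, rfl⟩ := Finset.card_eq_one.1 h
        obtain ⟨c, hc', -⟩ := consistentPairs_extend (hT v (by simp) v (by simp)) z
        exact ⟨c, by simpa using hc'⟩
      · obtain ⟨v, w, -, rfl⟩ := Finset.card_eq_two.1 h
        obtain ⟨c, hc₁, hc₂⟩ := consistentPairs_extend (hT v (by simp) w (by simp)) z
        refine ⟨c, fun u hu => ?_⟩
        rcases Finset.mem_insert.1 hu with rfl | hu
        · exact hc₁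
        · rw [Finset.mem_singleton.1 hu]
          exact consistentPairs_symm hc₂

/-- Path consistency decides instances whose consistent pairs are preserved by a majority
operation. -/
theorem exists_isSolution [Fintype V] [Fintype W] {H : LoopGraph W} {G : SimpleGraph V}
    {Λ : V → W → Prop} {m : W → W → W → W} (hm : IsMajority m)
    (hc : ClosedUnder m (consistentPairs H G Λ))
    (hdom : ∀ u, ∃ a, consistentPairs H G Λ (u, a) (u, a)) : ∃ φ, IsSolution H G Λ φ := by
  classical
  have key : ∀ S : Finset V, ∃ φ : V → W, ∀ u ∈ S, ∀ v ∈ S,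
      consistentPairs H G Λ (u, φ u) (v, φ v) := by
    intro S
    induction S using Finset.induction_on with
    | empty => exact ⟨fun v => (hdom v).choose, by simp⟩
    | insert z S hz ih =>
      obtain ⟨φ, hφ⟩ := ih
      obtain ⟨c, hcS⟩ := exists_extension hm hc hdom φ z S hφ
      have hzz : ∃ c, (∀ v ∈ S, consistentPairs H G Λ (v, φ v) (z, c)) ∧
          consistentPairs H G Λ (z, c) (z, c) := by
        rcases S.eq_empty_or_nonempty with rfl | ⟨v, hv⟩
        · obtain ⟨a, ha⟩ := hdom z
          exact ⟨a, by simp, ha⟩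
        · obtain ⟨c', -, h'⟩ := consistentPairs_extend (hcS v hv) z
          have : c' = c := (initialPairs_of_consistentPairs h').2.2.1 rfl
          exact ⟨c, hcS, this ▸ h'⟩
      obtain ⟨c, hcS, hcz⟩ := hzz
      have hne : ∀ v ∈ S, v ≠ z := fun v hv e => hz (e ▸ hv)
      refine ⟨Function.update φ z c, fun u hu v hv => ?_⟩
      rcases Finset.mem_insert.1 hu with rfl | hu'
      · rcases Finset.mem_insert.1 hv with rfl | hv'
        · simpa using hcz
        · simpa [hne v hv'] using consistentPairs_symm (hcS v hv')
      · rcases Finset.mem_insert.1 hv with rfl | hv'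
        · simpa [hne u hu'] using hcS u hu'
        · simpa [hne u hu', hne v hv'] using hφ u hu' v hv'
  obtain ⟨φ, hφ⟩ := key Finset.univ
  have h : ∀ u v, initialPairs H G Λ (u, φ u) (v, φ v) := fun u v =>
    initialPairs_of_consistentPairs (hφ u (Finset.mem_univ _) v (Finset.mem_univ _))
  exact ⟨φ, fun v => (h v v).1, fun u v => (h u v).2.2.2⟩

/-- If path consistency leaves one or two colours for every vertex, then there is a solution: this
is the case of 2-satisfiability. -/
theorem exists_isSolution_of_card_le_two [Fintype V] [Fintype W] {H : LoopGraph W}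
    {G : SimpleGraph V} {Λ : V → W → Prop}
    (hdom : ∀ u, ∃ a, consistentPairs H G Λ (u, a) (u, a))
    (htwo : ∀ u, {a | consistentPairs H G Λ (u, a) (u, a)}.ncard ≤ 2) :
    ∃ φ, IsSolution H G Λ φ := by
  classical
  have hdiag : ∀ {u a v b}, consistentPairs H G Λ (u, a) (v, b) →
      consistentPairs H G Λ (u, a) (u, a) := by
    intro u a v b h
    obtain ⟨c, h1, -⟩ := consistentPairs_extend h u
    have : a = c := (initialPairs_of_consistentPairs h1).2.2.1 rfl
    exact this ▸ h1
  have hthree : ∀ {u a b c}, consistentPairs H G Λ (u, a) (u, a) →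
      consistentPairs H G Λ (u, b) (u, b) → consistentPairs H G Λ (u, c) (u, c) →
      b ≠ c → a = b ∨ a = c := by
    intro u a b c ha hb hc' hbc
    by_contra! hne
    have : ({a, b, c} : Set W).ncard ≤ 2 := by
      refine (Set.ncard_le_ncard ?_ (Set.toFinite _)).trans (htwo u)
      rintro x (rfl | rfl | rfl)
      exacts [ha, hb, hc']
    rw [Set.ncard_eq_three.2 ⟨a, b, c, hne.1, hne.2, hbc, rfl⟩] at this
    omega
  refine exists_isSolution (m := fun a b c => if b = c then b else a) ?_ ?_ hdom
  · intro a b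
    refine ⟨?_, ?_, ?_⟩ <;> dsimp only <;> split_ifs with h <;> simp_all
  · -- the two majorities are attained at a common position
    intro u v a₁ a₂ a₃ b₁ b₂ b₃ h₁ h₂ h₃
    have ha := @hthree u a₁ a₂ a₃ (hdiag h₁) (hdiag h₂) (hdiag h₃)
    have hb := @hthree v b₁ b₂ b₃ (hdiag (consistentPairs_symm h₁))
      (hdiag (consistentPairs_symm h₂)) (hdiag (consistentPairs_symm h₃))
    dsimp only
    split_ifs with h h'
    · exact h₂
    · rcases hb h' with e | e
      · rw [e]; exact h₂
      · rw [e, h]; exact h₃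
    · rename_i h''
      rcases ha h with e | e
      · rw [e]; exact h₂
      · rw [e, h'']; exact h₃
    · exact h₁

theorem median_add_mem {x₁ x₂ x₃ y₁ y₂ y₃ : ℤ} (h₁ : 0 ≤ x₁ + y₁ ∧ x₁ + y₁ ≤ 1)
    (h₂ : 0 ≤ x₂ + y₂ ∧ x₂ + y₂ ≤ 1) (h₃ : 0 ≤ x₃ + y₃ ∧ x₃ + y₃ ≤ 1) :
    0 ≤ max (min x₁ x₂) (min (max x₁ x₂) x₃) + max (min y₁ y₂) (min (max y₁ y₂) y₃) ∧
    max (min x₁ x₂) (min (max x₁ x₂) x₃) + max (min y₁ y₂) (min (max y₁ y₂) y₃) ≤ 1 := by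
  omega

theorem exists_median (ω : W → ℤ) : ∃ m : W → W → W → W, IsMajority m ∧
    (∀ a b c, m a b c = a ∨ m a b c = b ∨ m a b c = c) ∧
    ∀ a b c, ω (m a b c) = max (min (ω a) (ω b)) (min (max (ω a) (ω b)) (ω c)) := by
  have : ∀ a b c, ∃ d, (a = b → d = a) ∧ (a = c → d = a) ∧ (b = c → d = b) ∧
      (d = a ∨ d = b ∨ d = c) ∧ ω d = max (min (ω a) (ω b)) (min (max (ω a) (ω b)) (ω c)) := by
    intro a b c
    by_cases hab : a = b
    · subst hab
      exact ⟨a, by simp⟩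
    by_cases hac : a = c
    · subst hac
      exact ⟨a, by simp, by simp, by simp +contextual, by simp, by omega⟩
    by_cases hbc : b = c
    · subst hbc
      exact ⟨b, by simp [hab], by simp [hab], by simp, by simp, by omega⟩
    simp only [hab, hac, hbc, false_imp_iff, true_and]
    have : max (min (ω a) (ω b)) (min (max (ω a) (ω b)) (ω c)) = ω a ∨
      max (min (ω a) (ω b)) (min (max (ω a) (ω b)) (ω c)) = ω b ∨
      max (min (ω a) (ω b)) (min (max (ω a) (ω b)) (ω c)) = ω c := by omega
    rcases this with h | h | h
    · exact ⟨a, by simp, h.symm⟩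
    · exact ⟨b, by simp, h.symm⟩
    · exact ⟨c, by simp, h.symm⟩
  choose m hab hac hbc hmem hω using this
  exact ⟨m, fun a b => ⟨hab a a b rfl, hac a b a rfl, hbc b a a rfl⟩, hmem, hω⟩

/-- On the colours of `S`, adjacency in `H` is described by a labelling with integers: two colours
are adjacent when their labels add up to `0` or `1`. With the labels `0, 1, -1, 2, -2, …` this is a
path with a loop at its first vertex, and without the label `0` it is a path without loops. -/
def IsLabelling (H : LoopGraph W) (S : Set W) (ω : W → ℤ) : Prop :=
  ∀ a ∈ S, ∀ b ∈ S, H.Adj a b ↔ 0 ≤ ω a + ω b ∧ ω a + ω b ≤ 1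

/-- If `H` has a labelling on the colours that occur in the lists, then path consistency decides
the instance: the median with respect to the labels is a majority operation. -/
theorem exists_isSolution_of_isLabelling [Fintype V] [Fintype W] {H : LoopGraph W}
    {G : SimpleGraph V} {Λ : V → W → Prop} {S : Set W} {ω : W → ℤ} (hω : IsLabelling H S ω)
    (hΛ : ∀ v a, Λ v a → a ∈ S) (hdom : ∀ u, ∃ a, consistentPairs H G Λ (u, a) (u, a)) :
    ∃ φ, IsSolution H G Λ φ := by
  obtain ⟨m, hmaj, hmem, hval⟩ := exists_median ω
  refine exists_isSolution hmaj (consistentPairs_induction (p := ClosedUnder m) ?_ ?_) hdom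
  · rintro u v a₁ a₂ a₃ b₁ b₂ b₃ ⟨p₁, q₁, r₁⟩ ⟨p₂, q₂, r₂⟩ ⟨p₃, q₃, r₃⟩
    have hp : Λ u (m a₁ a₂ a₃) := by rcases hmem a₁ a₂ a₃ with h | h | h <;> rw [h] <;> assumption
    have hq : Λ v (m b₁ b₂ b₃) := by rcases hmem b₁ b₂ b₃ with h | h | h <;> rw [h] <;> assumption
    refine ⟨hp, hq, fun e => ?_, fun e => ?_⟩
    · simp only [Compat] at r₁ r₂ r₃ e
      rw [r₁.1 e, r₂.1 e, r₃.1 e]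
    · refine (hω _ (hΛ _ _ hp) _ (hΛ _ _ hq)).2 ?_
      rw [hval, hval]
      exact median_add_mem ((hω _ (hΛ _ _ p₁) _ (hΛ _ _ q₁)).1 (r₁.2 e))
        ((hω _ (hΛ _ _ p₂) _ (hΛ _ _ q₂)).1 (r₂.2 e))
        ((hω _ (hΛ _ _ p₃) _ (hΛ _ _ q₃)).1 (r₃.2 e))
  · intro P hP u v a₁ a₂ a₃ b₁ b₂ b₃ h₁ h₂ h₃
    refine ⟨hP _ _ _ _ _ _ _ _ h₁.1 h₂.1 h₃.1, fun w => ?_⟩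
    obtain ⟨c₁, x₁, y₁⟩ := h₁.2 w
    obtain ⟨c₂, x₂, y₂⟩ := h₂.2 w
    obtain ⟨c₃, x₃, y₃⟩ := h₃.2 w
    exact ⟨_, hP _ _ _ _ _ _ _ _ x₁ x₂ x₃, hP _ _ _ _ _ _ _ _ y₁ y₂ y₃⟩

end ListColoring

/-! ### Branching and guessing -/

namespace ListColoring

variable {V W : Type*} {H : LoopGraph W} {G : SimpleGraph V}

/-- The lists after the assignments `σ 0, …, σ (s - 1)`. -/
def assignLists (H : LoopGraph W) (G : SimpleGraph V) (Λ : V → W → Prop) (σ : ℕ → V × W) (s : ℕ)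
    (v : V) (c : W) : Prop :=
  Λ v c ∧ ∀ i < s, Compat H G (σ i) (v, c)

/-- The number of vertices whose lists become smaller by the assignment `x`. -/
noncomputable def impact (H : LoopGraph W) (G : SimpleGraph V) (Λ : V → W → Prop) (x : V × W) : ℕ :=
  {u | ∃ b, Λ u b ∧ ¬ Compat H G x (u, b)}.ncard

/-- The lists without the colours whose assignment would make at least `δ` lists smaller. -/
def lightLists (H : LoopGraph W) (G : SimpleGraph V) (Λ : V → W → Prop) (δ : ℕ) (v : V) (c : W) :
    Prop :=
  Λ v c ∧ impact H G Λ (v, c) < δ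

/-- There are at least two colours in the list of `v`. -/
def Active (Λ : V → W → Prop) (v : V) : Prop := 1 < {c | Λ v c}.ncard

/-- The vertex `v₀` and the active vertices that can be reached from it by at most two steps through
active vertices. -/
def Near (G : SimpleGraph V) (Λ : V → W → Prop) (v₀ w : V) : Prop :=
  w = v₀ ∨ ∃ a, Active Λ a ∧ Active Λ w ∧ G.Adj v₀ a ∧ (a = w ∨ G.Adj a w)

theorem impact_mono [Finite V] {Λ Λ' : V → W → Prop} (h : ∀ v c, Λ' v c → Λ v c) (x : V × W) :
    impact H G Λ' x ≤ impact H G Λ x :=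
  Set.ncard_le_ncard (fun _ ⟨b, hb, hb'⟩ => ⟨b, h _ _ hb, hb'⟩) (Set.toFinite _)

theorem ncard_add_impact_le [Finite V] [Finite W] (Λ : V → W → Prop) (x : V × W) :
    {y : V × W | Λ y.1 y.2 ∧ Compat H G x y}.ncard + impact H G Λ x ≤
      {y : V × W | Λ y.1 y.2}.ncard := by
  have h1 : impact H G Λ x ≤ {y : V × W | Λ y.1 y.2 ∧ ¬ Compat H G x y}.ncard := by
    have : {u | ∃ b, Λ u b ∧ ¬ Compat H G x (u, b)} =
        Prod.fst '' {y : V × W | Λ y.1 y.2 ∧ ¬ Compat H G x y} := by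
      ext u
      constructor
      · rintro ⟨b, hb⟩
        exact ⟨(u, b), hb, rfl⟩
      · rintro ⟨⟨u', b⟩, hb, rfl⟩
        exact ⟨b, hb⟩
    rw [impact, this]
    exact Set.ncard_image_le (Set.toFinite _)
  have h2 : {y : V × W | Λ y.1 y.2} = {y : V × W | Λ y.1 y.2 ∧ Compat H G x y} ∪
      {y : V × W | Λ y.1 y.2 ∧ ¬ Compat H G x y} := by
    ext y
    by_cases h : Compat H G x y <;> simp [h]
  rw [h2, Set.ncard_union_eq ?_ (Set.toFinite _) (Set.toFinite _)]
  · omega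
  · exact Set.disjoint_left.2 fun y hy hy' => hy'.2 hy.2

/-- Some `s` assignments of a solution `φ` suffice to make all assignments of `φ` light: as long as
there is an assignment of `φ` with impact at least `δ`, it is added, and it reduces the total size
of the lists by `δ`. -/
theorem exists_light_assignment [Fintype V] [Fintype W] [Nonempty V] (Λ : V → W → Prop) (φ : V → W)
    {s δ : ℕ} (hδ : 0 < δ) (hs : Fintype.card V * Fintype.card W ≤ s * δ) :
    ∃ f : ℕ → V, ∀ v,
      impact H G (assignLists H G Λ (fun i => (f i, φ (f i))) s) (v, φ v) < δ := by
  classical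
  have key : ∀ j, ∃ f : ℕ → V,
      (∀ v, impact H G (assignLists H G Λ (fun i => (f i, φ (f i))) j) (v, φ v) < δ) ∨
      {y : V × W | assignLists H G Λ (fun i => (f i, φ (f i))) j y.1 y.2}.ncard + j * δ ≤
        Fintype.card V * Fintype.card W := by
    intro j
    induction j with
    | zero =>
      refine ⟨fun _ => Classical.arbitrary V, Or.inr ?_⟩
      rw [Nat.zero_mul, Nat.add_zero]
      refine (Set.ncard_le_card _).trans ?_
      simp [Fintype.card_prod]
    | succ j ih =>
      obtain ⟨f, hf⟩ := ih
      by_cases hl : ∀ v, impact H G (assignLists H G Λ (fun i => (f i, φ (f i))) j) (v, φ v) < δ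
      · exact ⟨f, Or.inl fun v => (impact_mono
          (fun v c h => ⟨h.1, fun i hi => h.2 i (by omega)⟩) _).trans_lt (hl v)⟩
      · have hf' := hf.resolve_left hl
        push Not at hl
        obtain ⟨v, hv⟩ := hl
        refine ⟨Function.update f j v, Or.inr ?_⟩
        have hstep := ncard_add_impact_le (H := H) (G := G)
          (assignLists H G Λ (fun i => (f i, φ (f i))) j) (v, φ v)
        have heq : {y : V × W | assignLists H G Λ (fun i => (Function.update f j v i,
            φ (Function.update f j v i))) (j + 1) y.1 y.2} =
            {y : V × W | assignLists H G Λ (fun i => (f i, φ (f i))) j y.1 y.2 ∧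
              Compat H G (v, φ v) y} := by
          ext y
          simp only [assignLists, Set.mem_ofPred_eq, and_assoc, and_congr_right_iff]
          intro _
          constructor
          · intro h
            refine ⟨fun i hi => ?_, ?_⟩
            · simpa [hi.ne] using h i (by omega)
            · simpa using h j (by omega)
          · rintro ⟨h, h'⟩ i hi
            by_cases hij : i = j
            · subst hij
              simpa using h'
            · simpa [hij] using h i (by omega)
        rw [heq, Nat.add_mul]
        omega
  obtain ⟨f, hf | hf⟩ := key s
  · exact ⟨f, hf⟩
  · refine ⟨f, fun v => ?_⟩
    have := ncard_add_impact_le (H := H) (G := G)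
      (assignLists H G Λ (fun i => (f i, φ (f i))) s) (v, φ v)
    omega

/-- No two vertices of `H` have two common neighbours. -/
def NoSquare (H : LoopGraph W) : Prop :=
  ∀ a a' b b', a ≠ a' → b ≠ b' → H.Adj a b → H.Adj a b' → H.Adj a' b → ¬ H.Adj a' b'

theorem Active.exists_pair {Λ : V → W → Prop} [Finite W] {v : V} (h : Active Λ v) :
    ∃ a b, Λ v a ∧ Λ v b ∧ a ≠ b := by
  obtain ⟨a, b, ha, hb, hab⟩ := (Set.one_lt_ncard (Set.toFinite _)).1 h
  exact ⟨a, ha, b, hb, hab⟩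

/-- With light lists, active vertices have few active neighbours: for two colours `a ≠ a'` in the
list of a vertex, every active neighbour has a colour that is not adjacent to both. -/
theorem ncard_active_neighbors_le [Finite V] [Finite W] (hH : NoSquare H) {Λ : V → W → Prop}
    {δ : ℕ} {v : V} (hv : Active (lightLists H G Λ δ) v) :
    {u | Active (lightLists H G Λ δ) u ∧ G.Adj v u}.ncard ≤ 2 * δ := by
  obtain ⟨a, a', ha, ha', haa⟩ := hv.exists_pair
  have hsub : {u | Active (lightLists H G Λ δ) u ∧ G.Adj v u} ⊆
      {u | ∃ b, Λ u b ∧ ¬ Compat H G (v, a) (u, b)} ∪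
      {u | ∃ b, Λ u b ∧ ¬ Compat H G (v, a') (u, b)} := by
    rintro u ⟨hu, hvu⟩
    obtain ⟨b, b', hb, hb', hbb⟩ := hu.exists_pair
    by_contra hn
    simp only [Set.mem_union, Set.mem_ofPred_eq, not_or, not_exists, not_and, not_not] at hn
    exact hH a a' b b' haa hbb ((hn.1 b hb.1).2 hvu) ((hn.1 b' hb'.1).2 hvu)
      ((hn.2 b hb.1).2 hvu) ((hn.2 b' hb'.1).2 hvu)
  have h1 := Set.ncard_le_ncard hsub (Set.toFinite _)
  have h2 := Set.ncard_union_le {u | ∃ b, Λ u b ∧ ¬ Compat H G (v, a) (u, b)}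
    {u | ∃ b, Λ u b ∧ ¬ Compat H G (v, a') (u, b)}
  have h3 : impact H G Λ (v, a) < δ := ha.2
  have h4 : impact H G Λ (v, a') < δ := ha'.2
  unfold impact at h3 h4
  omega

theorem ncard_near_le [Finite V] [Finite W] (hH : NoSquare H) {Λ : V → W → Prop}
    {δ : ℕ} {v₀ : V} (h₀ : Active (lightLists H G Λ δ) v₀ ∨ ∀ v, ¬ Active (lightLists H G Λ δ) v) :
    {w | Near G (lightLists H G Λ δ) v₀ w}.ncard ≤ 1 + 2 * δ + 2 * δ * (2 * δ) := by
  classical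
  have := Fintype.ofFinite V
  rcases h₀ with h₀ | h₀
  · set N : V → Finset V := fun v =>
      {u | Active (lightLists H G Λ δ) u ∧ G.Adj v u}.toFinite.toFinset with hN
    have hcard : ∀ v, Active (lightLists H G Λ δ) v → (N v).card ≤ 2 * δ := by
      intro v hv
      rw [hN, ← Set.ncard_eq_toFinset_card]
      exact ncard_active_neighbors_le hH hv
    have hsub : {w | Near G (lightLists H G Λ δ) v₀ w} ⊆
        (({v₀} ∪ N v₀ ∪ (N v₀).biUnion N : Finset V) : Set V) := by
      rintro w (rfl | ⟨a, ha, hw, hva, rfl | haw⟩)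
      · simp
      · simp [hN, ha, hva]
      · simp only [hN, Finset.coe_union, Set.mem_union, Finset.mem_coe, Finset.mem_biUnion,
          Set.Finite.mem_toFinset, Set.mem_ofPred_eq]
        exact Or.inr ⟨a, ⟨ha, hva⟩, hw, haw⟩
    have h1 := Set.ncard_le_ncard hsub (Finset.finite_toSet _)
    rw [Set.ncard_coe_finset] at h1
    have h2 := Finset.card_union_le ({v₀} ∪ N v₀) ((N v₀).biUnion N)
    have h3 := Finset.card_union_le {v₀} (N v₀)
    have h4 : ((N v₀).biUnion N).card ≤ (N v₀).card * (2 * δ) :=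
      Finset.card_biUnion_le_card_mul _ _ _ fun a ha => hcard a (by
        simp only [hN, Set.Finite.mem_toFinset, Set.mem_ofPred_eq] at ha
        exact ha.1)
    have h5 := Nat.mul_le_mul_right (2 * δ) (hcard v₀ h₀)
    have h6 := hcard v₀ h₀
    simp only [Finset.card_singleton] at h3
    omega
  · have : {w | Near G (lightLists H G Λ δ) v₀ w} ⊆ {v₀} := by
      rintro w (rfl | ⟨a, ha, -⟩)
      · rfl
      · exact absurd ha (h₀ a)
    have := Set.ncard_le_ncard this (Set.toFinite _)
    rw [Set.ncard_singleton] at this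
    omega

theorem exists_path_of_edist_le {u v : V} (h : G.edist u v ≤ 3) :
    u = v ∨ G.Adj u v ∨ (∃ a, G.Adj u a ∧ G.Adj a v) ∨
      ∃ a b, G.Adj u a ∧ G.Adj a b ∧ G.Adj b v := by
  have hne : G.edist u v ≠ ⊤ := fun e => by rw [e] at h; exact absurd h (by decide)
  obtain ⟨p, hp⟩ := (G.edist_ne_top_iff_reachable.1 hne).exists_walk_length_eq_edist
  rw [← hp] at h
  have hl : p.length ≤ 3 := by exact_mod_cast h
  match p with
  | .nil => exact Or.inl rfl
  | .cons h₁ .nil => exact Or.inr (Or.inl h₁)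
  | .cons h₁ (.cons h₂ .nil) => exact Or.inr (Or.inr (Or.inl ⟨_, h₁, h₂⟩))
  | .cons h₁ (.cons h₂ (.cons h₃ .nil)) => exact Or.inr (Or.inr (Or.inr ⟨_, _, h₁, h₂, h₃⟩))
  | .cons h₁ (.cons h₂ (.cons h₃ (.cons h₄ q))) =>
    simp only [SimpleGraph.Walk.length_cons] at hl
    omega

/-- The lists `Λ` where the colours of the vertices near `v₀` have been fixed according to `φ`. -/
def guessLists (G : SimpleGraph V) (Λ : V → W → Prop) (φ : V → W) (v₀ w : V) (c : W) : Prop :=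
  Λ w c ∧ (Near G Λ v₀ w → φ w = c)

/-- For every solution `φ` there is a small certificate: the assignments `(f i, φ (f i))` together
with a vertex `v₀` and the colours of the few vertices near `v₀` are enough for path consistency to
leave at most two colours for every vertex.

Every vertex with three colours left has active neighbours only, as a neighbour with one colour
would leave it two. So when `v₀` is such a vertex, then every other such vertex is adjacent to a
vertex near `v₀`, because the diameter is at most three. -/
theorem exists_certificate [Fintype V] [Fintype W] [Nonempty V] (hH : NoSquare H)
    (hdeg : ∀ x, H.degree x ≤ 2) (hdiam : ∀ u v, G.edist u v ≤ 3) {Λ : V → W → Prop} {φ : V → W}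
    (hφ : IsSolution H G Λ φ) {s δ : ℕ} (hδ : 0 < δ)
    (hs : Fintype.card V * Fintype.card W ≤ s * δ) :
    ∃ (f : ℕ → V) (v₀ : V), ∀ Λ' : V → W → Prop,
      Λ' = lightLists H G (assignLists H G Λ (fun i => (f i, φ (f i))) s) δ →
      {w | Near G Λ' v₀ w}.ncard ≤ 1 + 2 * δ + 2 * δ * (2 * δ) ∧
      (∀ u, ∃ a, consistentPairs H G (guessLists G Λ' φ v₀) (u, a) (u, a)) ∧
      ∀ u, {a | consistentPairs H G (guessLists G Λ' φ v₀) (u, a) (u, a)}.ncard ≤ 2 := by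
  obtain ⟨f, hf⟩ := exists_light_assignment (H := H) (G := G) Λ φ hδ hs
  refine ⟨f, ?_⟩
  set Λ₁ := assignLists H G Λ (fun i => (f i, φ (f i))) s with hΛ₁
  have hφ₂ : IsSolution H G (lightLists H G Λ₁ δ) φ :=
    ⟨fun v => ⟨⟨hφ.1 v, fun i _ => hφ.compat _ _⟩, hf v⟩, hφ.2⟩
  have hφ₃ : ∀ v₀, IsSolution H G (guessLists G (lightLists H G Λ₁ δ) φ v₀) φ :=
    fun v₀ => ⟨fun v => ⟨hφ₂.1 v, fun _ => rfl⟩, hφ.2⟩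
  -- a neighbour with a single colour leaves at most two colours
  have hnb : ∀ v₀ u w, G.Adj u w →
      (∀ b, guessLists G (lightLists H G Λ₁ δ) φ v₀ w b → b = φ w) →
      {a | consistentPairs H G (guessLists G (lightLists H G Λ₁ δ) φ v₀) (u, a) (u, a)}.ncard
        ≤ 2 := by
    intro v₀ u w huw hb
    refine (Set.ncard_le_ncard ?_ (Set.toFinite _)).trans (hdeg (φ w))
    intro a ha
    obtain ⟨b, h, -⟩ := consistentPairs_extend ha w
    have h' := initialPairs_of_consistentPairs h
    obtain rfl := hb b h'.2.1
    exact H.symm (h'.2.2.2 huw)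
  have hsingle : ∀ w, ¬ Active (lightLists H G Λ₁ δ) w →
      ∀ b, lightLists H G Λ₁ δ w b → b = φ w := by
    intro w hw b hb
    by_contra hne
    refine hw ?_
    exact (Set.one_lt_ncard (Set.toFinite _)).2 ⟨b, hb, φ w, hφ₂.1 w, hne⟩
  let Bad : V → Prop := fun v => 2 < {c | lightLists H G Λ₁ δ v c}.ncard ∧
    ∀ u, G.Adj v u → Active (lightLists H G Λ₁ δ) u
  have hBadActive : ∀ v, Bad v → Active (lightLists H G Λ₁ δ) v := by
    intro v hv
    have := hv.1
    unfold Active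
    omega
  obtain ⟨v₀, hv₀, hbad⟩ : ∃ v₀, (Active (lightLists H G Λ₁ δ) v₀ ∨
      ∀ v, ¬ Active (lightLists H G Λ₁ δ) v) ∧ ∀ v, Bad v → Bad v₀ := by
    by_cases hB : ∃ v, Bad v
    · obtain ⟨v₀, hv₀⟩ := hB
      exact ⟨v₀, Or.inl (hBadActive v₀ hv₀), fun _ _ => hv₀⟩
    · push Not at hB
      by_cases hA : ∃ v, Active (lightLists H G Λ₁ δ) v
      · obtain ⟨v₀, hv₀⟩ := hA
        exact ⟨v₀, Or.inl hv₀, fun v hv => absurd hv (hB v)⟩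
      · push Not at hA
        exact ⟨Classical.arbitrary V, Or.inr hA, fun v hv => absurd hv (hB v)⟩
  refine ⟨v₀, ?_⟩
  rintro _ rfl
  refine ⟨ncard_near_le hH hv₀, fun u => ⟨φ u, (hφ₃ v₀).consistentPairs u u⟩, fun u => ?_⟩
  by_cases hu : {c | lightLists H G Λ₁ δ u c}.ncard ≤ 2
  · refine (Set.ncard_le_ncard ?_ (Set.toFinite _)).trans hu
    intro a ha
    exact (initialPairs_of_consistentPairs ha).1.1
  by_cases hu' : ∃ w, G.Adj u w ∧ ¬ Active (lightLists H G Λ₁ δ) w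
  · obtain ⟨w, huw, hw⟩ := hu'
    exact hnb v₀ u w huw fun b hb => hsingle w hw b hb.1
  push Not at hu hu'
  have hBu : Bad u := ⟨hu, hu'⟩
  have hB₀ := hbad u hBu
  have hnear : Near G (lightLists H G Λ₁ δ) v₀ u →
      {a | consistentPairs H G (guessLists G (lightLists H G Λ₁ δ) φ v₀) (u, a) (u, a)}.ncard
        ≤ 2 := by
    intro h
    refine (Set.ncard_le_ncard (t := {φ u}) ?_ (Set.toFinite _)).trans (by simp)
    intro a ha
    exact ((initialPairs_of_consistentPairs ha).1.2 h).symm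
  rcases exists_path_of_edist_le (hdiam v₀ u) with h | h | ⟨a, h₁, h₂⟩ | ⟨a, b, h₁, h₂, h₃⟩
  · exact hnear (Or.inl h.symm)
  · exact hnear (Or.inr ⟨u, hBadActive u hBu, hBadActive u hBu, h, Or.inl rfl⟩)
  · exact hnear (Or.inr ⟨a, hB₀.2 a h₁, hBadActive u hBu, h₁, Or.inr h₂⟩)
  · refine hnb v₀ u b h₃.symm fun c hc => (hc.2 ?_).symm
    exact Or.inr ⟨a, hB₀.2 a h₁, hu' b h₃.symm, h₁, Or.inr h₂⟩

end ListColoring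

/-! ### Connected graphs of maximum degree two -/

namespace LoopGraph

variable {V : Type*} {H : LoopGraph V}

/-- The first `m` members of the sequence `p` form a path in `H`. -/
def IsPathSeq (H : LoopGraph V) (p : ℕ → V) (m : ℕ) : Prop :=
  (∀ i j, i < m → j < m → p i = p j → i = j) ∧ ∀ i, i + 1 < m → H.Adj (p i) (p (i + 1))

theorem IsPathSeq.le_card [Fintype V] {p : ℕ → V} {m : ℕ} (h : H.IsPathSeq p m) :
    m ≤ Fintype.card V := by
  have : Function.Injective (fun i : Fin m => p i) :=
    fun i j hij => Fin.ext (h.1 i j i.2 j.2 hij)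
  simpa using Fintype.card_le_of_injective _ this

theorem IsPathSeq.reverse {p : ℕ → V} {m : ℕ} (h : H.IsPathSeq p m) :
    H.IsPathSeq (fun i => p (m - 1 - i)) m := by
  refine ⟨fun i j hi hj hij => ?_, fun i hi => ?_⟩
  · have := h.1 _ _ (by omega) (by omega) hij
    omega
  · have := h.2 (m - 1 - (i + 1)) (by omega)
    rw [show m - 1 - (i + 1) + 1 = m - 1 - i by omega] at this
    exact H.symm this

theorem exists_longest_pathSeq [Fintype V] [Nonempty V] (H : LoopGraph V) :
    ∃ m p, 0 < m ∧ H.IsPathSeq p m ∧ ∀ m' p', H.IsPathSeq p' m' → m' ≤ m := by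
  classical
  have h1 : ∃ p, H.IsPathSeq p 1 :=
    ⟨fun _ => Classical.arbitrary V, fun i j hi hj _ => by omega, fun i hi => by omega⟩
  have hpos : 1 ≤ Fintype.card V := Fintype.card_pos
  obtain ⟨p, hp⟩ := Nat.findGreatest_spec (P := fun m => ∃ p, H.IsPathSeq p m) hpos h1
  refine ⟨_, p, ?_, hp, fun m' p' h' => ?_⟩
  · exact Nat.le_findGreatest (P := fun m => ∃ p, H.IsPathSeq p m) hpos h1
  · exact Nat.le_findGreatest (P := fun m => ∃ p, H.IsPathSeq p m) h'.le_card ⟨p', h'⟩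

/-- A longest path cannot be extended at its end. -/
theorem IsPathSeq.mem_of_adj_last {p : ℕ → V} {m : ℕ} (hm : 0 < m) (h : H.IsPathSeq p m)
    (hmax : ∀ m' p', H.IsPathSeq p' m' → m' ≤ m) {x : V} (hx : H.Adj (p (m - 1)) x) :
    ∃ j < m, p j = x := by
  classical
  by_contra! hn
  have : H.IsPathSeq (Function.update p m x) (m + 1) := by
    refine ⟨fun i j hi hj hij => ?_, fun i hi => ?_⟩
    · by_cases him : i = m
      · by_cases hjm : j = m
        · omega
        · subst him
          simp only [Function.update_self, Function.update_of_ne hjm] at hij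
          exact absurd hij.symm (hn j (by omega))
      · by_cases hjm : j = m
        · subst hjm
          simp only [Function.update_self, Function.update_of_ne him] at hij
          exact absurd hij (hn i (by omega))
        · simp only [Function.update_of_ne him, Function.update_of_ne hjm] at hij
          exact h.1 i j (by omega) (by omega) hij
    · have him : i ≠ m := by omega
      by_cases hi' : i + 1 = m
      · rw [Function.update_of_ne him, hi', Function.update_self]
        rwa [show i = m - 1 by omega]
      · rw [Function.update_of_ne him, Function.update_of_ne hi']
        exact h.2 i (by omega)
  have := hmax _ _ this
  omega

/-- A connected graph of maximum degree two is a path, possibly with loops at its ends, or a cycle: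
its vertices can be numbered so that all edges join consecutive numbers or the extreme numbers. The
propositions `A` and `B` say whether there are loops at the first and at the last vertex, and `C`
says whether `H` is a cycle. -/
theorem exists_numbering {k : ℕ} {H : LoopGraph (Fin k)} (hconn : H.Connected)
    (hdeg : ∀ x, H.degree x ≤ 2) :
    ∃ (q : Fin k → ℕ) (A B C : Prop), Function.Injective q ∧ (∀ x, q x < k) ∧
      (∀ i < k, ∃ x, q x = i) ∧ (C → 3 ≤ k ∧ ¬ A ∧ ¬ B) ∧
      ∀ x y, H.Adj x y ↔ q x + 1 = q y ∨ q y + 1 = q x ∨ (q x = 0 ∧ q y = 0 ∧ A) ∨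
        (q x + 1 = k ∧ q y + 1 = k ∧ B) ∨
        (C ∧ ((q x = 0 ∧ q y + 1 = k) ∨ (q x + 1 = k ∧ q y = 0))) := by
  classical
  have : Nonempty (Fin k) := hconn.nonempty
  obtain ⟨m, p, hm, hp, hmax⟩ := exists_longest_pathSeq H
  have hinner : ∀ i, 0 < i → i + 1 < m → H.neighborSet (p i) = {p (i - 1), p (i + 1)} := by
    intro i hi him
    have hne : p (i - 1) ≠ p (i + 1) := fun e => by
      have := hp.1 _ _ (by omega) him e
      omega
    refine (Set.eq_of_subset_of_ncard_le ?_ ?_ (Set.toFinite _)).symm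
    · rintro x (rfl | rfl)
      · have := hp.2 (i - 1) (by omega)
        rw [show i - 1 + 1 = i by omega] at this
        exact H.symm this
      · exact hp.2 i him
    · rw [Set.ncard_pair hne]
      exact hdeg (p i)
  have hclosed : ∀ i < m, ∀ x, H.Adj (p i) x → ∃ j < m, p j = x := by
    intro i hi x hx
    by_cases hl : i + 1 = m
    · exact hp.mem_of_adj_last hm hmax (by rwa [show m - 1 = i by omega])
    by_cases h0 : i = 0
    · subst h0
      obtain ⟨j, hj, hjx⟩ := hp.reverse.mem_of_adj_last hm hmax (x := x) (by simpa using hx)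
      exact ⟨m - 1 - j, by omega, hjx⟩
    have : x ∈ H.neighborSet (p i) := hx
    rw [hinner i (by omega) (by omega)] at this
    rcases this with rfl | rfl
    · exact ⟨i - 1, by omega, rfl⟩
    · exact ⟨i + 1, by omega, rfl⟩
  have hsurj : ∀ x, ∃ j < m, p j = x := by
    have key : ∀ {y x : Fin k}, (SimpleGraph.fromRel H.Adj).Walk y x → (∃ j < m, p j = y) →
        ∃ j < m, p j = x := by
      intro y x w
      induction w with
      | nil => exact id
      | cons h _ ih =>
        rintro ⟨j, hj, rfl⟩
        refine ih (hclosed j hj _ ?_)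
        rcases h.2 with h | h
        · exact h
        · exact H.symm h
    intro x
    obtain ⟨w⟩ := hconn.preconnected (p 0) x
    exact key w ⟨0, hm, rfl⟩
  choose q hqm hq using hsurj
  have hqp : ∀ i < m, q (p i) = i := fun i hi => hp.1 _ _ (hqm _) hi (hq _)
  have hmk : m = k := by
    refine le_antisymm (by simpa using hp.le_card) ?_
    have : Function.Injective (fun x => (⟨q x, hqm x⟩ : Fin m)) := by
      intro x y hxy
      simp only [Fin.mk.injEq] at hxy
      rw [← hq x, ← hq y, hxy]
    simpa using Fintype.card_le_of_injective _ this
  subst hmk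
  have hinner' : ∀ i j, 0 < i → i + 1 < m → j < m → H.Adj (p i) (p j) → i + 1 = j ∨ j + 1 = i := by
    intro i j hi him hj h
    have : p j ∈ H.neighborSet (p i) := h
    rw [hinner i hi him] at this
    rcases this with h | h
    · have := hp.1 _ _ hj (by omega) h
      omega
    · have := hp.1 _ _ hj (by omega) h
      omega
  have hthree : ∀ x a b c, H.Adj x a → H.Adj x b → H.Adj x c → a ≠ b → a ≠ c → b ≠ c → False := by
    intro x a b c ha hb hc hab hac hbc
    have h3 : ({a, b, c} : Set (Fin m)).ncard ≤ 2 := by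
      refine (Set.ncard_le_ncard ?_ (Set.toFinite _)).trans (hdeg x)
      rintro y (rfl | rfl | rfl)
      exacts [ha, hb, hc]
    rw [Set.ncard_eq_three.2 ⟨a, b, c, hab, hac, hbc, rfl⟩] at h3
    omega
  have hpne : ∀ i j, i < m → j < m → i ≠ j → p i ≠ p j := fun i j hi hj hne e =>
    hne (hp.1 i j hi hj e)
  refine ⟨q, H.Adj (p 0) (p 0), H.Adj (p (m - 1)) (p (m - 1)),
    3 ≤ m ∧ H.Adj (p 0) (p (m - 1)), ?_, hqm, fun i hi => ⟨p i, hqp i hi⟩, ?_, ?_⟩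
  · intro x y hxy
    rw [← hq x, ← hq y, hxy]
  · rintro ⟨h3, hC⟩
    have h01 : H.Adj (p 0) (p 1) := hp.2 0 (by omega)
    have hl : H.Adj (p (m - 1)) (p (m - 2)) := by
      have := hp.2 (m - 2) (by omega)
      rw [show m - 2 + 1 = m - 1 by omega] at this
      exact H.symm this
    refine ⟨h3, fun hA => ?_, fun hB => ?_⟩
    · exact hthree _ _ _ _ hA h01 hC (hpne _ _ (by omega) (by omega) (by omega))
        (hpne _ _ (by omega) (by omega) (by omega)) (hpne _ _ (by omega) (by omega) (by omega))
    · exact hthree _ _ _ _ hB hl (H.symm hC) (hpne _ _ (by omega) (by omega) (by omega))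
        (hpne _ _ (by omega) (by omega) (by omega)) (hpne _ _ (by omega) (by omega) (by omega))
  · intro x y
    obtain ⟨i, hi, rfl⟩ : ∃ i < m, p i = x := ⟨q x, hqm x, hq x⟩
    obtain ⟨j, hj, rfl⟩ : ∃ j < m, p j = y := ⟨q y, hqm y, hq y⟩
    rw [hqp i hi, hqp j hj]
    constructor
    · intro h
      by_cases hi' : 0 < i ∧ i + 1 < m
      · have := hinner' i j hi'.1 hi'.2 hj h
        omega
      by_cases hj' : 0 < j ∧ j + 1 < m
      · have := hinner' j i hj'.1 hj'.2 hi (H.symm h)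
        omega
      have hi2 : i = 0 ∨ i = m - 1 := by omega
      have hj2 : j = 0 ∨ j = m - 1 := by omega
      by_cases h3 : 3 ≤ m
      · rcases hi2 with rfl | rfl <;> rcases hj2 with rfl | rfl
        · exact Or.inr (Or.inr (Or.inl ⟨rfl, rfl, h⟩))
        · exact Or.inr (Or.inr (Or.inr (Or.inr ⟨⟨h3, h⟩, Or.inl ⟨rfl, by omega⟩⟩)))
        · exact Or.inr (Or.inr (Or.inr (Or.inr ⟨⟨h3, H.symm h⟩, Or.inr ⟨by omega, rfl⟩⟩)))
        · exact Or.inr (Or.inr (Or.inr (Or.inl ⟨by omega, by omega, h⟩)))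
      · by_cases hij : i = j
        · subst hij
          rcases hi2 with rfl | rfl
          · exact Or.inr (Or.inr (Or.inl ⟨rfl, rfl, h⟩))
          · exact Or.inr (Or.inr (Or.inr (Or.inl ⟨by omega, by omega, h⟩)))
        · omega
    · rintro (h | h | ⟨h, h', hA⟩ | ⟨h, h', hB⟩ | ⟨hC, ⟨h, h'⟩ | ⟨h, h'⟩⟩)
      · subst h
        exact hp.2 i hj
      · subst h
        exact H.symm (hp.2 j hi)
      · rwa [h, h']
      · rwa [show i = m - 1 by omega, show j = m - 1 by omega]
      · rw [h, show j = m - 1 by omega]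
        exact hC.2
      · rw [h', show i = m - 1 by omega]
        exact H.symm hC.2

/-- An isomorphism from a numbering of the vertices. -/
theorem isomorphic_of_numbering {k : ℕ} {H K : LoopGraph (Fin k)} {q : Fin k → ℕ}
    (hinj : Function.Injective q) (hq : ∀ x, q x < k)
    (hadj : ∀ x y, K.Adj ⟨q x, hq x⟩ ⟨q y, hq y⟩ ↔ H.Adj x y) : H.Isomorphic K := by
  have hinj' : Function.Injective (fun x => (⟨q x, hq x⟩ : Fin k)) := fun x y h =>
    hinj (by simpa using h)
  exact ⟨⟨Equiv.ofBijective _ (Finite.injective_iff_bijective.1 hinj'), fun {x y} => hadj x y⟩⟩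

theorem cycle_adj_iff {k : ℕ} (hk : k = 3 ∨ k = 5 ∨ k = 6 ∨ k = 7) (i j : Fin k) :
    (cycle k).Adj i j ↔ i.val + 1 = j.val ∨ j.val + 1 = i.val ∨
      (i.val = 0 ∧ j.val + 1 = k) ∨ (i.val + 1 = k ∧ j.val = 0) := by
  unfold cycle
  rcases hk with rfl | rfl | rfl | rfl <;> revert i j <;> decide

theorem loopedPath_adj_iff {k : ℕ} (i j : Fin k) :
    (loopedPath k).Adj i j ↔ i.val + 1 = j.val ∨ j.val + 1 = i.val ∨
      (i.val = 0 ∧ j.val = 0) ∨ (i.val + 1 = k ∧ j.val + 1 = k) := by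
  simp only [loopedPath, SimpleGraph.pathGraph_adj, Fin.ext_iff]
  omega

theorem noSquare_of_isomorphic {k l : ℕ} {H : LoopGraph (Fin k)} {K : LoopGraph (Fin l)}
    (h : H.Isomorphic K) (hK : ListColoring.NoSquare K) : ListColoring.NoSquare H := by
  obtain ⟨e⟩ := h
  intro a a' b b' ha hb h1 h2 h3 h4
  exact hK (e a) (e a') (e b) (e b') (e.injective.ne ha) (e.injective.ne hb)
    (e.map_rel_iff.2 h1) (e.map_rel_iff.2 h2) (e.map_rel_iff.2 h3) (e.map_rel_iff.2 h4)

theorem noSquare_cycle {k : ℕ} (hk : k = 3 ∨ k = 5 ∨ k = 6 ∨ k = 7) :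
    ListColoring.NoSquare (cycle k) := by
  intro a a' b b'
  simp only [cycle_adj_iff hk, ne_eq, Fin.ext_iff]
  omega

theorem noSquare_loopedPath {k : ℕ} (hk : k = 3 ∨ k = 4) :
    ListColoring.NoSquare (loopedPath k) := by
  intro a a' b b'
  simp only [loopedPath_adj_iff, ne_eq, Fin.ext_iff]
  omega

theorem IsExceptional.noSquare {k : ℕ} {H : LoopGraph (Fin k)} (h : H.IsExceptional) :
    ListColoring.NoSquare H := by
  rcases h with h | h | h | h | h | h
  · exact noSquare_of_isomorphic h (noSquare_cycle (by omega))
  · exact noSquare_of_isomorphic h (noSquare_cycle (by omega))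
  · exact noSquare_of_isomorphic h (noSquare_cycle (by omega))
  · exact noSquare_of_isomorphic h (noSquare_cycle (by omega))
  · exact noSquare_of_isomorphic h (noSquare_loopedPath (by omega))
  · exact noSquare_of_isomorphic h (noSquare_loopedPath (by omega))

end LoopGraph

namespace ListColoring

/-- The labels `0, 1, -1, 2, -2, …` of the vertices of a path that starts with a loop. -/
def pathLabel (j : ℕ) : ℤ := if j % 2 = 1 then ((j + 1) / 2 : ℕ) else -((j / 2 : ℕ) : ℤ)

theorem pathLabel_add_mem_iff (i j : ℕ) :
    (0 ≤ pathLabel i + pathLabel j ∧ pathLabel i + pathLabel j ≤ 1) ↔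
      i + 1 = j ∨ j + 1 = i ∨ (i = 0 ∧ j = 0) := by
  unfold pathLabel
  split_ifs <;> omega

/-- Colours at distance at least four in `H`, as witnessed by the potential `f`, do not occur
together. -/
theorem avoids_or_avoids {V W : Type*} {H : LoopGraph W} {G : SimpleGraph V}
    (hdiam : ∀ u v, G.edist u v ≤ 3) {φ : V → W} (hφ : ∀ u v, G.Adj u v → H.Adj (φ u) (φ v))
    (f : W → ℕ) (hf : ∀ a b, H.Adj a b → f b ≤ f a + 1) {P Q : W → Prop}
    (hPQ : ∀ a b, P a → Q b → f a + 4 ≤ f b) : (∀ v, ¬ P (φ v)) ∨ ∀ v, ¬ Q (φ v) := by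
  by_contra! h
  obtain ⟨⟨u, hu⟩, v, hv⟩ := h
  have huv := hPQ _ _ hu hv
  have step : ∀ x y, G.Adj x y → f (φ y) ≤ f (φ x) + 1 := fun x y h => hf _ _ (hφ x y h)
  rcases exists_path_of_edist_le (hdiam u v) with h | h | ⟨a, h₁, h₂⟩ | ⟨a, b, h₁, h₂, h₃⟩
  · subst h; omega
  · have := step _ _ h; omega
  · have := step _ _ h₁; have := step _ _ h₂; omega
  · have := step _ _ h₁; have := step _ _ h₂; have := step _ _ h₃; omega

/-- For a graph `H` that is not exceptional, the colours `x` and `y` (where the number `k` stands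
for no colour) do not both occur in a solution on a graph of diameter three, and `H` without one of
them has a labelling. -/
theorem exists_labellings {k : ℕ} {H : LoopGraph (Fin k)} (hconn : H.Connected)
    (hdeg : ∀ x, H.degree x ≤ 2) (hex : ¬ H.IsExceptional) :
    ∃ x y : ℕ, ∃ ω ω' : Fin k → ℤ, IsLabelling H {a | a.val ≠ x} ω ∧
      IsLabelling H {a | a.val ≠ y} ω' ∧
      ∀ (n : ℕ) (G : SimpleGraph (Fin n)) (φ : Fin n → Fin k), (∀ u v, G.edist u v ≤ 3) →
        (∀ u v, G.Adj u v → H.Adj (φ u) (φ v)) →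
        (∀ v, (φ v).val ≠ x) ∨ ∀ v, (φ v).val ≠ y := by
  obtain ⟨q, A, B, C, hinj, hq, hsurj, hC, hadj⟩ := LoopGraph.exists_numbering hconn hdeg
  have hsimple : ∀ ω, IsLabelling H {a | a.val ≠ k} ω → ∃ x y : ℕ, ∃ ω ω' : Fin k → ℤ,
      IsLabelling H {a | a.val ≠ x} ω ∧ IsLabelling H {a | a.val ≠ y} ω' ∧
      ∀ (n : ℕ) (G : SimpleGraph (Fin n)) (φ : Fin n → Fin k), (∀ u v, G.edist u v ≤ 3) →
        (∀ u v, G.Adj u v → H.Adj (φ u) (φ v)) →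
        (∀ v, (φ v).val ≠ x) ∨ ∀ v, (φ v).val ≠ y :=
    fun ω h => ⟨k, k, ω, ω, h, h, fun n G φ _ _ => Or.inl fun v => (φ v).2.ne⟩
  have hval : ∀ {a b : Fin k}, a.val ≠ b.val → q a ≠ q b := fun h e => h (by rw [hinj e])
  by_cases hC' : C
  · -- a cycle
    obtain ⟨hk3, hA, hB⟩ := hC hC'
    simp only [hA, hB, hC', and_false, false_or, true_and] at hadj
    have hcyc : (k = 3 ∨ k = 5 ∨ k = 6 ∨ k = 7) → H.Isomorphic (LoopGraph.cycle k) := fun hk =>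
      LoopGraph.isomorphic_of_numbering hinj hq fun x y => by
        rw [LoopGraph.cycle_adj_iff hk, hadj]
    have h3 : k ≠ 3 := by rintro rfl; exact hex (Or.inl (hcyc (by simp)))
    have h5 : k ≠ 5 := by rintro rfl; exact hex (Or.inr (Or.inl (hcyc (by simp))))
    have h6 : k ≠ 6 := by rintro rfl; exact hex (Or.inr (Or.inr (Or.inl (hcyc (by simp)))))
    have h7 : k ≠ 7 := by
      rintro rfl; exact hex (Or.inr (Or.inr (Or.inr (Or.inl (hcyc (by simp))))))
    by_cases h4 : k = 4
    · refine hsimple (fun a => if q a % 2 = 1 then 1 else -1) fun a _ b _ => ?_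
      have := hq a
      have := hq b
      rw [hadj]
      dsimp only
      split_ifs <;> omega
    · -- at least eight vertices, so the vertices numbered `0` and `4` have distance four
      obtain ⟨x, hx⟩ := hsurj 0 (by omega)
      obtain ⟨y, hy⟩ := hsurj 4 (by omega)
      refine ⟨x, y, fun a => pathLabel (q a),
        fun a => pathLabel (if 4 ≤ q a then q a - 4 else q a + k - 4), ?_, ?_, ?_⟩
      · intro a ha b hb
        have := hval ha
        have := hval hb
        rw [hadj, pathLabel_add_mem_iff]
        omega
      · intro a ha b hb
        have := hval ha
        have := hval hb
        have := hq a
        have := hq b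
        rw [hadj, pathLabel_add_mem_iff]
        split_ifs <;> omega
      · intro n G φ hdiam hφ
        refine avoids_or_avoids hdiam hφ (fun a => min (q a) (k - q a)) ?_
          (P := fun a => a.val = x.val) (Q := fun a => a.val = y.val) ?_
        · intro a b hab
          have := hq a
          have := hq b
          rw [hadj] at hab
          omega
        · intro a b ha hb
          obtain rfl := Fin.ext ha
          obtain rfl := Fin.ext hb
          omega
  · simp only [hC', false_and, or_false] at hadj
    by_cases hA : A
    · by_cases hB : B
      · -- a path with loops at both ends
        simp only [hA, hB, and_true] at hadj
        have hpath : H.Isomorphic (LoopGraph.loopedPath k) :=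
          LoopGraph.isomorphic_of_numbering hinj hq fun x y => by
            rw [LoopGraph.loopedPath_adj_iff, hadj]
        have h3 : k ≠ 3 := by
          rintro rfl; exact hex (Or.inr (Or.inr (Or.inr (Or.inr (Or.inl hpath)))))
        have h4 : k ≠ 4 := by
          rintro rfl; exact hex (Or.inr (Or.inr (Or.inr (Or.inr (Or.inr hpath)))))
        by_cases h2 : k ≤ 2
        · refine hsimple (fun _ => 0) fun a _ b _ => ?_
          have := hq a
          have := hq b
          rw [hadj]
          dsimp only
          omega
        · -- at least five vertices, so the two ends have distance at least four
          obtain ⟨x, hx⟩ := hsurj 0 (by omega)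
          obtain ⟨y, hy⟩ := hsurj (k - 1) (by omega)
          refine ⟨x, y, fun a => pathLabel (k - 1 - q a), fun a => pathLabel (q a), ?_, ?_, ?_⟩
          · intro a ha b hb
            have := hval ha
            have := hval hb
            have := hq a
            have := hq b
            rw [hadj, pathLabel_add_mem_iff]
            omega
          · intro a ha b hb
            have := hval ha
            have := hval hb
            have := hq a
            have := hq b
            rw [hadj, pathLabel_add_mem_iff]
            omega
          · intro n G φ hdiam hφ
            refine avoids_or_avoids hdiam hφ q ?_
              (P := fun a => a.val = x.val) (Q := fun a => a.val = y.val) ?_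
            · intro a b hab
              rw [hadj] at hab
              omega
            · intro a b ha hb
              obtain rfl := Fin.ext ha
              obtain rfl := Fin.ext hb
              omega
      · -- a path with a loop at its first vertex
        refine hsimple (fun a => pathLabel (q a)) fun a _ b _ => ?_
        simp only [hA, hB, and_true, and_false, or_false] at hadj
        rw [hadj, pathLabel_add_mem_iff]
    · by_cases hB : B
      · -- a path with a loop at its last vertex
        refine hsimple (fun a => pathLabel (k - 1 - q a)) fun a _ b _ => ?_
        have := hq a
        have := hq b
        simp only [hA, hB, and_true, and_false, false_or] at hadj
        rw [hadj, pathLabel_add_mem_iff]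
        omega
      · -- a path without loops: shifted labels avoid the label `0`
        refine hsimple (fun a => pathLabel (q a + 1)) fun a _ b _ => ?_
        simp only [hA, hB, and_false, or_false] at hadj
        rw [hadj, pathLabel_add_mem_iff]
        omega

end ListColoring

/-! ### Path consistency as a command -/

namespace RAM

namespace SumExpr

/-- An expression is true if its value is not `0`. -/
def Holds (e : SumExpr) (s : Store) : Prop := e.val s ≠ 0

def add (e f : SumExpr) : SumExpr := bin .add e f
def sub (e f : SumExpr) : SumExpr := bin .sub e f
def eq (e f : SumExpr) : SumExpr := bin .eq e f
def lt (e f : SumExpr) : SumExpr := bin .lt e f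
def neg (e : SumExpr) : SumExpr := eq e (const 0)
def conj (e f : SumExpr) : SumExpr := neg (add (neg e) (neg f))
def imp (e f : SumExpr) : SumExpr := lt (const 0) (add (neg e) f)
def disj (e f : SumExpr) : SumExpr := lt (const 0) (add e f)
/-- `e` is true for all values of the variable `x` below the variable `r`. -/
def all (x r : ℕ) (e : SumExpr) : SumExpr := neg (sum x r (neg e))
/-- `e` is true for some value of the variable `x` below the variable `r`. -/
def ex (x r : ℕ) (e : SumExpr) : SumExpr := lt (const 0) (sum x r e)
/-- The number of values of the variable `x` below the variable `r` for which `e` is true. -/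
def count (x r : ℕ) (e : SumExpr) : SumExpr := sum x r (lt (const 0) e)

section simps

variable (e f : SumExpr) (s : Store) (m x r a : ℕ)

@[simp] theorem val_const : (const m).val s = m := rfl
@[simp] theorem val_var : (var x).val s = s.var x := rfl
@[simp] theorem val_get : (get a e f).val s = s.arr a (e.val s) (f.val s) := rfl
@[simp] theorem val_add : (add e f).val s = e.val s + f.val s := rfl
@[simp] theorem val_sub : (sub e f).val s = e.val s - f.val s := rfl
@[simp] theorem val_sum : (sum x r e).val s =
    ∑ i ∈ Finset.range (s.var r), e.val (s.setVar x i) := rfl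

@[simp] theorem holds_get : (get a e f).Holds s ↔ s.arr a (e.val s) (f.val s) ≠ 0 := Iff.rfl
@[simp] theorem holds_var : (var x).Holds s ↔ s.var x ≠ 0 := Iff.rfl

@[simp] theorem holds_eq : (eq e f).Holds s ↔ e.val s = f.val s := by
  simp [Holds, eq, val, BinOp.app]

@[simp] theorem holds_lt : (lt e f).Holds s ↔ e.val s < f.val s := by
  simp [Holds, lt, val, BinOp.app]

@[simp] theorem holds_neg : (neg e).Holds s ↔ ¬ e.Holds s := by
  by_cases h : e.val s = 0 <;> simp [neg, Holds, eq, val, BinOp.app, h]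

theorem val_eq_zero_iff : e.val s = 0 ↔ ¬ e.Holds s := by simp [Holds]

@[simp] theorem holds_conj : (conj e f).Holds s ↔ e.Holds s ∧ f.Holds s := by
  rw [conj, holds_neg, Holds, val_add, not_not, Nat.add_eq_zero_iff, val_eq_zero_iff,
    val_eq_zero_iff, holds_neg, holds_neg, not_not, not_not]

@[simp] theorem holds_disj : (disj e f).Holds s ↔ e.Holds s ∨ f.Holds s := by
  rw [disj, holds_lt]
  simp only [val_const, val_add, Holds]
  omega

@[simp] theorem holds_imp : (imp e f).Holds s ↔ (e.Holds s → f.Holds s) := by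
  change (disj (neg e) f).Holds s ↔ _
  rw [holds_disj, holds_neg, imp_iff_not_or]

@[simp] theorem holds_all : (all x r e).Holds s ↔ ∀ i < s.var r, e.Holds (s.setVar x i) := by
  rw [all, holds_neg, Holds, not_not, val_sum, Finset.sum_eq_zero_iff]
  simp only [Finset.mem_range, val_eq_zero_iff, holds_neg, not_not]

@[simp] theorem holds_ex : (ex x r e).Holds s ↔ ∃ i < s.var r, e.Holds (s.setVar x i) := by
  rw [ex, holds_lt, val_const, Nat.pos_iff_ne_zero, val_sum, Ne, Finset.sum_eq_zero_iff]
  simp only [Finset.mem_range, not_forall, exists_prop, Holds, ne_eq]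

theorem val_count {n : ℕ} (hr : s.var r = n) {p : Fin n → Prop}
    (hp : ∀ i : Fin n, e.Holds (s.setVar x i) ↔ p i) : (count x r e).val s = {i | p i}.ncard := by
  classical
  rw [count, val_sum, hr, Finset.sum_range]
  have : ∀ i : Fin n, (lt (const 0) e).val (s.setVar x i) = if p i then 1 else 0 := by
    intro i
    have := hp i
    simp only [Holds] at this
    simp only [lt, val, BinOp.app, Nat.pos_iff_ne_zero, this]
  simp only [this, Finset.sum_boole]
  rw [Set.ncard_eq_toFinset_card']
  simp

end simps

end SumExpr

theorem exists_lt_iff_fin {n : ℕ} {p : ℕ → Prop} : (∃ i < n, p i) ↔ ∃ i : Fin n, p i := by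
  simp [Fin.exists_iff]

theorem forall_lt_iff_fin {n : ℕ} {p : ℕ → Prop} : (∀ i < n, p i) ↔ ∀ i : Fin n, p i := by
  simp [Fin.forall_iff]

/-- The size variables, the variables from `20` to `v - 1`, and the arrays below `a` are the same in
both stores. The variables from `8` to `19` only serve to run over ranges. -/
def Kept (v a : ℕ) (s s' : Store) : Prop :=
  (∀ x, x < 8 ∨ (20 ≤ x ∧ x < v) → s'.var x = s.var x) ∧ ∀ b < a, s'.arr b = s.arr b

theorem Kept.refl (v a : ℕ) (s : Store) : Kept v a s s := ⟨fun _ _ => rfl, fun _ _ => rfl⟩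

theorem Kept.trans {v a v' a' : ℕ} {s s' s'' : Store} (h : Kept v a s s') (h' : Kept v' a' s' s'')
    (hv : v ≤ v') (ha : a ≤ a') : Kept v a s s'' :=
  ⟨fun x hx => by rw [h'.1 x (by omega), h.1 x hx],
    fun b hb => by rw [h'.2 b (by omega), h.2 b hb]⟩

theorem Kept.mono {v a v' a' : ℕ} {s s' : Store} (h : Kept v a s s') (hv : v' ≤ v) (ha : a' ≤ a) :
    Kept v' a' s s' :=
  ⟨fun x hx => h.1 x (by omega), fun b hb => h.2 b (by omega)⟩

theorem Kept.setVar {v a : ℕ} {s s' : Store} (h : Kept v a s s') {x : ℕ} (hx : v ≤ x)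
    (h20 : 20 ≤ x) (m : ℕ) : Kept v a s (s'.setVar x m) :=
  ⟨fun y hy => by simp [show y ≠ x by omega, h.1 y hy], h.2⟩

theorem kept_setVar {v a : ℕ} (s : Store) {x : ℕ} (hx : v ≤ x ∨ x < 20) (h8 : 8 ≤ x) (m : ℕ) :
    Kept v a s (s.setVar x m) :=
  ⟨fun y hy => by simp [show y ≠ x by omega], fun _ _ => rfl⟩

namespace Cmd

theorem kept_fill₁ {a r : ℕ} {e : SumExpr} (he : e.Ok) (ha : ¬ e.Reads a) (s : Store) (v : ℕ) :
    Kept v a s ((fill₁ a r e).run s) :=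
  ⟨fun x hx => (run_fill₁ he ha s).1 x (by omega), fun b hb => (run_fill₁ he ha s).2.1 b hb.ne⟩

theorem kept_fill₂ {a r q : ℕ} (hq : q < 8) {e : SumExpr} (he : e.Ok) (ha : ¬ e.Reads a)
    (s : Store) (v : ℕ) : Kept v a s ((fill₂ a r q e).run s) :=
  ⟨fun x hx => (run_fill₂ hq he ha s).1 x (by omega) (by omega),
    fun b hb => (run_fill₂ hq he ha s).2.1 b hb.ne⟩

end Cmd

end RAM

namespace ListColoring

open RAM RAM.SumExpr RAM.Cmd

variable {k n : ℕ}

/-- The number that represents an assignment `(v, c)` in the program. -/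
def code (x : Fin n × Fin k) : ℕ := finProdFinEquiv x

theorem code_eq (x : Fin n × Fin k) : code x = x.2 + k * x.1 := rfl

theorem code_lt (x : Fin n × Fin k) : code x < n * k := (finProdFinEquiv x).2

theorem code_inj {x y : Fin n × Fin k} : code x = code y ↔ x = y :=
  ⟨fun h => finProdFinEquiv.injective (Fin.ext h), fun h => h ▸ rfl⟩

/-- The common data of all computations: the sizes, the adjacency matrix in array `0`, the vertex
and the colour of every assignment in the arrays `2` and `3`, and compatibility in array `4`. -/
structure Base (H : LoopGraph (Fin k)) (G : SimpleGraph (Fin n)) (s : Store) : Prop where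
  n_eq : s.var 0 = n
  k_eq : s.var 1 = k
  nk_eq : s.var 2 = n * k
  adj : ∀ u v : Fin n, s.arr 0 u v ≠ 0 ↔ G.Adj u v
  vertex : ∀ x : Fin n × Fin k, s.arr 2 (code x) 0 = x.1
  color : ∀ x : Fin n × Fin k, s.arr 3 (code x) 0 = x.2
  compat : ∀ x y : Fin n × Fin k, s.arr 4 (code x) (code y) ≠ 0 ↔ Compat H G x y

/-- The array `a` contains the lists `Λ`. -/
def ListAt (a : ℕ) (Λ : Fin n → Fin k → Prop) (s : Store) : Prop :=
  ∀ x : Fin n × Fin k, s.arr a (code x) 0 ≠ 0 ↔ Λ x.1 x.2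

/-- The array `a` contains the pairs `P` of assignments. -/
def PairsAt (a : ℕ) (P : Fin n × Fin k → Fin n × Fin k → Prop) (s : Store) : Prop :=
  ∀ x y : Fin n × Fin k, s.arr a (code x) (code y) ≠ 0 ↔ P x y

theorem Base.kept {H : LoopGraph (Fin k)} {G : SimpleGraph (Fin n)} {s s' : Store} {v a : ℕ}
    (h : Base H G s) (hk : Kept v a s s') (ha : 5 ≤ a) : Base H G s' where
  n_eq := by rw [hk.1 0 (by omega), h.n_eq]
  k_eq := by rw [hk.1 1 (by omega), h.k_eq]
  nk_eq := by rw [hk.1 2 (by omega), h.nk_eq]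
  adj := by rw [hk.2 0 (by omega)]; exact h.adj
  vertex := by rw [hk.2 2 (by omega)]; exact h.vertex
  color := by rw [hk.2 3 (by omega)]; exact h.color
  compat := by rw [hk.2 4 (by omega)]; exact h.compat

theorem ListAt.kept {Λ : Fin n → Fin k → Prop} {s s' : Store} {v a b : ℕ}
    (h : ListAt b Λ s) (hk : Kept v a s s') (hb : b < a) : ListAt b Λ s' := by
  unfold ListAt
  rw [hk.2 b hb]
  exact h

/-- The code of the assignment of the colour `f` to the vertex `e`. -/
def codeExpr (e f : SumExpr) : SumExpr := add f (.sum 15 1 e)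

theorem val_codeExpr {s : Store} (hk : s.var 1 = k) {e f : SumExpr} (u : Fin n) (c : Fin k)
    (he : ∀ i, e.val (s.setVar 15 i) = u) (hf : f.val s = c) :
    (codeExpr e f).val s = code (u, c) := by
  simp [codeExpr, code_eq, he, hf, hk]

theorem listAt_fill₁ {a : ℕ} {e : SumExpr} (he : e.Ok) (ha : ¬ e.Reads a) {s : Store}
    (hs : s.var 2 = n * k) {Λ : Fin n → Fin k → Prop}
    (h : ∀ x : Fin n × Fin k, e.Holds (s.setVar 8 (code x)) ↔ Λ x.1 x.2) :
    ListAt a Λ ((fill₁ a 2 e).run s) := by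
  intro x
  rw [(run_fill₁ he ha s).2.2 _ (by rw [hs]; exact code_lt x)]
  exact h x

theorem pairsAt_fill₂ {a : ℕ} {e : SumExpr} (he : e.Ok) (ha : ¬ e.Reads a) {s : Store}
    (hs : s.var 2 = n * k) {P : Fin n × Fin k → Fin n × Fin k → Prop}
    (h : ∀ x y, e.Holds ((s.setVar 8 (code x)).setVar 9 (code y)) ↔ P x y) :
    PairsAt a P ((fill₂ a 2 2 e).run s) := by
  intro x y
  rw [(run_fill₂ (by omega) he ha s).2.2 _ (by rw [hs]; exact code_lt x) _
    (by rw [hs]; exact code_lt y)]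
  exact h x y

/-- The initial pairs for the lists in array `16`. -/
def initialExpr : SumExpr :=
  conj (conj (get 16 (var 8) (const 0)) (get 16 (var 9) (const 0))) (get 4 (var 8) (var 9))

/-- One round of path consistency on the pairs in array `17`. -/
def refineExpr : SumExpr :=
  conj (get 17 (var 8) (var 9)) <| .all 10 0 <| .ex 11 1 <|
    conj (get 17 (var 8) (codeExpr (var 10) (var 11)))
      (get 17 (codeExpr (var 10) (var 11)) (var 9))

/-- Every vertex has at least one and at most `K` colours left. -/
def acceptExpr (K : ℕ) : SumExpr :=
  .all 10 0 <|
    conj (.ex 11 1 (get 17 (codeExpr (var 10) (var 11)) (codeExpr (var 10) (var 11))))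
      (lt (count 11 1 (get 17 (codeExpr (var 10) (var 11)) (codeExpr (var 10) (var 11))))
        (const (K + 1)))

/-- One round of path consistency on the pairs in array `17`; the array `18` is auxiliary. -/
def refineCmd : Cmd :=
  .seq (fill₂ 18 2 2 refineExpr) (fill₂ 17 2 2 (get 18 (var 8) (var 9)))

/-- Apply path consistency to the lists in array `16`; if it is successful, then set the variable
`24`. -/
def consistencyCmd (K : ℕ) : Cmd :=
  .seq (fill₂ 17 2 2 initialExpr) <|
  .seq (.iter 25 2 (.iter 26 2 refineCmd)) <|
  .set 24 (disj (var 24) (acceptExpr K))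

/-- Path consistency leaves at least one and at most `K` colours for every vertex. -/
def Accepts (H : LoopGraph (Fin k)) (G : SimpleGraph (Fin n)) (K : ℕ) (Λ : Fin n → Fin k → Prop) :
    Prop :=
  ∀ u, (∃ a, consistentPairs H G Λ (u, a) (u, a)) ∧
    {a | consistentPairs H G Λ (u, a) (u, a)}.ncard ≤ K

variable {H : LoopGraph (Fin k)} {G : SimpleGraph (Fin n)}

theorem run_refineCmd {s : Store} (hs : Base H G s) {P : Fin n × Fin k → Fin n × Fin k → Prop}
    (hP : PairsAt 17 P s) :
    Kept 25 17 s (refineCmd.run s) ∧ PairsAt 17 (refinePairs P) (refineCmd.run s) := by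
  have ok₁ : refineExpr.Ok := by
    simp [refineExpr, conj, neg, add, eq, lt, SumExpr.all, SumExpr.ex, codeExpr, SumExpr.Ok]
  have rd₁ : ¬ refineExpr.Reads 18 := by
    simp [refineExpr, conj, neg, add, eq, lt, SumExpr.all, SumExpr.ex, codeExpr, SumExpr.Reads]
  have ok₂ : (get 18 (var 8) (var 9)).Ok := by simp [SumExpr.Ok]
  have rd₂ : ¬ (get 18 (var 8) (var 9)).Reads 17 := by simp [SumExpr.Reads]
  set s₁ := (fill₂ 18 2 2 refineExpr).run s with hs₁
  have k₁ : Kept 25 18 s s₁ := kept_fill₂ (by omega) ok₁ rd₁ s 25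
  have k₂ := kept_fill₂ (a := 17) (r := 2) (q := 2) (by omega) ok₂ rd₂ s₁ 25
  have p₁ : PairsAt 18 (refinePairs P) s₁ := by
    refine pairsAt_fill₂ ok₁ rd₁ hs.nk_eq fun x y => ?_
    rw [refineExpr, holds_conj, holds_get, holds_all]
    simp only [Store.setVar_var, OfNat.zero_ne_ofNat, if_false, val_var, Store.setVar_arr,
      Nat.reduceEqDiff, if_true, hs.n_eq, forall_lt_iff_fin (n := n)]
    refine and_congr (hP x y) (forall_congr' fun w => ?_)
    rw [holds_ex]
    simp only [Store.setVar_var, if_false, hs.k_eq, exists_lt_iff_fin (n := k),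
      OfNat.one_ne_ofNat]
    refine exists_congr fun c => ?_
    rw [holds_conj, holds_get, holds_get, val_codeExpr (k := k) (by simp [hs.k_eq]) w c (by simp)
      (by simp)]
    simp only [val_var, Store.setVar_var, Nat.reduceEqDiff, if_false, if_true, Store.setVar_arr]
    rw [hP, hP]
  refine ⟨(k₁.mono le_rfl (by omega)).trans k₂ le_rfl le_rfl, ?_⟩
  refine pairsAt_fill₂ ok₂ rd₂ (by rw [k₁.1 2 (by omega)]; exact hs.nk_eq) fun x y => ?_
  simp only [holds_get, val_var, Store.setVar_var, Nat.reduceEqDiff, if_false, if_true,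
    Store.setVar_arr]
  exact p₁ x y

theorem holds_acceptExpr {s : Store} (hs : Base H G s) {Λ : Fin n → Fin k → Prop}
    (hP : PairsAt 17 (consistentPairs H G Λ) s) (K : ℕ) :
    (acceptExpr K).Holds s ↔ Accepts H G K Λ := by
  rw [acceptExpr, holds_all, hs.n_eq, forall_lt_iff_fin]
  refine forall_congr' fun u => ?_
  have hval : ∀ c : Fin k, (codeExpr (var 10) (var 11)).val ((s.setVar 10 u).setVar 11 c) =
      code (u, c) := fun c => val_codeExpr (k := k) (by simp [hs.k_eq]) u c (by simp) (by simp)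
  have hget : ∀ c : Fin k, (get 17 (codeExpr (var 10) (var 11))
      (codeExpr (var 10) (var 11))).Holds ((s.setVar 10 u).setVar 11 c) ↔
      consistentPairs H G Λ (u, c) (u, c) := by
    intro c
    rw [holds_get, hval]
    exact hP _ _
  have hk : (s.setVar 10 u).var 1 = k := by simp [hs.k_eq]
  rw [holds_conj, holds_ex, hk, exists_lt_iff_fin, holds_lt, val_count _ _ _ _ hk hget, val_const,
    Nat.lt_succ_iff]
  exact and_congr_left' (exists_congr hget)

theorem run_consistencyCmd {s : Store} (hs : Base H G s) {Λ : Fin n → Fin k → Prop}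
    (hΛ : ListAt 16 Λ s) (K : ℕ) :
    Kept 24 17 s ((consistencyCmd K).run s) ∧
    (((consistencyCmd K).run s).var 24 ≠ 0 ↔ s.var 24 ≠ 0 ∨ Accepts H G K Λ) := by
  have ok₁ : initialExpr.Ok := by
    simp [initialExpr, conj, neg, add, eq, SumExpr.Ok]
  have rd₁ : ¬ initialExpr.Reads 17 := by
    simp [initialExpr, conj, neg, add, eq, SumExpr.Reads]
  set s₁ := (fill₂ 17 2 2 initialExpr).run s with hs₁
  have k₁ : Kept 25 17 s s₁ := kept_fill₂ (by omega) ok₁ rd₁ s 25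
  have p₁ : PairsAt 17 (initialPairs H G Λ) s₁ := by
    refine pairsAt_fill₂ ok₁ rd₁ hs.nk_eq fun x y => ?_
    simp only [initialExpr, holds_conj, holds_get, val_var, val_const, Store.setVar_var,
      Nat.reduceEqDiff, if_false, if_true, Store.setVar_arr]
    rw [hΛ x, hΛ y, hs.compat, initialPairs, and_assoc]
  have hb₁ := hs.kept k₁ (by omega)
  -- after `i` outer and `j` inner rounds, `i * (n * k) + j` rounds have been performed
  have inner : ∀ m s₂, Base H G s₂ → PairsAt 17 (refinePairs^[m] (initialPairs H G Λ)) s₂ →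
      Kept 25 17 s₂ ((Cmd.iter 26 2 refineCmd).run s₂) ∧
      PairsAt 17 (refinePairs^[m + n * k] (initialPairs H G Λ))
        ((Cmd.iter 26 2 refineCmd).run s₂) := by
    intro m s₂ hb₂ p₂
    have := loopState_induction refineCmd.run 26 s₂ (s₂.var 2)
      (fun j s' => Kept 25 17 s₂ s' ∧
        PairsAt 17 (refinePairs^[m + j] (initialPairs H G Λ)) s') ⟨Kept.refl _ _ _, p₂⟩ ?_
    · rw [hb₂.nk_eq] at this
      rw [Cmd.run, hb₂.nk_eq]
      exact this
    · rintro j - s' ⟨hk', hp'⟩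
      have hk'' : Kept 25 17 s₂ (s'.setVar 26 j) := hk'.setVar (by omega) (by omega) _
      obtain ⟨h1, h2⟩ := run_refineCmd (hb₂.kept hk'' (by omega))
        (P := refinePairs^[m + j] (initialPairs H G Λ)) hp'
      refine ⟨hk''.trans h1 le_rfl le_rfl, ?_⟩
      rwa [← Nat.add_assoc, Function.iterate_succ_apply']
  have outer : Kept 25 17 s₁ ((Cmd.iter 25 2 (.iter 26 2 refineCmd)).run s₁) ∧
      PairsAt 17 (refinePairs^[(n * k) * (n * k)] (initialPairs H G Λ))
        ((Cmd.iter 25 2 (.iter 26 2 refineCmd)).run s₁) := by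
    have := loopState_induction (Cmd.iter 26 2 refineCmd).run 25 s₁ (s₁.var 2)
      (fun i s' => Kept 25 17 s₁ s' ∧
        PairsAt 17 (refinePairs^[i * (n * k)] (initialPairs H G Λ)) s')
      ⟨Kept.refl _ _ _, by simpa using p₁⟩ ?_
    · rw [hb₁.nk_eq] at this
      rw [Cmd.run, hb₁.nk_eq]
      exact this
    · rintro i - s' ⟨hk', hp'⟩
      have hk'' : Kept 25 17 s₁ (s'.setVar 25 i) := hk'.setVar (by omega) (by omega) _
      obtain ⟨h1, h2⟩ := inner (i * (n * k)) _ (hb₁.kept hk'' (by omega)) hp'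
      refine ⟨hk''.trans h1 le_rfl le_rfl, ?_⟩
      rwa [Nat.add_mul, Nat.one_mul]
  set s₂ := (Cmd.iter 25 2 (.iter 26 2 refineCmd)).run s₁ with hs₂
  have hk₂ := k₁.trans outer.1 le_rfl le_rfl
  have hrun : (consistencyCmd K).run s =
      s₂.setVar 24 ((disj (var 24) (acceptExpr K)).val s₂) := rfl
  rw [hrun]
  refine ⟨(hk₂.mono (by omega) le_rfl).trans (kept_setVar s₂ (Or.inl le_rfl) (by omega) _) le_rfl
    le_rfl, ?_⟩
  simp only [Store.setVar_var, if_true]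
  have hcp : PairsAt 17 (consistentPairs H G Λ) s₂ := by
    have := outer.2
    simpa only [consistentPairs, Fintype.card_fin] using this
  have := holds_disj (var 24) (acceptExpr K) s₂
  rw [holds_acceptExpr (hs.kept hk₂ (by omega)) hcp, holds_var, hk₂.1 24 (by omega)] at this
  exact this

end ListColoring

/-! ### Preparation, and the polynomial cases -/

namespace RAM

namespace SumExpr

/-- The value of `e` divided by the variable `b`, provided that the quotient is at most the variable
`m`. -/
def divExpr (e : SumExpr) (b m : ℕ) : SumExpr :=
  .sum 11 m (lt (.sum 15 b (add (var 11) (const 1))) (add e (const 1)))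

theorem val_divExpr {e : SumExpr} {b m : ℕ} {s : Store} {x B M : ℕ} (hb : b ≠ 11)
    (he : ∀ i, e.val (s.setVar 11 i) = x) (hB : s.var b = B) (hM : s.var m = M) (hB0 : 0 < B)
    (hx : x / B ≤ M) : (divExpr e b m).val s = x / B := by
  have h : ∀ i, (lt (.sum 15 b (add (var 11) (const 1))) (add e (const 1))).val (s.setVar 11 i) =
      if i < x / B then 1 else 0 := by
    intro i
    have : (i + 1) * B < x + 1 ↔ i < x / B := by
      rw [Nat.lt_succ_iff, ← Nat.le_div_iff_mul_le hB0, Nat.succ_le_iff]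
    simp only [lt, val, BinOp.app, val_add, he, Store.setVar_var,
      if_neg hb, hB]
    simp only [Nat.reduceEqDiff, if_false, if_true, Finset.sum_const, Finset.card_range,
      smul_eq_mul, mul_comm B, this]
  rw [divExpr, val_sum, hM]
  simp only [h, Finset.sum_boole, Nat.cast_id]
  rw [show (Finset.range M).filter (· < x / B) = Finset.range (x / B) by ext; simp; omega]
  simp

end SumExpr

end RAM

namespace ListColoring

open RAM RAM.SumExpr RAM.Cmd

variable {k n : ℕ}

/-- Set the entries of the array `5` at the positions in `l`. -/
def marksCmd : List (ℕ × ℕ) → Cmd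
  | [] => .set 27 (const 0)
  | x :: l => .seq (.put 5 (const x.1) (const x.2) (const 1)) (marksCmd l)

theorem ok_marksCmd (l : List (ℕ × ℕ)) : (marksCmd l).Ok ∧ (marksCmd l).KeepsSizes := by
  induction l with
  | nil => simp [marksCmd, Cmd.Ok, SumExpr.Ok, KeepsSizes]
  | cons x l ih => exact ⟨⟨by simp [Cmd.Ok, SumExpr.Ok], ih.1⟩, ⟨trivial, ih.2⟩⟩

theorem run_marksCmd (l : List (ℕ × ℕ)) (s : Store) :
    (∀ x ≠ 27, ((marksCmd l).run s).var x = s.var x) ∧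
    (∀ b ≠ 5, ((marksCmd l).run s).arr b = s.arr b) ∧
    ∀ i j, ((marksCmd l).run s).arr 5 i j ≠ 0 ↔ (i, j) ∈ l ∨ s.arr 5 i j ≠ 0 := by
  induction l generalizing s with
  | nil =>
    refine ⟨fun x hx => ?_, fun _ _ => rfl, ?_⟩
    · simp [marksCmd, Cmd.run, hx]
    · simp [marksCmd, Cmd.run]
  | cons x l ih =>
    obtain ⟨h1, h2, h3⟩ := ih (s.setArr 5 x.1 x.2 1)
    refine ⟨fun y hy => ?_, fun b hb => ?_, fun i j => ?_⟩
    · exact (h1 y hy).trans rfl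
    · refine (h2 b hb).trans ?_
      funext i j
      simp [Store.setArr_arr, hb]
    · refine (h3 i j).trans ?_
      rw [Store.setArr_arr, List.mem_cons, Prod.ext_iff]
      by_cases h : i = x.1 ∧ j = x.2 <;> simp [h]

open Classical in
/-- The adjacent pairs of colours. -/
noncomputable def adjList (H : LoopGraph (Fin k)) : List (ℕ × ℕ) :=
  ((Finset.univ.filter fun x : Fin k × Fin k => H.Adj x.1 x.2).toList).map
    fun x => (x.1.val, x.2.val)

theorem mem_adjList {H : LoopGraph (Fin k)} (a b : Fin k) :
    (a.val, b.val) ∈ adjList H ↔ H.Adj a b := by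
  simp only [adjList, List.mem_map, Finset.mem_toList, Finset.mem_filter, Finset.mem_univ,
    true_and, Prod.mk.injEq, Prod.exists]
  constructor
  · rintro ⟨a', b', h, ha, hb⟩
    rwa [← Fin.ext ha, ← Fin.ext hb]
  · exact fun h => ⟨a, b, h, rfl, rfl⟩

/-- Compatibility of the assignments `8` and `9`. -/
def compatExpr : SumExpr :=
  conj
    (imp (eq (get 2 (var 8) (const 0)) (get 2 (var 9) (const 0)))
      (eq (get 3 (var 8) (const 0)) (get 3 (var 9) (const 0))))
    (imp (get 0 (get 2 (var 8) (const 0)) (get 2 (var 9) (const 0)))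
      (get 5 (get 3 (var 8) (const 0)) (get 3 (var 9) (const 0))))

/-- Compute the data in `Base`, with the lists of the assignments in array `6`. -/
noncomputable def prepareCmd (H : LoopGraph (Fin k)) : Cmd :=
  .seq (marksCmd (adjList H)) <|
  .seq (fill₁ 2 2 (divExpr (var 8) 1 0)) <|
  .seq (fill₁ 3 2 (sub (var 8) (.sum 15 1 (get 2 (var 8) (const 0))))) <|
  .seq (fill₂ 4 2 2 compatExpr)
    (fill₁ 6 2 (get 1 (get 2 (var 8) (const 0)) (get 3 (var 8) (const 0))))

/-- Compute the sizes `k` and `n * k`, and prepare. -/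
noncomputable def initCmd (H : LoopGraph (Fin k)) : Cmd :=
  .seq (.set 1 (const k)) <| .seq (.set 2 (.sum 10 0 (var 1))) (prepareCmd H)

theorem ok_prepareCmd (H : LoopGraph (Fin k)) :
    (prepareCmd H).Ok ∧ (prepareCmd H).KeepsSizes := by
  have := ok_marksCmd (adjList H)
  constructor <;>
    simp [prepareCmd, this, fill₁, fill₂, Cmd.Ok, SumExpr.Ok, KeepsSizes, divExpr, lt, add, sub,
      compatExpr, conj, imp, neg, eq]

theorem ok_initCmd (H : LoopGraph (Fin k)) : (initCmd H).Ok := by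
  simp [initCmd, Cmd.Ok, SumExpr.Ok, ok_prepareCmd]

theorem run_prepareCmd {H : LoopGraph (Fin k)} {G : SimpleGraph (Fin n)}
    {Λ : Fin n → Fin k → Prop} {s : Store} (h0 : s.var 0 = n) (h1 : s.var 1 = k)
    (h2 : s.var 2 = n * k) (hG : ∀ u v : Fin n, s.arr 0 u v ≠ 0 ↔ G.Adj u v)
    (hL : ∀ (v : Fin n) (c : Fin k), s.arr 1 v c ≠ 0 ↔ Λ v c) (h5 : ∀ i j, s.arr 5 i j = 0) :
    Base H G ((prepareCmd H).run s) ∧ ListAt 6 Λ ((prepareCmd H).run s) ∧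
      Kept 27 0 s ((prepareCmd H).run s) := by
  have ok₁ : (divExpr (var 8) 1 0).Ok := by simp [SumExpr.Ok, divExpr, lt, add]
  have rd₁ : ¬ (divExpr (var 8) 1 0).Reads 2 := by simp [SumExpr.Reads, divExpr, lt, add]
  have ok₂ : (sub (var 8) (.sum 15 1 (get 2 (var 8) (const 0)))).Ok := by simp [SumExpr.Ok, sub]
  have rd₂ : ¬ (sub (var 8) (.sum 15 1 (get 2 (var 8) (const 0)))).Reads 3 := by
    simp [SumExpr.Reads, sub]
  have ok₃ : compatExpr.Ok := by simp [SumExpr.Ok, compatExpr, conj, imp, neg, eq, add, lt]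
  have rd₃ : ¬ compatExpr.Reads 4 := by
    simp [SumExpr.Reads, compatExpr, conj, imp, neg, eq, add, lt]
  have ok₄ : (get 1 (get 2 (var 8) (const 0)) (get 3 (var 8) (const 0))).Ok := by simp [SumExpr.Ok]
  have rd₄ : ¬ (get 1 (get 2 (var 8) (const 0)) (get 3 (var 8) (const 0))).Reads 6 := by
    simp [SumExpr.Reads]
  set s₀ := (marksCmd (adjList H)).run s with hs₀
  obtain ⟨v₀, a₀, m₀⟩ := run_marksCmd (adjList H) s
  have k₀ : Kept 27 0 s s₀ := ⟨fun x hx => v₀ x (by omega), by simp⟩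
  set s₁ := (fill₁ 2 2 (divExpr (var 8) 1 0)).run s₀ with hs₁
  obtain ⟨-, a₁, f₁⟩ := run_fill₁ (r := 2) ok₁ rd₁ s₀
  have k₁ : Kept 27 2 s₀ s₁ := kept_fill₁ ok₁ rd₁ s₀ 27
  set s₂ := (fill₁ 3 2 (sub (var 8) (.sum 15 1 (get 2 (var 8) (const 0))))).run s₁ with hs₂
  obtain ⟨-, a₂, f₂⟩ := run_fill₁ (r := 2) ok₂ rd₂ s₁
  have k₂ : Kept 27 3 s₁ s₂ := kept_fill₁ ok₂ rd₂ s₁ 27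
  set s₃ := (fill₂ 4 2 2 compatExpr).run s₂ with hs₃
  have k₃ : Kept 27 4 s₂ s₃ := kept_fill₂ (by omega) ok₃ rd₃ s₂ 27
  have hrun : (prepareCmd H).run s =
    (fill₁ 6 2 (get 1 (get 2 (var 8) (const 0)) (get 3 (var 8) (const 0)))).run s₃ := rfl
  rw [hrun]
  set s₄ := (fill₁ 6 2 (get 1 (get 2 (var 8) (const 0)) (get 3 (var 8) (const 0)))).run s₃ with hs₄
  have k₄ : Kept 27 6 s₃ s₄ := kept_fill₁ ok₄ rd₄ s₃ 27
  have K₁ : Kept 27 0 s s₁ := k₀.trans k₁ le_rfl (by omega)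
  have K₂ : Kept 27 0 s s₂ := K₁.trans k₂ le_rfl (by omega)
  have K₃ : Kept 27 0 s s₃ := K₂.trans k₃ le_rfl (by omega)
  have hkpos : ∀ x : Fin n × Fin k, 0 < k := fun x => by have := x.2.2; omega
  have hdiv : ∀ x : Fin n × Fin k, code x / k = x.1 := fun x => by
    rw [code_eq, Nat.add_mul_div_left _ _ (hkpos x), Nat.div_eq_of_lt x.2.2, Nat.zero_add]
  have vertex : ∀ x : Fin n × Fin k, s₁.arr 2 (code x) 0 = x.1 := by
    intro x
    have e : s₀.var 2 = n * k := by rw [k₀.1 2 (by omega), h2]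
    rw [hs₁, f₁ _ (by rw [e]; exact code_lt x), val_divExpr (x := code x) (B := k) (M := n)
      (by omega) (by simp) (by simp [k₀.1 1, h1]) (by simp [k₀.1 0, h0]) (hkpos x) ?_, hdiv]
    rw [hdiv]
    exact x.1.2.le
  have vertex₂ : ∀ x : Fin n × Fin k, s₂.arr 2 (code x) 0 = x.1 := fun x => by
    rw [k₂.2 2 (by omega), vertex]
  have color : ∀ x : Fin n × Fin k, s₂.arr 3 (code x) 0 = x.2 := by
    intro x
    have e : s₁.var 2 = n * k := by rw [K₁.1 2 (by omega), h2]
    rw [hs₂, f₂ _ (by rw [e]; exact code_lt x)]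
    have hv := vertex x
    simp [K₁.1 1, h1, hv]
    simp [code_eq]
  have arr5 : ∀ a b : Fin k, s₂.arr 5 a b ≠ 0 ↔ H.Adj a b := by
    intro a b
    rw [hs₂, a₂ 5 (by omega), hs₁, a₁ 5 (by omega), hs₀, m₀, mem_adjList]
    simp [h5]
  have arr0 : ∀ u v : Fin n, s₂.arr 0 u v ≠ 0 ↔ G.Adj u v := by
    intro u v
    rw [hs₂, a₂ 0 (by omega), hs₁, a₁ 0 (by omega), hs₀, a₀ 0 (by omega), hG]
  have compat : ∀ x y : Fin n × Fin k, s₃.arr 4 (code x) (code y) ≠ 0 ↔ Compat H G x y := by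
    refine pairsAt_fill₂ ok₃ rd₃ (by rw [K₂.1 2 (by omega), h2]) fun x y => ?_
    simp only [compatExpr, holds_conj, holds_imp, holds_eq, holds_get, val_get, val_var, val_const,
      Store.setVar_var, Store.setVar_arr, Nat.reduceEqDiff, if_true, if_false, vertex₂, color,
      arr5, arr0, Compat, Fin.ext_iff]
  refine ⟨⟨?_, ?_, ?_, ?_, ?_, ?_, ?_⟩, ?_, K₃.trans k₄ le_rfl (by omega)⟩
  · rw [k₄.1 0 (by omega), K₃.1 0 (by omega), h0]
  · rw [k₄.1 1 (by omega), K₃.1 1 (by omega), h1]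
  · rw [k₄.1 2 (by omega), K₃.1 2 (by omega), h2]
  · rw [k₄.2 0 (by omega), k₃.2 0 (by omega)]
    exact arr0
  · rw [k₄.2 2 (by omega), k₃.2 2 (by omega)]
    exact vertex₂
  · rw [k₄.2 3 (by omega), k₃.2 3 (by omega)]
    exact color
  · rw [k₄.2 4 (by omega)]
    exact compat
  · refine listAt_fill₁ ok₄ rd₄ (by rw [K₃.1 2 (by omega), h2]) fun x => ?_
    simp only [holds_get, val_get, val_var, val_const, Store.setVar_var, Store.setVar_arr, if_true]
    rw [k₃.2 2 (by omega), k₃.2 3 (by omega), vertex₂, color, k₃.2 1 (by omega),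
      k₂.2 1 (by omega), k₁.2 1 (by omega), a₀ 1 (by omega), hL]

theorem input_arr_zero (G : SimpleGraph (Fin n)) (L : Fin n → Finset (Fin k)) (u v : Fin n) :
    (input G L).arr 0 u v ≠ 0 ↔ G.Adj u v := by
  simp [input]

theorem input_arr_one (G : SimpleGraph (Fin n)) (L : Fin n → Finset (Fin k)) (v : Fin n)
    (c : Fin k) : (input G L).arr 1 v c ≠ 0 ↔ c ∈ L v := by
  simp [input]

theorem run_initCmd (H : LoopGraph (Fin k)) (G : SimpleGraph (Fin n))
    (L : Fin n → Finset (Fin k)) :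
    Base H G ((initCmd H).run (input G L)) ∧
    ListAt 6 (fun v c => c ∈ L v) ((initCmd H).run (input G L)) ∧
    (∀ x, (3 ≤ x ∧ x < 8) ∨ (20 ≤ x ∧ x < 27) → ((initCmd H).run (input G L)).var x = 0) ∧
    ∀ M, n ≤ M → k ≤ M → n * k ≤ M → (initCmd H).SizeLE M (input G L) ∧
      ((initCmd H).run (input G L)).SizeLE M := by
  set s := ((input G L).setVar 1 k).setVar 2
    ((SumExpr.sum 10 0 (var 1)).val ((input G L).setVar 1 k)) with hs
  have hrun : (initCmd H).run (input G L) = (prepareCmd H).run s := rfl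
  have h0 : s.var 0 = n := by simp [hs, input]
  have h1 : s.var 1 = k := by simp [hs]
  have h2 : s.var 2 = n * k := by simp [hs, input]
  have hvar : ∀ x, 3 ≤ x → s.var x = 0 := fun x hx => by
    simp [hs, input, show x ≠ 0 by omega, show x ≠ 1 by omega, show x ≠ 2 by omega]
  obtain ⟨hB, hL, hK⟩ := run_prepareCmd (H := H) (G := G) (Λ := fun v c => c ∈ L v) h0 h1 h2
    (input_arr_zero G L) (input_arr_one G L) (by simp [hs, input])
  rw [hrun]
  refine ⟨hB, hL, fun x hx => ?_, fun M hn hk hnk => ?_⟩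
  · rw [hK.1 x (by omega), hvar x (by omega)]
  · have hsz : s.SizeLE M := by
      intro r hr
      rcases Nat.lt_or_ge r 3 with h | h
      · interval_cases r <;> omega
      · rw [hvar r h]; omega
    have hsz₀ : (input G L).SizeLE M := by
      intro r _
      simp only [input]
      split_ifs <;> omega
    have hsz₁ : ((input G L).setVar 1 k).SizeLE M := by
      intro r hr
      rw [Store.setVar_var]
      split_ifs
      · exact hk
      · exact hsz₀ r hr
    refine ⟨⟨hsz₀, hsz₁, sizeLE_of_keepsSizes (ok_prepareCmd H).2 hsz⟩, fun r hr => ?_⟩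
    rw [keepsSizes_run (ok_prepareCmd H).2 _ hr]
    exact hsz r hr

theorem hasListHom_iff {H : LoopGraph (Fin k)} {G : SimpleGraph (Fin n)}
    {L : Fin n → Finset (Fin k)} :
    H.HasListHom G L ↔ ∃ φ, IsSolution H G (fun v c => c ∈ L v) φ :=
  exists_congr fun _ => and_comm

theorem ok_consistencyCmd (K : ℕ) :
    (consistencyCmd K).Ok ∧ (consistencyCmd K).KeepsSizes := by
  constructor <;>
    simp [consistencyCmd, refineCmd, initialExpr, refineExpr, acceptExpr, fill₂, Cmd.Ok,
      SumExpr.Ok, KeepsSizes, codeExpr, lt, add, conj, neg, eq, disj, SumExpr.all, SumExpr.ex,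
      count]

theorem ediam_bound {G : SimpleGraph (Fin n)} (h : G.ediam = (3 : ℕ)) (u v : Fin n) :
    G.edist u v ≤ 3 := by
  have := G.edist_le_ediam (u := u) (v := v)
  rw [h] at this
  exact_mod_cast this

/-- A command whose compiled form solves the problem. -/
theorem solvesInTime_compile {H : LoopGraph (Fin k)} {d : ℕ} {c : Cmd} (hc : c.Ok) (M : ℕ → ℕ)
    (h : ∀ (n : ℕ) (G : SimpleGraph (Fin n)) (L : Fin n → Finset (Fin k)), G.ediam = d →
      c.SizeLE (M n) (input G L) ∧
      (H.HasListHom G L → (c.run (input G L)).var 0 = 1) ∧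
      (¬ H.HasListHom G L → (c.run (input G L)).var 0 = 0)) :
    SolvesInTime H d (c.compile 100) (fun n => ((c.time.eval (M n) : ℕ) : ℝ)) := by
  classical
  intro n G L hG
  obtain ⟨hM, h1, h0⟩ := h n G L hG
  obtain ⟨t, s, hex, hv, -, -, ht⟩ := exec_compile hc le_rfl (fun _ _ => rfl) rfl hM
  refine ⟨t, s, hex, Nat.cast_le.2 ht, ?_⟩
  rw [hv 0 (by omega)]
  by_cases hh : H.HasListHom G L
  · rw [h1 hh, if_pos hh]
  · rw [h0 hh, if_neg hh]

/-- Remove the colour `x` from all lists. -/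
def dropCmd (x : ℕ) : Cmd :=
  fill₁ 16 2 (conj (get 6 (var 8) (const 0)) (neg (eq (get 3 (var 8) (const 0)) (const x))))

theorem run_dropCmd {H : LoopGraph (Fin k)} {G : SimpleGraph (Fin n)} {s : Store} (hs : Base H G s)
    {Λ : Fin n → Fin k → Prop} (hΛ : ListAt 6 Λ s) (x : ℕ) :
    Kept 27 16 s ((dropCmd x).run s) ∧
      ListAt 16 (fun v c => Λ v c ∧ c.val ≠ x) ((dropCmd x).run s) := by
  have ok : (conj (get 6 (var 8) (const 0))
      (neg (eq (get 3 (var 8) (const 0)) (const x)))).Ok := by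
    simp [SumExpr.Ok, conj, neg, eq, add]
  have rd : ¬ (conj (get 6 (var 8) (const 0))
      (neg (eq (get 3 (var 8) (const 0)) (const x)))).Reads 16 := by
    simp [SumExpr.Reads, conj, neg, eq, add]
  refine ⟨kept_fill₁ ok rd s 27, listAt_fill₁ ok rd hs.nk_eq fun z => ?_⟩
  simp only [holds_conj, holds_neg, holds_get, holds_eq, val_get, val_var, val_const,
    Store.setVar_var, Store.setVar_arr, if_true, hΛ z, hs.color]

/-- Path consistency, with at most `K` colours, for the lists without the colour `x` and for the
lists without the colour `y`. -/
def twoRunsCmd (K x y : ℕ) : Cmd :=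
  .seq (.seq (dropCmd x) (consistencyCmd K)) (.seq (dropCmd y) (consistencyCmd K))

/-- Initialize, perform the computation `c`, and answer according to the variable `24`. -/
noncomputable def answerCmd (H : LoopGraph (Fin k)) (c : Cmd) : Cmd :=
  .seq (initCmd H) (.seq c (.set 0 (lt (const 0) (var 24))))

theorem run_answerCmd (H : LoopGraph (Fin k)) (c : Cmd) (s : Store) :
    ((answerCmd H c).run s).var 0 = if 0 < (c.run ((initCmd H).run s)).var 24 then 1 else 0 := by
  simp only [answerCmd, Cmd.run, lt, val, BinOp.app, Store.setVar_var, if_true]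
  rfl

theorem ok_twoRunsCmd (K x y : ℕ) : (twoRunsCmd K x y).Ok ∧ (twoRunsCmd K x y).KeepsSizes := by
  have h := ok_consistencyCmd K
  have hd : ∀ x, (dropCmd x).Ok ∧ (dropCmd x).KeepsSizes := by
    intro x
    constructor <;> simp [dropCmd, fill₁, Cmd.Ok, SumExpr.Ok, conj, neg, eq, add, KeepsSizes]
  exact ⟨⟨⟨(hd x).1, h.1⟩, (hd y).1, h.1⟩, ⟨⟨(hd x).2, h.2⟩, (hd y).2, h.2⟩⟩

theorem run_twoRunsCmd {H : LoopGraph (Fin k)} {G : SimpleGraph (Fin n)} {s : Store}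
    (hs : Base H G s) {Λ : Fin n → Fin k → Prop} (hΛ : ListAt 6 Λ s) (K x y : ℕ) :
    ((twoRunsCmd K x y).run s).var 24 ≠ 0 ↔ s.var 24 ≠ 0 ∨
      Accepts H G K (fun v c => Λ v c ∧ c.val ≠ x) ∨
      Accepts H G K (fun v c => Λ v c ∧ c.val ≠ y) := by
  have h := run_dropCmd hs hΛ x
  rw [twoRunsCmd, Cmd.run, Cmd.run, Cmd.run]
  generalize (dropCmd x).run s = s₁ at *
  have b₁ := hs.kept h.1 (by omega)
  have h' := run_consistencyCmd b₁ h.2 K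
  generalize (consistencyCmd K).run s₁ = s₂ at *
  have b₂ := b₁.kept h'.1 (by omega)
  have h'' := run_dropCmd b₂ ((hΛ.kept h.1 (by omega)).kept h'.1 (by omega)) y
  generalize (dropCmd y).run s₂ = s₃ at *
  rw [(run_consistencyCmd (b₂.kept h''.1 (by omega)) h''.2 K).2, h''.1.1 24 (by omega), h'.2,
    h.1.1 24 (by omega), or_assoc]

theorem exists_polynomial_program {H : LoopGraph (Fin k)} (hconn : H.Connected)
    (hdeg : ∀ x, H.degree x ≤ 2) (hex : ¬ H.IsExceptional) :
    ∃ (p : Program) (q : Polynomial ℕ), SolvesInTime H 3 p (fun n => ((q.eval n : ℕ) : ℝ)) := by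
  obtain ⟨x, y, ω, ω', hω, hω', havoid⟩ := exists_labellings hconn hdeg hex
  have hok := ok_twoRunsCmd k x y
  have hok' : (answerCmd H (twoRunsCmd k x y)).Ok :=
    ⟨ok_initCmd H, hok.1, by simp [Cmd.Ok, SumExpr.Ok, lt]⟩
  refine ⟨(answerCmd H (twoRunsCmd k x y)).compile 100, (answerCmd H (twoRunsCmd k x y)).time.comp
    (Polynomial.X + Polynomial.C k + Polynomial.X * Polynomial.C k), ?_⟩
  have hsolve := solvesInTime_compile (H := H) (d := 3) hok' (fun n => n + k + n * k) ?_
  · simpa only [Polynomial.eval_comp, Polynomial.eval_add, Polynomial.eval_mul, Polynomial.eval_X,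
      Polynomial.eval_C] using hsolve
  intro n G L hG
  obtain ⟨hB, hL, hz, hsz⟩ := run_initCmd H G L
  obtain ⟨hsz, hsz'⟩ := hsz (n + k + n * k) (by omega) (by omega) (by omega)
  have hacc : ((twoRunsCmd k x y).run ((initCmd H).run (input G L))).var 24 ≠ 0 ↔
      H.HasListHom G L := by
    rw [run_twoRunsCmd hB hL, hz 24 (by omega), hasListHom_iff]
    constructor
    · rintro (h | h | h)
      · exact absurd rfl h
      · obtain ⟨φ, hφ⟩ := exists_isSolution_of_isLabelling hω (fun v a h => h.2) fun u => (h u).1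
        exact ⟨φ, fun v => (hφ.1 v).1, hφ.2⟩
      · obtain ⟨φ, hφ⟩ := exists_isSolution_of_isLabelling hω' (fun v a h => h.2) fun u => (h u).1
        exact ⟨φ, fun v => (hφ.1 v).1, hφ.2⟩
    · rintro ⟨φ, hφ⟩
      have key : ∀ z, (∀ v, (φ v).val ≠ z) →
          Accepts H G k (fun v c => c ∈ L v ∧ c.val ≠ z) := by
        intro z hz'
        have hφ' : IsSolution H G (fun v c => c ∈ L v ∧ c.val ≠ z) φ :=
          ⟨fun v => ⟨hφ.1 v, hz' v⟩, hφ.2⟩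
        refine fun u => ⟨⟨φ u, hφ'.consistentPairs u u⟩, ?_⟩
        exact (Set.ncard_le_card _).trans (by simp)
      rcases havoid n G φ (ediam_bound hG) hφ.2 with h | h
      · exact Or.inr (Or.inl (key x h))
      · exact Or.inr (Or.inr (key y h))
  refine ⟨⟨hsz, sizeLE_of_keepsSizes hok.2 hsz', fun r hr => ?_⟩, fun h => ?_, fun h => ?_⟩
  · rw [keepsSizes_run hok.2 _ hr]
    exact hsz' r hr
  · rw [run_answerCmd, if_pos (Nat.pos_of_ne_zero (hacc.2 h))]
  · rw [run_answerCmd, if_neg (fun h' => h (hacc.1 h'.ne'))]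

end ListColoring

/-! ### Searching for a certificate -/

namespace ListColoring

open RAM RAM.SumExpr RAM.Cmd

variable {k n : ℕ}

theorem exists_digits (b s : ℕ) (g : ℕ → ℕ) (hg : ∀ i, g i < b) :
    ∃ z < b ^ s, ∀ i < s, z / b ^ i % b = g i := by
  refine ⟨finFunctionFinEquiv (fun i : Fin s => ⟨g i, hg i⟩), Fin.isLt _, fun i hi => ?_⟩
  have := congrFun (finFunctionFinEquiv.symm_apply_apply (fun i : Fin s => (⟨g i, hg i⟩ : Fin b)))
    ⟨i, hi⟩
  exact congrArg Fin.val this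

/-- The digit `i` of the number `z` in base `n * k`, as an assignment. -/
def digitNode (hN : 0 < n * k) (z i : ℕ) : Fin n × Fin k :=
  finProdFinEquiv.symm ⟨z / (n * k) ^ i % (n * k), Nat.mod_lt _ hN⟩

theorem code_digitNode (hN : 0 < n * k) (z i : ℕ) :
    code (digitNode hN z i) = z / (n * k) ^ i % (n * k) := by
  unfold code digitNode
  rw [Equiv.apply_symm_apply]

/-- The position of `w` among the vertices near `v₀`. -/
noncomputable def nearRank (G : SimpleGraph (Fin n)) (Λ : Fin n → Fin k → Prop)
    (v₀ w : Fin n) : ℕ :=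
  {x | x < w ∧ Near G Λ v₀ x}.ncard

/-- The lists `Λ` where the colours of the vertices near `v₀` have been fixed according to the first
`t` digits of `z` in base `k`. -/
def digitLists (G : SimpleGraph (Fin n)) (Λ : Fin n → Fin k → Prop) (v₀ : Fin n) (t z : ℕ)
    (w : Fin n) (c : Fin k) : Prop :=
  Λ w c ∧ (Near G Λ v₀ w → nearRank G Λ v₀ w < t ∧ z / k ^ nearRank G Λ v₀ w % k = c)

theorem nearRank_lt_nearRank {G : SimpleGraph (Fin n)} {Λ : Fin n → Fin k → Prop} {v₀ w w' : Fin n}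
    (hw : Near G Λ v₀ w) (h : w < w') : nearRank G Λ v₀ w < nearRank G Λ v₀ w' := by
  refine Set.ncard_lt_ncard ⟨fun x hx => ⟨hx.1.trans h, hx.2⟩, fun hsub => ?_⟩ (Set.toFinite _)
  exact lt_irrefl _ (hsub (a := w) ⟨h, hw⟩).1

theorem nearRank_lt_ncard {G : SimpleGraph (Fin n)} {Λ : Fin n → Fin k → Prop} {v₀ w : Fin n}
    (hw : Near G Λ v₀ w) : nearRank G Λ v₀ w < {w | Near G Λ v₀ w}.ncard := by
  refine Set.ncard_lt_ncard ⟨fun x hx => hx.2, fun hsub => ?_⟩ (Set.toFinite _)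
  exact lt_irrefl _ (hsub (a := w) hw).1

theorem exists_digitLists_eq (hk : 0 < k) {G : SimpleGraph (Fin n)} {Λ : Fin n → Fin k → Prop}
    {v₀ : Fin n} {t : ℕ} (ht : {w | Near G Λ v₀ w}.ncard ≤ t) (φ : Fin n → Fin k) :
    ∃ z < k ^ t, digitLists G Λ v₀ t z = guessLists G Λ φ v₀ := by
  classical
  let g : ℕ → ℕ := fun i =>
    if h : ∃ w, Near G Λ v₀ w ∧ nearRank G Λ v₀ w = i then φ h.choose else 0
  have hg : ∀ i, g i < k := by
    intro i
    dsimp only [g]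
    split_ifs
    · exact Fin.isLt _
    · exact hk
  have hgw : ∀ w, Near G Λ v₀ w → g (nearRank G Λ v₀ w) = φ w := by
    intro w hw
    have h : ∃ w', Near G Λ v₀ w' ∧ nearRank G Λ v₀ w' = nearRank G Λ v₀ w := ⟨w, hw, rfl⟩
    have e : h.choose = w := by
      rcases lt_trichotomy h.choose w with h' | h' | h'
      · exact absurd h.choose_spec.2 (nearRank_lt_nearRank h.choose_spec.1 h').ne
      · exact h'
      · exact absurd h.choose_spec.2 (nearRank_lt_nearRank hw h').ne'
    dsimp only [g]
    rw [dif_pos h, e]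
  obtain ⟨z, hz, hzd⟩ := exists_digits k t g hg
  refine ⟨z, hz, ?_⟩
  funext w c
  refine propext (and_congr_right fun _ => forall_congr' fun hw => ?_)
  have hlt : nearRank G Λ v₀ w < t := (nearRank_lt_ncard hw).trans_le ht
  rw [hzd _ hlt, hgw w hw, ← Fin.ext_iff]
  exact and_iff_right hlt

/-- The certificates are sound and complete. -/
theorem exists_accepts_iff {H : LoopGraph (Fin k)} {G : SimpleGraph (Fin n)} (hH : NoSquare H)
    (hdeg : ∀ x, H.degree x ≤ 2) (hdiam : ∀ u v, G.edist u v ≤ 3) (hn : 0 < n) (hk : 0 < k)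
    (hN : 0 < n * k) (Λ : Fin n → Fin k → Prop) {s t δ : ℕ} (hδ : 0 < δ) (hs : n * k ≤ s * δ)
    (ht : 1 + 2 * δ + 2 * δ * (2 * δ) ≤ t) :
    (∃ z < (n * k) ^ s, ∃ v₀, ∃ y < k ^ t, Accepts H G 2 (digitLists G
      (lightLists H G (assignLists H G Λ (digitNode hN z) s) δ) v₀ t y)) ↔
    ∃ φ, IsSolution H G Λ φ := by
  constructor
  · rintro ⟨z, -, v₀, y, -, h⟩
    obtain ⟨φ, hφ⟩ := exists_isSolution_of_card_le_two (fun u => (h u).1) fun u => (h u).2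
    exact ⟨φ, fun v => (hφ.1 v).1.1.1, hφ.2⟩
  · rintro ⟨φ, hφ⟩
    have : Nonempty (Fin n) := ⟨⟨0, hn⟩⟩
    obtain ⟨f, v₀, h⟩ := exists_certificate hH hdeg hdiam hφ hδ (s := s) (by simpa using hs)
    obtain ⟨h1, h2, h3⟩ := h _ rfl
    obtain ⟨z, hz, hzd⟩ := exists_digits (n * k) s (fun i => code (f i, φ (f i)))
      fun i => code_lt _
    have hσ : assignLists H G Λ (digitNode hN z) s =
        assignLists H G Λ (fun i => (f i, φ (f i))) s := by
      funext v c
      refine propext (and_congr_right fun _ => forall_congr' fun i => forall_congr' fun hi => ?_)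
      have : digitNode hN z i = (f i, φ (f i)) := by
        rw [← code_inj, code_digitNode, hzd i hi]
      rw [this]
    obtain ⟨y, hy, hyl⟩ := exists_digitLists_eq hk (h1.trans ht) φ
    refine ⟨z, hz, v₀, y, hy, ?_⟩
    rw [hσ, hyl]
    exact fun u => ⟨h2 u, h3 u⟩

/-- Write the digits of the variable `z` in base `b` to the array `d`; their number is in the
variable `q`, the variable `m` is an upper bound for `z`, and the array `a` receives the successive
quotients. -/
def digitsCmd (z b q m a d : ℕ) : Cmd :=
  .seq (.put a (const 0) (const 0) (var z)) <|
  .seq (.iter 13 q (.put a (add (var 13) (const 1)) (const 0)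
    (divExpr (get a (var 13) (const 0)) b m)))
  (fill₁ d q (sub (get a (var 8) (const 0))
    (.sum 15 b (get a (add (var 8) (const 1)) (const 0)))))

theorem run_digitsCmd {z b q m a d : ℕ} (hb : b < 8) (hq : q < 8) (hm : m < 8) (had : a < d)
    {s : Store} {B Z : ℕ} (hB : s.var b = B) (hB0 : 0 < B) (hZ : s.var z = Z)
    (hZm : Z ≤ s.var m) (v : ℕ) :
    Kept v a s ((digitsCmd z b q m a d).run s) ∧
    ∀ i < s.var q, ((digitsCmd z b q m a d).run s).arr d i 0 = Z / B ^ i % B := by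
  set s₁ := s.setArr a 0 0 Z with hs₁
  set s₂ := (Cmd.iter 13 q (.put a (add (var 13) (const 1)) (const 0)
    (divExpr (get a (var 13) (const 0)) b m))).run s₁ with hs₂
  have hrun : (digitsCmd z b q m a d).run s = (fill₁ d q (sub (get a (var 8) (const 0))
      (.sum 15 b (get a (add (var 8) (const 1)) (const 0))))).run s₂ := by
    rw [hs₂, hs₁, ← hZ]
    rfl
  have k₁ : Kept v a s s₁ := ⟨fun _ _ => rfl, fun b' hb' => by
    funext i j
    simp [hs₁, Store.setArr_arr, hb'.ne]⟩
  have h₂ : Kept v a s s₂ ∧ ∀ i ≤ s.var q, s₂.arr a i 0 = Z / B ^ i := by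
    refine loopState_induction _ 13 s₁ (s₁.var q) (fun j s' => Kept v a s s' ∧
      ∀ i ≤ j, s'.arr a i 0 = Z / B ^ i) ⟨k₁, fun i hi => ?_⟩ ?_
    · obtain rfl : i = 0 := by omega
      simp [hs₁, Store.setArr_arr]
    · rintro j - s' ⟨hk', hd'⟩
      have hdiv : (divExpr (get a (var 13) (const 0)) b m).val (s'.setVar 13 j) =
          Z / B ^ (j + 1) := by
        rw [val_divExpr (x := Z / B ^ j) (B := B) (M := s.var m) (by omega) ?_ ?_ ?_ hB0 ?_,
          Nat.div_div_eq_div_mul, pow_succ]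
        · intro i
          simp [hd' j le_rfl]
        · simp [show b ≠ 13 by omega, hk'.1 b (by omega), hB]
        · simp [show m ≠ 13 by omega, hk'.1 m (by omega)]
        · exact (Nat.div_le_self _ _).trans ((Nat.div_le_self _ _).trans hZm)
      refine ⟨⟨fun x hx => ?_, fun b' hb' => ?_⟩, fun i hi => ?_⟩
      · simp [Cmd.run, show x ≠ 13 by omega, hk'.1 x hx]
      · funext i' j'
        simp [Cmd.run, Store.setArr_arr, hb'.ne, hk'.2 b' hb']
      · simp only [Cmd.run, Store.setArr_arr, hdiv, val_add, val_var, val_const,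
          Store.setVar_var, if_true, true_and, and_true, Store.setVar_arr]
        split_ifs with h
        · rw [h]
        · exact hd' i (by omega)
  have ok : (sub (get a (var 8) (const 0))
      (.sum 15 b (get a (add (var 8) (const 1)) (const 0)))).Ok := by
    simp [SumExpr.Ok, sub, add, hb]
  have rd : ¬ (sub (get a (var 8) (const 0))
      (.sum 15 b (get a (add (var 8) (const 1)) (const 0)))).Reads d := by
    simp [SumExpr.Reads, sub, add, had.ne']
  rw [hrun]
  refine ⟨h₂.1.trans (kept_fill₁ ok rd s₂ v) le_rfl had.le, fun i hi => ?_⟩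
  rw [(run_fill₁ ok rd s₂).2.2 i (by rw [h₂.1.1 q (by omega)]; exact hi)]
  have e1 := h₂.2 i (by omega)
  have e2 := h₂.2 (i + 1) (by omega)
  have hb' : s₂.var b = B := by rw [h₂.1.1 b (by omega), hB]
  simp only [val_sub, val_get, val_sum, val_add, val_var, val_const, Store.setVar_var,
    Store.setVar_arr, show b ≠ 8 by omega, if_true, if_false, Nat.reduceEqDiff, hb', e1, e2,
    Finset.sum_const, Finset.card_range, smul_eq_mul, pow_succ, ← Nat.div_div_eq_div_mul]
  exact (Nat.mod_def _ _).symm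

/-- A loop that sets the variable `24` as soon as a condition holds for some value of the loop
variable. -/
theorem run_search {c : Cmd} {x r a : ℕ} (hx : 20 ≤ x) (hx' : x < 24) (s : Store)
    (p : ℕ → Prop)
    (hc : ∀ i < s.var r, ∀ s', Kept x a s s' → s'.var x = i →
      Kept x a s' (c.run s') ∧ ((c.run s').var 24 ≠ 0 ↔ s'.var 24 ≠ 0 ∨ p i)) :
    Kept x a s ((Cmd.iter x r c).run s) ∧
    (((Cmd.iter x r c).run s).var 24 ≠ 0 ↔ s.var 24 ≠ 0 ∨ ∃ i < s.var r, p i) := by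
  refine loopState_induction _ x s (s.var r) (fun m s' => Kept x a s s' ∧
    (s'.var 24 ≠ 0 ↔ s.var 24 ≠ 0 ∨ ∃ i < m, p i)) ⟨Kept.refl _ _ _, by simp⟩ ?_
  rintro i hi s' ⟨hk, hp⟩
  have hk' : Kept x a s (s'.setVar x i) := hk.setVar le_rfl hx i
  obtain ⟨h1, h2⟩ := hc i hi (s'.setVar x i) hk' (by simp)
  refine ⟨hk'.trans h1 le_rfl le_rfl, ?_⟩
  rw [h2, Store.setVar_var, if_neg (by omega), hp, or_assoc]
  refine or_congr_right ?_
  constructor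
  · rintro (⟨j, hj, hpj⟩ | hpi)
    · exact ⟨j, by omega, hpj⟩
    · exact ⟨i, by omega, hpi⟩
  · rintro ⟨j, hj, hpj⟩
    by_cases hji : j = i
    · exact Or.inr (hji ▸ hpj)
    · exact Or.inl ⟨j, by omega, hpj⟩

/-- The lists in array `6` after the assignments in array `8`. -/
def assignExpr : SumExpr :=
  conj (get 6 (var 8) (const 0)) (.all 13 3 (get 4 (get 8 (var 13) (const 0)) (var 8)))

/-- The light colours in the lists in array `9`. -/
def lightExpr : SumExpr :=
  conj (get 9 (var 8) (const 0)) <|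
    lt (count 10 0 (.ex 11 1 (conj (get 9 (codeExpr (var 10) (var 11)) (const 0))
      (neg (get 4 (var 8) (codeExpr (var 10) (var 11))))))) (var 7)

/-- The active vertices for the lists in array `10`. -/
def activeExpr : SumExpr :=
  lt (const 1) (count 11 1 (get 10 (codeExpr (var 8) (var 11)) (const 0)))

/-- The vertices near the vertex in the variable `22`. -/
def nearExpr : SumExpr :=
  disj (eq (var 8) (var 22)) <| .ex 10 0 <| conj (get 11 (var 10) (const 0)) <|
    conj (get 11 (var 8) (const 0)) <| conj (get 0 (var 22) (var 10)) <|
    disj (eq (var 10) (var 8)) (get 0 (var 10) (var 8))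

/-- The positions of the vertices among those that are marked in array `12`. -/
def rankExpr : SumExpr :=
  count 10 0 (conj (lt (var 10) (var 8)) (get 12 (var 10) (const 0)))

/-- The lists in array `10` where the vertices marked in array `12` get the colours in array `15`,
at the positions in array `13`. -/
def guessExpr : SumExpr :=
  conj (get 10 (var 8) (const 0)) <| imp (get 12 (get 2 (var 8) (const 0)) (const 0)) <|
    conj (lt (get 13 (get 2 (var 8) (const 0)) (const 0)) (var 4))
      (eq (get 15 (get 13 (get 2 (var 8) (const 0)) (const 0)) (const 0)) (get 3 (var 8) (const 0)))

/-- Try the guess of colours that is encoded in the variable `23`. -/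
def guessCmd : Cmd :=
  .seq (digitsCmd 23 1 4 6 14 15) <| .seq (fill₁ 16 2 guessExpr) (consistencyCmd 2)

/-- Try all guesses of colours near the vertex in the variable `22`. -/
def nearCmd : Cmd :=
  .seq (fill₁ 12 0 nearExpr) <| .seq (fill₁ 13 0 rankExpr) (.iter 23 6 guessCmd)

/-- Try all certificates with the assignments that are encoded in the variable `21`. -/
def branchCmd : Cmd :=
  .seq (digitsCmd 21 2 3 5 7 8) <| .seq (fill₁ 9 2 assignExpr) <| .seq (fill₁ 10 2 lightExpr) <|
  .seq (fill₁ 11 0 activeExpr) (.iter 22 0 nearCmd)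

/-- The search through all certificates. The variables `3` and `4` contain the number of assignments
and the number of guessed colours, `5` and `6` the numbers of possibilities for them, and `7` the
threshold for light colours. -/
def searchCmd : Cmd := .iter 21 5 branchCmd

theorem ok_searchCmd : searchCmd.Ok ∧ searchCmd.KeepsSizes := by
  have h := ok_consistencyCmd 2
  constructor
  · simp [searchCmd, branchCmd, nearCmd, guessCmd, h, digitsCmd, fill₁, Cmd.Ok, SumExpr.Ok,
      divExpr, assignExpr, lightExpr, activeExpr, nearExpr, rankExpr, guessExpr, lt, add, sub, conj,
      neg, eq, disj, imp, SumExpr.all, SumExpr.ex, count, codeExpr]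
  · simp [searchCmd, branchCmd, nearCmd, guessCmd, h, digitsCmd, fill₁, KeepsSizes]

variable {H : LoopGraph (Fin k)} {G : SimpleGraph (Fin n)}

theorem run_guessCmd {s : Store} (hs : Base H G s) {Λ : Fin n → Fin k → Prop} (hΛ : ListAt 10 Λ s)
    {v₀ : Fin n} (hnear : ∀ w : Fin n, s.arr 12 w 0 ≠ 0 ↔ Near G Λ v₀ w)
    (hrank : ∀ w : Fin n, s.arr 13 w 0 = nearRank G Λ v₀ w) (hk : 0 < k) {z : ℕ}
    (hz : s.var 23 = z) (hz' : z ≤ s.var 6) :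
    Kept 23 14 s (guessCmd.run s) ∧ ((guessCmd.run s).var 24 ≠ 0 ↔
      s.var 24 ≠ 0 ∨ Accepts H G 2 (digitLists G Λ v₀ (s.var 4) z)) := by
  have ok : guessExpr.Ok := by
    simp [guessExpr, SumExpr.Ok, conj, imp, lt, eq, neg, add]
  have rd : ¬ guessExpr.Reads 16 := by
    simp [guessExpr, SumExpr.Reads, conj, imp, lt, eq, neg, add]
  obtain ⟨k₁, d₁⟩ := run_digitsCmd (z := 23) (b := 1) (q := 4) (m := 6) (a := 14) (d := 15)
    (by omega) (by omega) (by omega) (by omega) hs.k_eq hk hz hz' 25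
  rw [guessCmd, Cmd.run, Cmd.run]
  generalize (digitsCmd 23 1 4 6 14 15).run s = s₁ at *
  have b₁ := hs.kept k₁ (by omega)
  have k₂ := kept_fill₁ (r := 2) ok rd s₁ 25
  have l₂ : ListAt 16 (digitLists G Λ v₀ (s.var 4) z) ((fill₁ 16 2 guessExpr).run s₁) := by
    refine listAt_fill₁ ok rd b₁.nk_eq fun x => ?_
    simp only [guessExpr, holds_conj, holds_imp, holds_lt, holds_eq, holds_get, val_get, val_var,
      val_const, Store.setVar_var, Store.setVar_arr, Nat.reduceEqDiff, if_true, if_false,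
      b₁.vertex, b₁.color]
    rw [k₁.2 10 (by omega), k₁.2 12 (by omega), k₁.2 13 (by omega), k₁.1 4 (by omega), hΛ, hnear,
      hrank]
    refine and_congr_right fun _ => forall_congr' fun _ => and_congr_right fun h => ?_
    rw [d₁ _ h]
  obtain ⟨k₃, h₃⟩ := run_consistencyCmd (b₁.kept k₂ (by omega)) l₂ 2
  refine ⟨((k₁.mono (by omega) le_rfl).trans k₂ (by omega) (by omega)).trans k₃ (by omega)
    (by omega), ?_⟩
  rw [h₃, k₂.1 24 (by omega), k₁.1 24 (by omega)]

theorem run_nearCmd {s : Store} (hs : Base H G s) {Λ : Fin n → Fin k → Prop} (hΛ : ListAt 10 Λ s)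
    (hact : ∀ v : Fin n, s.arr 11 v 0 ≠ 0 ↔ Active Λ v) (hk : 0 < k) {v₀ : Fin n}
    (hv₀ : s.var 22 = v₀) (h6 : s.var 6 = k ^ s.var 4) :
    Kept 22 12 s (nearCmd.run s) ∧ ((nearCmd.run s).var 24 ≠ 0 ↔
      s.var 24 ≠ 0 ∨ ∃ z < k ^ s.var 4, Accepts H G 2 (digitLists G Λ v₀ (s.var 4) z)) := by
  have ok₁ : nearExpr.Ok := by
    simp [nearExpr, SumExpr.Ok, conj, disj, SumExpr.ex, lt, eq, neg, add]
  have rd₁ : ¬ nearExpr.Reads 12 := by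
    simp [nearExpr, SumExpr.Reads, conj, disj, SumExpr.ex, lt, eq, neg, add]
  have ok₂ : rankExpr.Ok := by
    simp [rankExpr, SumExpr.Ok, conj, count, lt, eq, neg, add]
  have rd₂ : ¬ rankExpr.Reads 13 := by
    simp [rankExpr, SumExpr.Reads, conj, count, lt, eq, neg, add]
  have k₁ := kept_fill₁ (r := 0) ok₁ rd₁ s 25
  have n₁ : ∀ w : Fin n, ((fill₁ 12 0 nearExpr).run s).arr 12 w 0 ≠ 0 ↔ Near G Λ v₀ w := by
    intro w
    rw [(run_fill₁ ok₁ rd₁ s).2.2 w (by rw [hs.n_eq]; exact w.2)]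
    change nearExpr.Holds _ ↔ _
    rw [nearExpr, holds_disj, holds_ex]
    simp only [holds_eq, val_var, Store.setVar_var, Nat.reduceEqDiff, if_true, if_false, hv₀,
      OfNat.zero_ne_ofNat, hs.n_eq, exists_lt_iff_fin (n := n), holds_conj, holds_disj, holds_get,
      val_const, Store.setVar_arr, hact, hs.adj, ← Fin.ext_iff]
    rfl
  rw [nearCmd, Cmd.run, Cmd.run]
  generalize (fill₁ 12 0 nearExpr).run s = s₁ at *
  have b₁ := hs.kept k₁ (by omega)
  have k₂ := kept_fill₁ (r := 0) ok₂ rd₂ s₁ 25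
  have r₂ : ∀ w : Fin n, ((fill₁ 13 0 rankExpr).run s₁).arr 13 w 0 = nearRank G Λ v₀ w := by
    intro w
    rw [(run_fill₁ ok₂ rd₂ s₁).2.2 w (by rw [b₁.n_eq]; exact w.2), rankExpr, nearRank,
      val_count (n := n) _ _ _ _ (by simp [b₁.n_eq]) (p := fun x => x < w ∧ Near G Λ v₀ x)]
    intro x
    simp only [holds_conj, holds_lt, holds_get, val_var, val_const, Store.setVar_var,
      Nat.reduceEqDiff, if_true, if_false, Store.setVar_arr, n₁, Fin.lt_def]
  generalize (fill₁ 13 0 rankExpr).run s₁ = s₂ at *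
  have K₂ : Kept 25 12 s s₂ := k₁.trans k₂ le_rfl (by omega)
  have hkp : s₂.var 6 = k ^ s.var 4 := by rw [K₂.1 6 (by omega), h6]
  have h₃ := run_search (c := guessCmd) (x := 23) (r := 6) (a := 14) (by omega) (by omega) s₂
    (fun z => Accepts H G 2 (digitLists G Λ v₀ (s.var 4) z)) ?_
  · refine ⟨(K₂.mono (by omega) le_rfl).trans h₃.1 (by omega) (by omega), ?_⟩
    rw [h₃.2, K₂.1 24 (by omega), hkp]
  · intro z hz s' hk' hz'
    have K' : Kept 23 12 s s' := (K₂.mono (by omega) le_rfl).trans hk' le_rfl (by omega)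
    have := run_guessCmd (hs.kept K' (by omega)) (hΛ.kept K' (by omega)) (v₀ := v₀)
      (by rw [hk'.2 12 (by omega), k₂.2 12 (by omega)]; exact n₁)
      (by rw [hk'.2 13 (by omega)]; exact r₂) hk hz' (by rw [hk'.1 6 (by omega)]; exact hz.le)
    rwa [K'.1 4 (by omega)] at this

theorem run_branchCmd {s : Store} (hs : Base H G s) {Λ : Fin n → Fin k → Prop} (hΛ : ListAt 6 Λ s)
    (hk : 0 < k) (hN : 0 < n * k) (h6 : s.var 6 = k ^ s.var 4) {z : ℕ} (hz : s.var 21 = z)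
    (hz' : z ≤ s.var 5) :
    Kept 21 7 s (branchCmd.run s) ∧ ((branchCmd.run s).var 24 ≠ 0 ↔
      s.var 24 ≠ 0 ∨ ∃ v₀, ∃ y < k ^ s.var 4, Accepts H G 2 (digitLists G (lightLists H G
        (assignLists H G Λ (digitNode hN z) (s.var 3)) (s.var 7)) v₀ (s.var 4) y)) := by
  have ok₂ : assignExpr.Ok := by
    simp [assignExpr, SumExpr.Ok, conj, SumExpr.all, neg, eq, add]
  have rd₂ : ¬ assignExpr.Reads 9 := by
    simp [assignExpr, SumExpr.Reads, conj, SumExpr.all, neg, eq, add]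
  have ok₃ : lightExpr.Ok := by
    simp [lightExpr, SumExpr.Ok, conj, count, SumExpr.ex, lt, neg, eq, add, codeExpr]
  have rd₃ : ¬ lightExpr.Reads 10 := by
    simp [lightExpr, SumExpr.Reads, conj, count, SumExpr.ex, lt, neg, eq, add, codeExpr]
  have ok₄ : activeExpr.Ok := by
    simp [activeExpr, SumExpr.Ok, count, lt, add, codeExpr]
  have rd₄ : ¬ activeExpr.Reads 11 := by
    simp [activeExpr, SumExpr.Reads, count, lt, add, codeExpr]
  obtain ⟨k₁, d₁⟩ := run_digitsCmd (z := 21) (b := 2) (q := 3) (m := 5) (a := 7) (d := 8)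
    (by omega) (by omega) (by omega) (by omega) hs.nk_eq hN hz hz' 25
  rw [branchCmd, Cmd.run, Cmd.run, Cmd.run, Cmd.run]
  generalize (digitsCmd 21 2 3 5 7 8).run s = s₁ at *
  have b₁ := hs.kept k₁ (by omega)
  have k₂ := kept_fill₁ (r := 2) ok₂ rd₂ s₁ 25
  set Λ₁ := assignLists H G Λ (digitNode hN z) (s.var 3) with hΛ₁
  have l₂ : ListAt 9 Λ₁ ((fill₁ 9 2 assignExpr).run s₁) := by
    refine listAt_fill₁ ok₂ rd₂ b₁.nk_eq fun x => ?_
    rw [assignExpr, holds_conj, holds_all]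
    simp only [holds_get, val_get, val_var, val_const, Store.setVar_var, Store.setVar_arr,
      Nat.reduceEqDiff, if_true, if_false, k₁.1 3 (by omega)]
    rw [k₁.2 6 (by omega), hΛ]
    refine and_congr_right fun _ => forall_congr' fun i => forall_congr' fun hi => ?_
    rw [d₁ i hi, ← code_digitNode hN, b₁.compat]
  generalize (fill₁ 9 2 assignExpr).run s₁ = s₂ at *
  have K₂ : Kept 25 7 s s₂ := k₁.trans k₂ le_rfl (by omega)
  have b₂ := hs.kept K₂ (by omega)
  have k₃ := kept_fill₁ (r := 2) ok₃ rd₃ s₂ 25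
  set Λ₂ := lightLists H G Λ₁ (s.var 7) with hΛ₂
  have l₃ : ListAt 10 Λ₂ ((fill₁ 10 2 lightExpr).run s₂) := by
    refine listAt_fill₁ ok₃ rd₃ b₂.nk_eq fun x => ?_
    rw [lightExpr, holds_conj, holds_lt, val_count (n := n) _ _ _ _ (by simp [b₂.n_eq])
      (p := fun u => ∃ b, Λ₁ u b ∧ ¬ Compat H G x (u, b))]
    · simp only [holds_get, val_var, val_const, Store.setVar_var, Store.setVar_arr,
        Nat.reduceEqDiff, if_true, if_false, K₂.1 7 (by omega), l₂ x]
      rfl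
    · intro u
      rw [holds_ex]
      simp only [Store.setVar_var, OfNat.one_ne_ofNat, if_false, b₂.k_eq,
        exists_lt_iff_fin (n := k)]
      refine exists_congr fun c => ?_
      rw [holds_conj, holds_neg, holds_get, holds_get,
        val_codeExpr (k := k) (by simp [b₂.k_eq]) u c (by simp) (by simp)]
      simp only [val_var, val_const, Store.setVar_var, Store.setVar_arr,
        Nat.reduceEqDiff, if_true, if_false, l₂ (u, c), b₂.compat]
  generalize (fill₁ 10 2 lightExpr).run s₂ = s₃ at *
  have K₃ : Kept 25 7 s s₃ := K₂.trans k₃ le_rfl (by omega)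
  have b₃ := hs.kept K₃ (by omega)
  have k₄ := kept_fill₁ (r := 0) ok₄ rd₄ s₃ 25
  have a₄ : ∀ v : Fin n, ((fill₁ 11 0 activeExpr).run s₃).arr 11 v 0 ≠ 0 ↔ Active Λ₂ v := by
    intro v
    rw [(run_fill₁ ok₄ rd₄ s₃).2.2 v (by rw [b₃.n_eq]; exact v.2)]
    change activeExpr.Holds _ ↔ _
    rw [activeExpr, holds_lt, val_count (n := k) _ _ _ _ (by simp [b₃.k_eq]) (p := fun c => Λ₂ v c)]
    · rfl
    · intro c
      rw [holds_get, val_codeExpr (k := k) (by simp [b₃.k_eq]) v c (by simp) (by simp)]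
      exact l₃ (v, c)
  generalize (fill₁ 11 0 activeExpr).run s₃ = s₄ at *
  have K₄ : Kept 25 7 s s₄ := K₃.trans k₄ le_rfl (by omega)
  have b₄ := hs.kept K₄ (by omega)
  have h₅ := run_search (c := nearCmd) (x := 22) (r := 0) (a := 12) (by omega) (by omega) s₄
    (fun i => ∃ v₀ : Fin n, v₀.val = i ∧ ∃ y < k ^ s.var 4,
      Accepts H G 2 (digitLists G Λ₂ v₀ (s.var 4) y)) ?_
  · refine ⟨(K₄.mono (by omega) le_rfl).trans h₅.1 (by omega) (by omega), ?_⟩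
    rw [h₅.2, K₄.1 24 (by omega), b₄.n_eq]
    refine or_congr_right ⟨?_, ?_⟩
    · rintro ⟨-, -, v₀, -, h⟩
      exact ⟨v₀, h⟩
    · rintro ⟨v₀, h⟩
      exact ⟨v₀, v₀.2, v₀, rfl, h⟩
  · intro i hi s' hk' hi'
    rw [b₄.n_eq] at hi
    have K' : Kept 22 7 s s' := (K₄.mono (by omega) le_rfl).trans hk' le_rfl (by omega)
    have := run_nearCmd (hs.kept K' (by omega)) ((l₃.kept k₄ (by omega)).kept hk' (by omega))
      (by rw [hk'.2 11 (by omega)]; exact a₄) hk (v₀ := ⟨i, hi⟩) hi'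
      (by rw [K'.1 6 (by omega), K'.1 4 (by omega), h6])
    rw [K'.1 4 (by omega)] at this
    refine ⟨this.1, this.2.trans (or_congr_right ⟨fun h => ⟨⟨i, hi⟩, rfl, h⟩, ?_⟩)⟩
    rintro ⟨v₀, rfl, h⟩
    exact h

theorem run_searchCmd {s : Store} (hs : Base H G s) {Λ : Fin n → Fin k → Prop} (hΛ : ListAt 6 Λ s)
    (hk : 0 < k) (hN : 0 < n * k) (h5 : s.var 5 = (n * k) ^ s.var 3) (h6 : s.var 6 = k ^ s.var 4) :
    (searchCmd.run s).var 24 ≠ 0 ↔ s.var 24 ≠ 0 ∨ ∃ z < (n * k) ^ s.var 3, ∃ v₀,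
      ∃ y < k ^ s.var 4, Accepts H G 2 (digitLists G (lightLists H G
        (assignLists H G Λ (digitNode hN z) (s.var 3)) (s.var 7)) v₀ (s.var 4) y) := by
  have h := run_search (c := branchCmd) (x := 21) (r := 5) (a := 7) (by omega) (by omega) s
    (fun z => ∃ v₀, ∃ y < k ^ s.var 4, Accepts H G 2 (digitLists G (lightLists H G
        (assignLists H G Λ (digitNode hN z) (s.var 3)) (s.var 7)) v₀ (s.var 4) y)) ?_
  · rw [searchCmd, h.2, h5]
  · intro z hz s' hk' hz'
    have := run_branchCmd (hs.kept hk' (by omega)) (hΛ.kept hk' (by omega)) hk hN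
      (by rw [hk'.1 6 (by omega), hk'.1 4 (by omega), h6]) hz'
      (by rw [hk'.1 5 (by omega)]; exact hz.le)
    rwa [hk'.1 3 (by omega), hk'.1 4 (by omega), hk'.1 7 (by omega)] at this

end ListColoring

/-! ### The parameters of the search -/

namespace ListColoring

open RAM RAM.SumExpr RAM.Cmd

variable {k n : ℕ}

/-- The number of binary digits of a positive number `n`. -/
def digitCount (n : ℕ) : ℕ := Nat.log 2 n + 1

theorem lt_two_pow_digitCount (n : ℕ) : n < 2 ^ digitCount n :=
  Nat.lt_pow_succ_log_self (by omega) n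

theorem digitCount_le (hn : 0 < n) : digitCount n ≤ n :=
  Nat.log_lt_self 2 hn.ne'

theorem exists_threshold (n : ℕ) : ∃ d, n * digitCount n ≤ d * d * d := by
  refine ⟨n, ?_⟩
  rcases Nat.eq_zero_or_pos n with rfl | hn
  · simp
  · have := digitCount_le hn
    calc n * digitCount n ≤ n * (n * n) := Nat.mul_le_mul_left _ (by nlinarith)
      _ = _ := by ring

/-- The least `d` with `n log n ≤ d ^ 3`, the threshold for light colours. It balances the number
of assignments, which is about `n / d`, against the number of guessed colours, which is about
`d ^ 2`. -/
noncomputable def threshold (n : ℕ) : ℕ := Nat.find (exists_threshold n)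

theorem threshold_spec (n : ℕ) : n * digitCount n ≤ threshold n * threshold n * threshold n :=
  Nat.find_spec (exists_threshold n)

theorem lt_threshold_iff {d : ℕ} : d < threshold n ↔ d * d * d < n * digitCount n := by
  rw [threshold, Nat.lt_find_iff]
  refine ⟨fun h => not_le.1 (h d le_rfl), fun h m hm hle => ?_⟩
  have : m * m * m ≤ d * d * d := Nat.mul_le_mul (Nat.mul_le_mul hm hm) hm
  omega

theorem threshold_le (n : ℕ) : threshold n ≤ n := by
  refine Nat.find_min' (exists_threshold n) ?_
  rcases Nat.eq_zero_or_pos n with rfl | hn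
  · simp
  · have := digitCount_le hn
    calc n * digitCount n ≤ n * (n * n) := Nat.mul_le_mul_left _ (by nlinarith)
      _ = _ := by ring

theorem threshold_pos (hn : 0 < n) : 0 < threshold n := by
  rw [lt_threshold_iff]
  simp [hn, digitCount]

/-- The number of assignments in a certificate. -/
noncomputable def assignCount (k n : ℕ) : ℕ := n * k / threshold n + 1

/-- The number of guessed colours in a certificate. -/
noncomputable def guessCount (n : ℕ) : ℕ :=
  1 + 2 * threshold n + 2 * threshold n * (2 * threshold n)

theorem le_assignCount_mul (hn : 0 < n) : n * k ≤ assignCount k n * threshold n := by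
  have := Nat.lt_div_mul_add (a := n * k) (threshold_pos hn)
  rw [assignCount, Nat.add_mul]
  omega

/-- The binary logarithm of a bound for all sizes in the search. -/
noncomputable def sizeExponent (k n : ℕ) : ℕ :=
  (digitCount n + k) * (assignCount k n + 1) + (k + 1) * guessCount n

theorem sizes_le (k n : ℕ) : n ≤ 2 ^ sizeExponent k n ∧ k ≤ 2 ^ sizeExponent k n ∧
    n * k ≤ 2 ^ sizeExponent k n ∧ threshold n ≤ 2 ^ sizeExponent k n ∧
    assignCount k n ≤ 2 ^ sizeExponent k n ∧ guessCount n ≤ 2 ^ sizeExponent k n ∧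
    (n * k) ^ assignCount k n ≤ 2 ^ sizeExponent k n ∧
    k ^ guessCount n ≤ 2 ^ sizeExponent k n := by
  have hn := (lt_two_pow_digitCount n).le
  have hk : k ≤ 2 ^ k := Nat.lt_two_pow_self.le
  have hnk : n * k ≤ 2 ^ (digitCount n + k) := by
    rw [pow_add]
    exact Nat.mul_le_mul hn hk
  have hmono : ∀ {m}, m ≤ sizeExponent k n → 2 ^ m ≤ 2 ^ sizeExponent k n := fun h =>
    Nat.pow_le_pow_right (by omega) h
  have hd : 1 ≤ digitCount n := by simp [digitCount]
  have e1 : digitCount n + k ≤ sizeExponent k n :=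
    (Nat.le_mul_of_pos_right _ (by omega)).trans (Nat.le_add_right _ _)
  have e2 : assignCount k n ≤ sizeExponent k n := by
    refine le_trans ?_ (Nat.le_add_right _ _)
    exact (Nat.le_succ _).trans (Nat.le_mul_of_pos_left _ (by omega))
  have e3 : guessCount n ≤ sizeExponent k n :=
    (Nat.le_mul_of_pos_left _ (by omega)).trans (Nat.le_add_left _ _)
  refine ⟨hn.trans (hmono (by omega)), hk.trans (hmono (by omega)), hnk.trans (hmono e1),
    (threshold_le n).trans (hn.trans (hmono (by omega))), Nat.lt_two_pow_self.le.trans (hmono e2),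
    Nat.lt_two_pow_self.le.trans (hmono e3), ?_, ?_⟩
  · refine (Nat.pow_le_pow_left hnk _).trans ?_
    rw [← pow_mul]
    refine hmono (le_trans (Nat.mul_le_mul_left _ (Nat.le_succ _)) (Nat.le_add_right _ _))
  · refine (Nat.pow_le_pow_left hk _).trans ?_
    rw [← pow_mul]
    exact hmono (le_trans (Nat.mul_le_mul_right _ (Nat.le_succ _)) (Nat.le_add_left _ _))

/-- Store the number of binary digits of the variable `0` in the variable `27`, using a table of the
powers of two in array `19`. -/
def digitCountCmd : Cmd :=
  .seq (.put 19 (const 0) (const 0) (const 1)) <|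
  .seq (.iter 13 0 (.put 19 (add (var 13) (const 1)) (const 0)
    (add (get 19 (var 13) (const 0)) (get 19 (var 13) (const 0)))))
  (.set 27 (.sum 10 0 (lt (get 19 (var 10) (const 0)) (add (var 0) (const 1)))))

/-- Store the power of the variable `b` with the variable `r` as exponent in the variable `28`. -/
def powCmd (b r : ℕ) : Cmd :=
  .seq (.set 28 (const 1)) (.iter 13 r (.set 28 (.sum 15 b (var 28))))

/-- The cube of the variable `10`, which must be at most the variable `0`. -/
def cubeExpr : SumExpr :=
  .sum 11 0 <| .sum 12 0 <| .sum 14 0 <| lt (const 0) <|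
    conj (lt (var 11) (var 10)) (conj (lt (var 12) (var 10)) (lt (var 14) (var 10)))

/-- The threshold for light colours, if the variable `27` contains the number of binary digits. -/
def thresholdExpr : SumExpr := .sum 10 0 (lt cubeExpr (.sum 11 0 (var 27)))

/-- Compute the size variables `3` to `7` for the search. The variables
`3` and `4` bound the loops that compute the powers in `5` and `6`. -/
def paramsCmd : Cmd :=
  .seq digitCountCmd <| .seq (.set 7 thresholdExpr) <|
  .seq (.set 3 (add (divExpr (var 2) 7 2) (const 1))) <|
  .seq (.set 4 (add (const 1) (.sum 8 7 (add (const 2) (.sum 9 7 (const 4)))))) <|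
  .seq (powCmd 2 3) <| .seq (.set 5 (var 28)) <| .seq (powCmd 1 4) (.set 6 (var 28))

theorem ok_digitCountCmd : digitCountCmd.Ok ∧ digitCountCmd.KeepsSizes := by
  constructor <;> simp [digitCountCmd, Cmd.Ok, SumExpr.Ok, KeepsSizes, add, lt]

theorem ok_powCmd {b r : ℕ} (hb : b < 8) (hr : r < 8) :
    (powCmd b r).Ok ∧ (powCmd b r).KeepsSizes := by
  constructor <;> simp [powCmd, Cmd.Ok, SumExpr.Ok, KeepsSizes, hb, hr]

theorem ok_paramsCmd : paramsCmd.Ok := by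
  have h1 := ok_digitCountCmd.1
  have h2 := (ok_powCmd (b := 2) (r := 3) (by omega) (by omega)).1
  have h3 := (ok_powCmd (b := 1) (r := 4) (by omega) (by omega)).1
  simp [paramsCmd, Cmd.Ok, h1, h2, h3, SumExpr.Ok, thresholdExpr, cubeExpr, divExpr, add, lt, conj,
    neg, eq]

theorem sum_range_ite_lt {c M : ℕ} (h : c ≤ M) (m : ℕ) :
    ∑ i ∈ Finset.range M, (if i < c then m else 0) = c * m := by
  rw [← Finset.sum_filter,
    show (Finset.range M).filter (· < c) = Finset.range c by ext; simp; omega]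
  simp

theorem run_digitCountCmd {s : Store} (h0 : s.var 0 = n) (hn : 0 < n) :
    Kept 27 19 s (digitCountCmd.run s) ∧ (digitCountCmd.run s).var 27 = digitCount n := by
  set s₂ := (Cmd.iter 13 0 (.put 19 (add (var 13) (const 1)) (const 0)
    (add (get 19 (var 13) (const 0)) (get 19 (var 13) (const 0))))).run (s.setArr 19 0 0 1) with hs₂
  have h₂ : Kept 27 19 s s₂ ∧ ∀ i ≤ s.var 0, s₂.arr 19 i 0 = 2 ^ i := by
    refine loopState_induction _ 13 (s.setArr 19 0 0 1) (s.var 0) (fun j s' => Kept 27 19 s s' ∧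
      ∀ i ≤ j, s'.arr 19 i 0 = 2 ^ i) ⟨⟨fun _ _ => rfl, fun b hb => ?_⟩, fun i hi => ?_⟩ ?_
    · funext i j
      simp [Store.setArr_arr, hb.ne]
    · obtain rfl : i = 0 := by omega
      simp [Store.setArr_arr]
    · rintro j - s' ⟨hk', hd'⟩
      refine ⟨⟨fun x hx => ?_, fun b hb => ?_⟩, fun i hi => ?_⟩
      · simp [Cmd.run, show x ≠ 13 by omega, hk'.1 x hx]
      · funext i' j'
        simp [Cmd.run, Store.setArr_arr, hb.ne, hk'.2 b hb]
      · simp only [Cmd.run, Store.setArr_arr, val_add, val_get, val_var, val_const,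
          Store.setVar_var, if_true, true_and, and_true, Store.setVar_arr]
        split_ifs with h
        · rw [h, hd' j le_rfl, pow_succ]
          ring
        · exact hd' i (by omega)
  have hrun : digitCountCmd.run s = s₂.setVar 27
      ((SumExpr.sum 10 0 (lt (get 19 (var 10) (const 0)) (add (var 0) (const 1)))).val s₂) := rfl
  rw [hrun]
  refine ⟨h₂.1.setVar le_rfl (by omega) _, ?_⟩
  have h0' : s₂.var 0 = n := by rw [h₂.1.1 0 (by omega), h0]
  rw [Store.setVar_var, if_pos rfl, val_sum, h0', ← Nat.mul_one (digitCount n),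
    ← sum_range_ite_lt (digitCount_le hn) 1]
  refine Finset.sum_congr rfl fun i hi => ?_
  have hi := Finset.mem_range.1 hi
  simp only [lt, val, BinOp.app, val_add, Store.setVar_var, Store.setVar_arr, if_true,
    OfNat.zero_ne_ofNat, if_false, h0', h₂.2 i (by omega), digitCount, Nat.lt_succ_iff,
    ← Nat.le_log_iff_pow_le (b := 2) (by omega) hn.ne']

theorem run_powCmd {b r : ℕ} (hb : b < 8) (hr : r < 8) (s : Store) (a : ℕ) :
    Kept 28 a s ((powCmd b r).run s) ∧ ((powCmd b r).run s).var 28 = s.var b ^ s.var r := by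
  have hrun : (powCmd b r).run s =
      (Cmd.iter 13 r (.set 28 (.sum 15 b (var 28)))).run (s.setVar 28 1) := rfl
  have h1 : (s.setVar 28 1).var r = s.var r := by simp [show r ≠ 28 by omega]
  rw [hrun, ← h1]
  refine loopState_induction _ 13 (s.setVar 28 1) ((s.setVar 28 1).var r) (fun j s' =>
    Kept 28 a s s' ∧ s'.var 28 = s.var b ^ j) ⟨kept_setVar s (by omega) (by omega) 1, by simp⟩ ?_
  rintro j - s' ⟨hk, hp⟩
  refine ⟨(hk.trans (kept_setVar s' (by omega) (by omega) j) le_rfl le_rfl).trans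
    (kept_setVar _ (by omega) (by omega) _) le_rfl le_rfl, ?_⟩
  simp [Cmd.run, show b ≠ 13 by omega, hk.1 b (by omega), hp, pow_succ, mul_comm]

theorem val_thresholdExpr {s : Store} (h0 : s.var 0 = n) (h27 : s.var 27 = digitCount n) :
    thresholdExpr.val s = threshold n := by
  have hcube : ∀ d < n, cubeExpr.val (s.setVar 10 d) = d * d * d := by
    intro d hd
    have h : ∀ a b c, (lt (const 0) (conj (lt (var 11) (var 10)) (conj (lt (var 12) (var 10))
        (lt (var 14) (var 10))))).val ((((s.setVar 10 d).setVar 11 a).setVar 12 b).setVar 14 c) =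
        if a < d then if b < d then if c < d then 1 else 0 else 0 else 0 := by
      intro a b c
      rw [← ite_and, ← ite_and]
      simp [lt, neg, conj, add, eq, val, BinOp.app]
      split_ifs <;> simp_all
    simp only [cubeExpr, val_sum, Store.setVar_var, OfNat.zero_ne_ofNat, if_false, h0, h,
      Finset.sum_ite_irrel, Finset.sum_const_zero, sum_range_ite_lt hd.le]
    ring
  rw [thresholdExpr, val_sum, h0, ← Nat.mul_one (threshold n),
    ← sum_range_ite_lt (threshold_le n) 1]
  refine Finset.sum_congr rfl fun d hd => ?_
  have hd := Finset.mem_range.1 hd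
  have e := hcube d hd
  simp [lt, val, BinOp.app, e, h0, h27, lt_threshold_iff]

theorem sizeLE_setVar {s : Store} {M : ℕ} (h : s.SizeLE M) {x m : ℕ} (hm : m ≤ M) :
    (s.setVar x m).SizeLE M := by
  intro r hr
  rw [Store.setVar_var]
  split_ifs
  exacts [hm, h r hr]

theorem sizeLE_run {c : Cmd} (hc : c.KeepsSizes) {s : Store} {M : ℕ} (h : s.SizeLE M) :
    (c.run s).SizeLE M := fun r hr => by
  rw [keepsSizes_run hc s hr]
  exact h r hr

theorem run_paramsCmd {s : Store} (h0 : s.var 0 = n) (h1 : s.var 1 = k) (h2 : s.var 2 = n * k)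
    (hn : 0 < n) (hM : s.SizeLE (2 ^ sizeExponent k n)) :
    (∀ x, x < 3 ∨ x = 24 → (paramsCmd.run s).var x = s.var x) ∧
    (∀ b < 19, (paramsCmd.run s).arr b = s.arr b) ∧
    (paramsCmd.run s).var 3 = assignCount k n ∧ (paramsCmd.run s).var 4 = guessCount n ∧
    (paramsCmd.run s).var 5 = (n * k) ^ assignCount k n ∧
    (paramsCmd.run s).var 6 = k ^ guessCount n ∧ (paramsCmd.run s).var 7 = threshold n ∧
    paramsCmd.SizeLE (2 ^ sizeExponent k n) s ∧
    (paramsCmd.run s).SizeLE (2 ^ sizeExponent k n) := by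
  obtain ⟨-, -, -, b7, b3, b4, b5, b6⟩ := sizes_le k n
  generalize 2 ^ sizeExponent k n = M at *
  obtain ⟨k₁, v₁⟩ := run_digitCountCmd h0 hn
  have m₁ := sizeLE_run ok_digitCountCmd.2 hM
  have z₁ := sizeLE_of_keepsSizes ok_digitCountCmd.2 hM
  rw [paramsCmd]
  simp only [Cmd.run, Cmd.SizeLE]
  generalize digitCountCmd.run s = s₁ at *
  rw [val_thresholdExpr (by rw [k₁.1 0 (by omega), h0]) v₁]
  have m₂ := sizeLE_setVar m₁ (x := 7) b7
  have e3 : (add (divExpr (var 2) 7 2) (const 1)).val (s₁.setVar 7 (threshold n)) =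
      assignCount k n := by
    rw [val_add, val_divExpr (x := n * k) (B := threshold n) (M := n * k) (by omega)
      (by simp [k₁.1 2, h2]) (by simp) (by simp [k₁.1 2, h2]) (threshold_pos hn)
      (Nat.div_le_self _ _)]
    rfl
  rw [e3]
  have m₃ := sizeLE_setVar m₂ (x := 3) b3
  have e4 : (add (const 1) (.sum 8 7 (add (const 2) (.sum 9 7 (const 4))))).val
      ((s₁.setVar 7 (threshold n)).setVar 3 (assignCount k n)) = guessCount n := by
    simp [guessCount]
    ring
  rw [e4]
  have m₄ := sizeLE_setVar m₃ (x := 4) b4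
  set s₄ := ((s₁.setVar 7 (threshold n)).setVar 3 (assignCount k n)).setVar 4 (guessCount n)
    with hs₄
  have p₅ := ok_powCmd (b := 2) (r := 3) (by omega) (by omega)
  obtain ⟨k₅, v₅⟩ := run_powCmd (b := 2) (r := 3) (by omega) (by omega) s₄ 19
  have m₅ := sizeLE_run p₅.2 m₄
  have z₅ := sizeLE_of_keepsSizes p₅.2 m₄
  have f₄ : s₄.var 0 = n ∧ s₄.var 1 = k ∧ s₄.var 2 = n * k ∧ s₄.var 3 = assignCount k n ∧
      s₄.var 4 = guessCount n ∧ s₄.var 7 = threshold n ∧ s₄.var 24 = s.var 24 := by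
    simp [hs₄, k₁.1 0, k₁.1 1, k₁.1 2, k₁.1 24, h0, h1, h2]
  have a₄ : s₄.arr = s₁.arr := rfl
  clear_value s₄
  obtain ⟨f0, f1, f2, f3, f4, f7, f24⟩ := f₄
  generalize (powCmd 2 3).run s₄ = s₅ at *
  have e5 : s₅.var 28 = (n * k) ^ assignCount k n := by rw [v₅, f2, f3]
  rw [val_var, e5]
  have m₆ := sizeLE_setVar m₅ (x := 5) b5
  set s₆ := s₅.setVar 5 ((n * k) ^ assignCount k n) with hs₆
  have p₇ := ok_powCmd (b := 1) (r := 4) (by omega) (by omega)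
  obtain ⟨k₇, v₇⟩ := run_powCmd (b := 1) (r := 4) (by omega) (by omega) s₆ 19
  have m₇ := sizeLE_run p₇.2 m₆
  have z₇ := sizeLE_of_keepsSizes p₇.2 m₆
  have g₆ : ∀ x, x ≠ 5 → x < 8 ∨ x = 24 → s₆.var x = s₄.var x := fun x hx hx' => by
    rw [hs₆, Store.setVar_var, if_neg hx, k₅.1 x (by omega)]
  have g5 : s₆.var 5 = (n * k) ^ assignCount k n := by simp [hs₆]
  have a₆ : s₆.arr = s₅.arr := rfl
  clear_value s₆
  generalize (powCmd 1 4).run s₆ = s₇ at *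
  have e6 : s₇.var 28 = k ^ guessCount n := by
    rw [v₇, g₆ 1 (by omega) (by omega), g₆ 4 (by omega) (by omega), f1, f4]
  rw [val_var, e6]
  have g : ∀ x, x ≠ 5 → x ≠ 6 → x < 8 ∨ x = 24 →
      (s₇.setVar 6 (k ^ guessCount n)).var x = s₄.var x :=
    fun x hx hx6 hx' => by rw [Store.setVar_var, if_neg hx6, k₇.1 x (by omega), g₆ x hx hx']
  refine ⟨?_, fun b hb => ?_, ?_, ?_, ?_, ?_, ?_, ⟨z₁, m₁, m₂, m₃, z₅, m₅, z₇, m₇⟩,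
    sizeLE_setVar m₇ b6⟩
  · rintro x (hx | rfl)
    · rw [g x (by omega) (by omega) (by omega)]
      interval_cases x
      exacts [f0.trans h0.symm, f1.trans h1.symm, f2.trans h2.symm]
    · rw [g 24 (by omega) (by omega) (by omega), f24]
  · rw [Store.setVar_arr, k₇.2 b hb, a₆, k₅.2 b hb, a₄, k₁.2 b hb]
  · rw [g 3 (by omega) (by omega) (by omega), f3]
  · rw [g 4 (by omega) (by omega) (by omega), f4]
  · rw [Store.setVar_var, if_neg (by omega), k₇.1 5 (by omega), g5]
  · rw [Store.setVar_var, if_pos rfl]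
  · rw [g 7 (by omega) (by omega) (by omega), f7]

/-! ### The time bound -/

/-- A polynomial is bounded by a monomial whose coefficient is a power of two. -/
theorem exists_eval_le (q : Polynomial ℕ) :
    ∃ a e : ℕ, ∀ M, 1 ≤ M → q.eval M ≤ 2 ^ a * M ^ e := by
  refine ⟨∑ i ∈ Finset.range (q.natDegree + 1), q.coeff i, q.natDegree, fun M hM => ?_⟩
  rw [Polynomial.eval_eq_sum_range]
  refine le_trans ?_ (Nat.mul_le_mul_right _ Nat.lt_two_pow_self.le)
  rw [Finset.sum_mul]
  refine Finset.sum_le_sum fun i hi => Nat.mul_le_mul_left _ ?_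
  exact Nat.pow_le_pow_right hM (Nat.lt_succ_iff.1 (Finset.mem_range.1 hi))

theorem digitCount_le_log (hn : 2 ≤ n) : (digitCount n : ℝ) ≤ 4 * Real.log n := by
  have h2 : 0.6931471803 < Real.log 2 := Real.log_two_gt_d9
  have hlog : Real.log 2 ≤ Real.log n := Real.log_le_log (by norm_num) (by exact_mod_cast hn)
  have h1 : (Nat.log 2 n : ℝ) ≤ Real.log n / Real.log 2 := by
    simpa [Real.logb] using Real.natLog_le_logb n 2
  rw [le_div_iff₀ (by linarith)] at h1
  have h3 : (0 : ℝ) ≤ Nat.log 2 n := Nat.cast_nonneg _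
  rw [digitCount, Nat.cast_add, Nat.cast_one]
  nlinarith

/-- The exponent in terms of the cube root `x` of `n log n`: both summands are quadratic in `x`. -/
theorem sizeExponent_le (hn : 0 < n) {x : ℝ} (hx : 0 < x) (hx3 : x ^ 3 = n * digitCount n) :
    (sizeExponent k n : ℝ) ≤ (((k + 1) * (k + 2) + 21 * (k + 1) : ℕ) : ℝ) * x ^ 2 := by
  set l : ℝ := ((digitCount n : ℕ) : ℝ) with hl
  set d : ℝ := ((threshold n : ℕ) : ℝ) with hd
  have hn1 : (1 : ℝ) ≤ n := by exact_mod_cast hn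
  have hl1 : (1 : ℝ) ≤ l := by simp [hl, digitCount]
  have hln : l ≤ n := Nat.cast_le.2 (digitCount_le hn)
  have hx1 : 1 ≤ x := by
    by_contra! h
    have : x ^ 3 < 1 := pow_lt_one₀ hx.le h (by omega)
    nlinarith
  -- the logarithm is at most `x ^ 2`, since its cube is at most `n ^ 2 * l ^ 2`
  have hlx : l ≤ x ^ 2 := by
    refine le_of_pow_le_pow_left₀ (n := 3) (by omega) (by positivity) ?_
    calc l ^ 3 = l ^ 2 * l := by ring
      _ ≤ l ^ 2 * (n * n) := by gcongr; nlinarith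
      _ = (x ^ 3) ^ 2 := by rw [hx3]; ring
      _ = (x ^ 2) ^ 3 := by ring
  have hxd : x ≤ d := by
    refine le_of_pow_le_pow_left₀ (n := 3) (by omega) (by positivity) ?_
    rw [hx3, hl, hd]
    have := threshold_spec n
    calc (n : ℝ) * digitCount n = ((n * digitCount n : ℕ) : ℝ) := by push_cast; rfl
      _ ≤ ((threshold n * threshold n * threshold n : ℕ) : ℝ) := by exact_mod_cast this
      _ = _ := by push_cast; ring
  have hdx : d ≤ 2 * x := by
    obtain ⟨m, hm⟩ : ∃ m, threshold n = m + 1 := ⟨_, (Nat.succ_pred (threshold_pos hn).ne').symm⟩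
    have h1 : m * m * m < n * digitCount n := lt_threshold_iff.1 (by omega)
    have h2 : (m : ℝ) ^ 3 < x ^ 3 := by
      rw [hx3]
      calc (m : ℝ) ^ 3 = ((m * m * m : ℕ) : ℝ) := by push_cast; ring
        _ < ((n * digitCount n : ℕ) : ℝ) := by exact_mod_cast h1
        _ = _ := by push_cast; rfl
    have h3 : (m : ℝ) < x := lt_of_pow_lt_pow_left₀ 3 hx.le h2
    rw [hd, hm]
    push_cast
    linarith
  have hk0 : (0 : ℝ) ≤ k := Nat.cast_nonneg k
  have hs : (assignCount k n : ℝ) ≤ n * k / x + 1 := by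
    have : ((n * k / threshold n : ℕ) : ℝ) ≤ ((n * k : ℕ) : ℝ) / d := Nat.cast_div_le
    rw [assignCount, Nat.cast_add, Nat.cast_one]
    refine add_le_add (this.trans ?_) le_rfl
    rw [Nat.cast_mul]
    gcongr
  have hls : l * assignCount k n ≤ (k + 1) * x ^ 2 := by
    calc l * assignCount k n ≤ l * (n * k / x + 1) := by gcongr
      _ = k * (n * l) / x + l := by ring
      _ = k * x ^ 2 + l := by rw [← hx3]; field_simp
      _ ≤ (k + 1) * x ^ 2 := by linarith
  have hg : (guessCount n : ℝ) ≤ 21 * x ^ 2 := by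
    have : (guessCount n : ℝ) = 1 + 2 * d + 2 * d * (2 * d) := by
      rw [guessCount, hd]; push_cast; rfl
    rw [this]
    nlinarith
  have hlk : l + k ≤ (k + 1) * l := by nlinarith
  have hE : (sizeExponent k n : ℝ) = (l + k) * (assignCount k n + 1) + (k + 1) * guessCount n := by
    rw [sizeExponent, hl]; push_cast; rfl
  rw [hE]
  push_cast
  calc (l + k) * (assignCount k n + 1) + (k + 1) * guessCount n
      ≤ (k + 1) * l * (assignCount k n + 1) + (k + 1) * (21 * x ^ 2) := by gcongr
    _ = (k + 1) * (l * assignCount k n + l) + (k + 1) * (21 * x ^ 2) := by ring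
    _ ≤ (k + 1) * ((k + 1) * x ^ 2 + x ^ 2) + (k + 1) * (21 * x ^ 2) := by gcongr
    _ = _ := by ring

theorem isBigO_sizeExponent (k a e : ℕ) :
    (fun n : ℕ => ((a + e * sizeExponent k n : ℕ) : ℝ)) =O[Filter.atTop]
      (fun n : ℕ => (n : ℝ) ^ (2 / 3 : ℝ) * Real.log n ^ (2 / 3 : ℝ)) := by
  set C : ℝ := (((k + 1) * (k + 2) + 21 * (k + 1) : ℕ) : ℝ)
  refine Asymptotics.IsBigO.of_bound ((a + e) * (C * 4 ^ (2 / 3 : ℝ))) ?_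
  filter_upwards [Filter.eventually_ge_atTop 2] with n hn
  have hlog : 0 ≤ Real.log n := Real.log_natCast_nonneg n
  have hy : (0 : ℝ) < n * digitCount n := by
    have : 0 < n * digitCount n := Nat.mul_pos (by omega) (by simp [digitCount])
    exact_mod_cast this
  set x : ℝ := (n * digitCount n : ℝ) ^ (1 / 3 : ℝ) with hx
  have hx0 : 0 < x := Real.rpow_pos_of_pos hy _
  have hx3 : x ^ 3 = n * digitCount n := by
    rw [hx, ← Real.rpow_natCast, ← Real.rpow_mul hy.le]
    norm_num
  have hx2 : x ^ 2 ≤ 4 ^ (2 / 3 : ℝ) * ((n : ℝ) ^ (2 / 3 : ℝ) * Real.log n ^ (2 / 3 : ℝ)) := by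
    calc x ^ 2 = (n * digitCount n : ℝ) ^ (2 / 3 : ℝ) := by
          rw [hx, ← Real.rpow_natCast, ← Real.rpow_mul hy.le]
          norm_num
      _ ≤ (4 * (n * Real.log n)) ^ (2 / 3 : ℝ) := by
          refine Real.rpow_le_rpow hy.le ?_ (by norm_num)
          nlinarith [digitCount_le_log hn, (Nat.cast_nonneg n : (0 : ℝ) ≤ n)]
      _ = _ := by
          rw [Real.mul_rpow (by norm_num) (by positivity), Real.mul_rpow (by positivity) hlog]
  have hE : (sizeExponent k n : ℝ) ≤ C * x ^ 2 := sizeExponent_le (by omega) hx0 hx3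
  have hE1 : (1 : ℝ) ≤ sizeExponent k n := by
    have : 1 ≤ sizeExponent k n :=
      Nat.le_add_right_of_le (Nat.mul_pos (by simp [digitCount]) (by omega))
    exact_mod_cast this
  have hC : 0 ≤ C := Nat.cast_nonneg _
  rw [Real.norm_of_nonneg (Nat.cast_nonneg _), Real.norm_of_nonneg (by positivity)]
  have ha : (0 : ℝ) ≤ a := Nat.cast_nonneg a
  calc ((a + e * sizeExponent k n : ℕ) : ℝ) = a + e * sizeExponent k n := by push_cast; rfl
    _ ≤ (a + e) * sizeExponent k n := by nlinarith
    _ ≤ (a + e) * (C * (4 ^ (2 / 3 : ℝ) *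
        ((n : ℝ) ^ (2 / 3 : ℝ) * Real.log n ^ (2 / 3 : ℝ)))) := by
      gcongr
      exact hE.trans (by gcongr)
    _ = _ := by ring

theorem SolvesInTime.mono {H : LoopGraph (Fin k)} {d : ℕ} {p : Program} {T T' : ℕ → ℝ}
    (h : SolvesInTime H d p T) (hT : ∀ n, T n ≤ T' n) : SolvesInTime H d p T' := by
  intro n G L hG
  obtain ⟨t, s, hex, ht, hs⟩ := h n G L hG
  exact ⟨t, s, hex, ht.trans (hT n), hs⟩

theorem exists_subexponential_program {H : LoopGraph (Fin k)} (hconn : H.Connected)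
    (hdeg : ∀ x, H.degree x ≤ 2) (hex : H.IsExceptional) :
    ∃ (p : Program) (f : ℕ → ℝ),
      f =O[Filter.atTop] (fun n : ℕ => (n : ℝ) ^ (2 / 3 : ℝ) * Real.log n ^ (2 / 3 : ℝ)) ∧
      SolvesInTime H 3 p (fun n => (2 : ℝ) ^ f n) := by
  have hk : 0 < k := by
    obtain ⟨x⟩ := hconn.nonempty
    exact x.pos
  have hok : (answerCmd H (.seq paramsCmd searchCmd)).Ok :=
    ⟨ok_initCmd H, ⟨ok_paramsCmd, ok_searchCmd.1⟩, by simp [Cmd.Ok, SumExpr.Ok, lt]⟩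
  obtain ⟨a, e, hae⟩ := exists_eval_le (answerCmd H (.seq paramsCmd searchCmd)).time
  refine ⟨_, _, isBigO_sizeExponent k a e,
    (solvesInTime_compile hok (fun n => 2 ^ sizeExponent k n) ?_).mono fun n => ?_⟩
  · intro n G L hG
    have hn : 0 < n := by
      rcases Nat.eq_zero_or_pos n with rfl | hn
      · rw [SimpleGraph.ediam_eq_zero_of_subsingleton] at hG
        norm_num at hG
      · exact hn
    have hN : 0 < n * k := Nat.mul_pos hn hk
    obtain ⟨b1, b2, b3, -⟩ := sizes_le k n
    obtain ⟨hB, hL, hz, hsz⟩ := run_initCmd H G L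
    obtain ⟨hsz, hsz'⟩ := hsz _ b1 b2 b3
    obtain ⟨p0, pa, p3, p4, p5, p6, p7, pz, pz'⟩ :=
      run_paramsCmd hB.n_eq hB.k_eq hB.nk_eq hn hsz'
    have hB' : Base H G (paramsCmd.run ((initCmd H).run (input G L))) :=
      { n_eq := by rw [p0 0 (by omega), hB.n_eq]
        k_eq := by rw [p0 1 (by omega), hB.k_eq]
        nk_eq := by rw [p0 2 (by omega), hB.nk_eq]
        adj := by rw [pa 0 (by omega)]; exact hB.adj
        vertex := by rw [pa 2 (by omega)]; exact hB.vertex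
        color := by rw [pa 3 (by omega)]; exact hB.color
        compat := by rw [pa 4 (by omega)]; exact hB.compat }
    have hL' : ListAt 6 (fun v c => c ∈ L v) (paramsCmd.run ((initCmd H).run (input G L))) := by
      unfold ListAt
      rw [pa 6 (by omega)]
      exact hL
    have hacc : ((Cmd.seq paramsCmd searchCmd).run ((initCmd H).run (input G L))).var 24 ≠ 0 ↔
        H.HasListHom G L := by
      rw [Cmd.run, run_searchCmd hB' hL' hk hN (by rw [p5, p3]) (by rw [p6, p4]), p0 24 (by omega),
        hz 24 (by omega), p3, p4, p7, exists_accepts_iff hex.noSquare hdeg (ediam_bound hG) hn hk hN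
          _ (t := guessCount n) (threshold_pos hn) (le_assignCount_mul hn) le_rfl, hasListHom_iff]
      simp
    refine ⟨⟨hsz, ⟨pz, sizeLE_of_keepsSizes ok_searchCmd.2 pz'⟩, sizeLE_run ok_searchCmd.2 pz'⟩,
      fun h => ?_, fun h => ?_⟩
    · rw [run_answerCmd, if_pos (Nat.pos_of_ne_zero (hacc.2 h))]
    · rw [run_answerCmd, if_neg (fun h' => h (hacc.1 h'.ne'))]
  · rw [Real.rpow_natCast]
    refine le_trans (Nat.cast_le.2 (hae _ Nat.one_le_two_pow)) ?_
    rw [← pow_mul, ← pow_add, mul_comm e]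
    push_cast
    exact le_rfl

end ListColoring

theorem mainTheorem5 (k : ℕ) (H : LoopGraph (Fin k)) (hconn : H.Connected)
    (hdeg : ∀ x, H.degree x ≤ 2) :
    (¬ H.IsExceptional →
      ∃ (p : RAM.Program) (q : Polynomial ℕ),
        ListColoring.SolvesInTime H 3 p (fun n => ((q.eval n : ℕ) : ℝ))) ∧
    (H.IsExceptional →
      ∃ (p : RAM.Program) (f : ℕ → ℝ),
        f =O[Filter.atTop] (fun n : ℕ => (n : ℝ) ^ (2 / 3 : ℝ) * Real.log n ^ (2 / 3 : ℝ)) ∧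
        ListColoring.SolvesInTime H 3 p (fun n => (2 : ℝ) ^ f n)) := by
  exact ⟨ListColoring.exists_polynomial_program hconn hdeg,
    ListColoring.exists_subexponential_program hconn hdeg⟩
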